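/- **Setting.** The elementary gates are NOT, CNOT, controlled-$V$ and controlled-$V^\dagger$, where $V=\frac{1+i}{2}\begin{pmatrix}1&-i\\-i&1\end{pmatrix}$. A permutation of $\{0,1\}^n$ is synthesized on $n$ lines, plus one ancilla line if it is odd; the ancilla may have any value and is returned unchanged. Let $n\ge 6$ and $k=\lfloor n/2\rfloor$, and identify a term $x\in\{0,1\}^n$ with the set of positions $i$ ($0\le i<n$) with $x_i=1$, written relative to $k$ (so $\{2,-1\}$ has ones exactly at $k+2$ and $k-1$). **Elementary cycles.** These are the cycles and pairs of disjoint cycles of the types below. For each type, the list gives the prescribed terms $T_1,T_2,\dots$ in the order in which they are treated, and the fixed permutation $\kappa_0$. - (2): $\{1\},\{1,0\}$; $\kappa_0=(T_1T_2)$. - (2,2): $\{2\},\{2,-1\},\{2,0\},\{2,0,-1\}$; $\kappa_0=(T_1T_2)(T_3T_4)$. - (3): $\{-1\},\{1,-1\},\{1,0,-1\}$; $\kappa_0=(T_1T_2T_3)$. - (3,3): $\{-2\},\{-1,-2\},\{0,-1,-2\},\{2,-2\},\{2,-1,-2\},\{2,0,-1,-2\}$; $\kappa_0=(T_1T_2T_3)(T_4T_5T_6)$.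 - (4): the terms of (2,2); $\kappa_0=(T_1T_2T_3T_4)$. - (4,2): the terms of (2,2), then $\{2,0,-1,-2\},\{2,-1,-2\}$; $\kappa_0=(T_1T_2T_3T_4)(T_5T_6)$. - (4,4): $\{2\},\{2,-2\},\{2,-1\},\{2,-1,-2\},\{2,0\},\{2,0,-2\},\{2,0,-1\},\{2,0,-1,-2\}$; $\kappa_0=(T_1T_2T_3T_4)(T_5T_6T_7T_8)$. - (5): $\{2\},\{2,-2\},\{2,-1\},\{2,-1,-2\},\{2,0,-1,-2\}$; $\kappa_0=(T_1T_4T_2T_3T_5)$. - (5,5): $\{2\},\{2,-3\},\{2,-2\},\{2,-2,-3\},\{2,0\},\{2,0,-3\},\{2,0,-2\},\{2,0,-2,-3\},\{2,0,-1,-2,-3\},\{2,-1,-2,-3\}$; $\kappa_0=(T_1T_4T_2T_3T_{10})(T_5T_8T_6T_7T_9)$. **Synthesis.** The permutation $\sigma$ is written as a product of elementary cycles: every cycle of $\sigma$ of length less than $6$ is used as it is, and every longer one is decomposed into cycles of length less than $6$ on its own terms. Each elementary cycle, or pair of disjoint elementary cycles, is implemented by a subcircuit $\pi\,\kappa_0\,\pi^{-1}$.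 - The circuit $\pi$ moves the input terms one after the other to $T_1,T_2,\dots$ without disturbing the terms already fixed. The first term is moved by NOT gates. A later term that is not yet in place is moved as follows. If necessary, its pivot bit (prescribed below) is set by one CNOT or Toffoli gate with positive or negative controls, a Toffoli gate being allowed only for terms 4–6 of (3,3), 6 of (4,2), 6 and 7 of (4,4), and 6, 7 and 10 of (5,5). Then each remaining wrong bit is corrected by a CNOT, first on the lines from $0$ up to the pivot and then from $n-1$ down to the pivot. The control of this CNOT is a line other than the target, on the same side of the pivot (or the pivot itself), where the present term is $1$ and all fixed terms are $0$, as close to the target as possible. The CNOTs produce the intermediate term, which is the final term with the pivot bit set; if the final term does not contain the pivot, a static gate listed below then clears the pivot. - Pivots of the second, third, … terms: (2): $0$; (2,2) and (4): $-1,0,1$; (3): $1,0$; (3,3): $-1,0,2,1,1$; (4,2): $-1,0,1,-2,1$; (4,4): $-2,-1,0,0,1,1,1$; (5): $-2,-1,1,0$; (5,5): $-3,-2,-1,0,1,1,1,-1,1$. - Controls of the static gates (target: the pivot; $\bar 0$ is a negative control on line $k$, all others are positive): (2,2), (4) and (4,2), term 4: $-1,0$; (3,3), terms 5 and 6: $-1,2$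 and $0,2$; (4,2), term 6: $-2,\bar 0$; (4,4), terms 4, 6, 7, 8: $-2,-1$; $-2,0$; $-1,0$; $-2,-1,0$; (5), term 4: $-2,-1$; (5,5), terms 4, 6, 7, 8, 10: $-3,-2$; $-3,0$; $-2,0$; $-3,-2,0$; $-1,\bar 0$. - Every NOT, CNOT and Toffoli gate of $\pi$ is realized by elementary gates, $\kappa_0$ is an elementary-gate circuit that realizes the fixed permutation, and $\pi^{-1}$ is the inverse circuit. - In the linear nearest neighbour (LNN) architecture two-line gates may act only on adjacent lines. The LNN version of a circuit is obtained by surrounding each gate on non-adjacent lines by SWAPs of adjacent lines (three CNOTs each), which bring its lines together and are undone afterwards. **Theorem.** There are functions $r_1(n)=o(n^2)$ and $r_2(n)=o(n^3)$ such that for all $n\ge 6$ every permutation $\sigma$ of $\{0,1\}^n$ is realized by a circuit $C$ obtained in this way with at most $$9.4\,n2^n-18.8\cdot 2^n+r_1(n)$$ elementary gates, and such that $C$ has an LNN version, which also realizes $\sigma$, with at most $$42.4\,n^22^n+r_2(n)$$ elementary gates. -/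

import Mathlib

open scoped Asymptotics

/-! ### Elementary gates and their circuits -/

/-- Bit patterns ("terms") on `n` lines; line `i` is bit position `i`. -/
abbrev Term (n : ℕ) : Type := Fin n → Bool

/-- The three two-line elementary gates: CNOT, controlled-V and controlled-V†. -/
inductive Kind : Type
  | x
  | v
  | vdg

/-- The one-line matrix that a two-line elementary gate applies to its target. -/
noncomputable def Kind.mat : Kind → Bool → Bool → ℂ
  | .x, a, b => if a = b then 0 else 1
  | .v, a, b => (1 + Complex.I) / 2 * (if a = b then 1 else -Complex.I)
  | .vdg, a, b => (1 - Complex.I) / 2 * (if a = b then 1 else Complex.I)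

/-- An elementary gate on `m` lines: NOT, or a two-line gate with control `c` and target `t`. -/
inductive Gate (m : ℕ) : Type
  | not (t : Fin m)
  | ctrl (κ : Kind) (c t : Fin m) (h : c ≠ t)

/-- The action of an elementary gate on a state vector of `m` qubits. -/
noncomputable def Gate.act {m : ℕ} : Gate m → (Term m → ℂ) → (Term m → ℂ)
  | .not t, ψ => fun x => ψ (Function.update x t (!x t))
  | .ctrl κ c t _, ψ => fun x =>
      if x c = true then ∑ b : Bool, κ.mat (x t) b * ψ (Function.update x t b) else ψ x

/-- The inverse gate. -/
def Gate.inv {m : ℕ} : Gate m → Gate m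
  | .not t => .not t
  | .ctrl .x c t h => .ctrl .x c t h
  | .ctrl .v c t h => .ctrl .vdg c t h
  | .ctrl .vdg c t h => .ctrl .v c t h

/-- A circuit: a list of elementary gates, the head is applied first.  Its number of elementary
gates is its length. -/
abbrev Circuit (m : ℕ) : Type := List (Gate m)

/-- The action of a circuit on a state vector. -/
noncomputable def Circuit.run {m : ℕ} (C : Circuit m) (ψ : Term m → ℂ) : Term m → ℂ :=
  C.foldl (fun φ g => g.act φ) ψ

/-- The inverse circuit. -/
def Circuit.inv {m : ℕ} (C : Circuit m) : Circuit m := (C.map Gate.inv).reverse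

/-- The computational basis state of a term. -/
noncomputable def ket {m : ℕ} (x : Term m) : Term m → ℂ := Pi.single x 1

/-- A circuit on `n` lines and `a` further lines (ancillae) realizes a function `f` on the `n`
lines, leaving the ancillae, whatever their values, unchanged. -/
def Realizes {n a : ℕ} (C : Circuit (n + a)) (f : Term n → Term n) : Prop :=
  ∀ (x : Term n) (y : Term a), C.run (ket (Fin.append x y)) = ket (Fin.append (f x) y)

/-! ### NOT, CNOT and Toffoli gates with positive and negative controls -/

/-- A multiple-control Toffoli gate with positive controls `pos` and negative controls `neg`. -/
structure Toffoli (n : ℕ) : Type where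
  pos : Finset (Fin n)
  neg : Finset (Fin n)
  target : Fin n

/-- The controls and the target are distinct lines. -/
def Toffoli.Valid {n : ℕ} (g : Toffoli n) : Prop :=
  Disjoint g.pos g.neg ∧ g.target ∉ g.pos ∧ g.target ∉ g.neg

/-- The controls of the gate are satisfied by the term. -/
def Toffoli.Fires {n : ℕ} (g : Toffoli n) (x : Term n) : Prop :=
  (∀ i ∈ g.pos, x i = true) ∧ (∀ i ∈ g.neg, x i = false)

instance {n : ℕ} (g : Toffoli n) (x : Term n) : Decidable (g.Fires x) :=
  inferInstanceAs (Decidable (_ ∧ _))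

/-- The gate as a function on terms. -/
def Toffoli.act {n : ℕ} (g : Toffoli n) (x : Term n) : Term n :=
  if g.Fires x then Function.update x g.target (!x g.target) else x

/-- A list of gates as a function on terms, the head is applied first. -/
def Toffoli.run {n : ℕ} (gs : List (Toffoli n)) (x : Term n) : Term n :=
  gs.foldl (fun y g => g.act y) x

/-- The NOT gate. -/
def notGate {n : ℕ} (t : Fin n) : Toffoli n := ⟨∅, ∅, t⟩

/-- The CNOT gate with a positive control. -/
def cnotGate {n : ℕ} (c t : Fin n) : Toffoli n := ⟨{c}, ∅, t⟩

/-! ### Elementary cycles: data -/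

/-- How one input term of an elementary cycle is handled.  All positions are given relative to
the middle line `k = ⌊n/2⌋`. -/
structure Row : Type where
  /-- the pivot -/
  pivot : ℤ
  /-- the largest number of controls of the gate that sets the pivot: `1` CNOT, `2` Toffoli -/
  maxControls : ℕ
  /-- the positions that are `1` in the intermediate term -/
  mid : List ℤ
  /-- the positive and the negative controls of the static gate, whose target is the pivot;
  `none` if there is no static gate -/
  static : Option (List ℤ × List ℤ)
  /-- the positions that are `1` in the final (`κ₀`) term -/
  final : List ℤ

/-- The data of an elementary cycle, or pair of elementary cycles: the number of terms, the cycles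
written by the indices of their terms in the order in which these are treated, and the rows. -/
structure CycleType : Type where
  size : ℕ
  cycles : List (List (Fin size))
  row : Fin size → Row

def type2 : CycleType where
  size := 2
  cycles := [[0, 1]]
  row := ![⟨1, 0, [1], none, [1]⟩,
    ⟨0, 1, [1, 0], none, [1, 0]⟩]

def type22 : CycleType where
  size := 4
  cycles := [[0, 1], [2, 3]]
  row := ![⟨2, 0, [2], none, [2]⟩,
    ⟨-1, 1, [2, -1], none, [2, -1]⟩,
    ⟨0, 1, [2, 0], none, [2, 0]⟩,
    ⟨1, 1, [2, 1, 0, -1], some ([-1, 0], []), [2, 0, -1]⟩]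

def type3 : CycleType where
  size := 3
  cycles := [[0, 1, 2]]
  row := ![⟨-1, 0, [-1], none, [-1]⟩,
    ⟨1, 1, [1, -1], none, [1, -1]⟩,
    ⟨0, 1, [1, 0, -1], none, [1, 0, -1]⟩]

def type33 : CycleType where
  size := 6
  cycles := [[0, 1, 2], [3, 4, 5]]
  row := ![⟨-2, 0, [-2], none, [-2]⟩,
    ⟨-1, 1, [-1, -2], none, [-1, -2]⟩,
    ⟨0, 1, [0, -1, -2], none, [0, -1, -2]⟩,
    ⟨2, 2, [2, -2], none, [2, -2]⟩,
    ⟨1, 2, [2, 1, -1, -2], some ([-1, 2], []), [2, -1, -2]⟩,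
    ⟨1, 2, [2, 1, 0, -1, -2], some ([0, 2], []), [2, 0, -1, -2]⟩]

def type4 : CycleType where
  size := 4
  cycles := [[0, 1, 2, 3]]
  row := ![⟨2, 0, [2], none, [2]⟩,
    ⟨-1, 1, [2, -1], none, [2, -1]⟩,
    ⟨0, 1, [2, 0], none, [2, 0]⟩,
    ⟨1, 1, [2, 1, 0, -1], some ([-1, 0], []), [2, 0, -1]⟩]

def type42 : CycleType where
  size := 6
  cycles := [[0, 1, 2, 3], [4, 5]]
  row := ![⟨2, 0, [2], none, [2]⟩,
    ⟨-1, 1, [2, -1], none, [2, -1]⟩,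
    ⟨0, 1, [2, 0], none, [2, 0]⟩,
    ⟨1, 1, [2, 1, 0, -1], some ([-1, 0], []), [2, 0, -1]⟩,
    ⟨-2, 1, [2, 0, -1, -2], none, [2, 0, -1, -2]⟩,
    ⟨1, 2, [2, 1, -1, -2], some ([-2], [0]), [2, -1, -2]⟩]

def type44 : CycleType where
  size := 8
  cycles := [[0, 1, 2, 3], [4, 5, 6, 7]]
  row := ![⟨2, 0, [2], none, [2]⟩,
    ⟨-2, 1, [2, -2], none, [2, -2]⟩,
    ⟨-1, 1, [2, -1], none, [2, -1]⟩,
    ⟨0, 1, [2, 0, -1, -2], some ([-2, -1], []), [2, -1, -2]⟩,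
    ⟨0, 1, [2, 0], none, [2, 0]⟩,
    ⟨1, 2, [2, 1, 0, -2], some ([-2, 0], []), [2, 0, -2]⟩,
    ⟨1, 2, [2, 1, 0, -1], some ([-1, 0], []), [2, 0, -1]⟩,
    ⟨1, 1, [2, 1, 0, -1, -2], some ([-2, -1, 0], []), [2, 0, -1, -2]⟩]

def type5 : CycleType where
  size := 5
  cycles := [[0, 3, 1, 2, 4]]
  row := ![⟨2, 0, [2], none, [2]⟩,
    ⟨-2, 1, [2, -2], none, [2, -2]⟩,
    ⟨-1, 1, [2, -1], none, [2, -1]⟩,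
    ⟨1, 1, [2, 1, -1, -2], some ([-2, -1], []), [2, -1, -2]⟩,
    ⟨0, 1, [2, 0, -1, -2], none, [2, 0, -1, -2]⟩]

def type55 : CycleType where
  size := 10
  cycles := [[0, 3, 1, 2, 9], [4, 7, 5, 6, 8]]
  row := ![⟨2, 0, [2], none, [2]⟩,
    ⟨-3, 1, [2, -3], none, [2, -3]⟩,
    ⟨-2, 1, [2, -2], none, [2, -2]⟩,
    ⟨-1, 1, [2, -1, -2, -3], some ([-3, -2], []), [2, -2, -3]⟩,
    ⟨0, 1, [2, 0], none, [2, 0]⟩,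
    ⟨1, 2, [2, 1, 0, -3], some ([-3, 0], []), [2, 0, -3]⟩,
    ⟨1, 2, [2, 1, 0, -2], some ([-2, 0], []), [2, 0, -2]⟩,
    ⟨1, 1, [2, 1, 0, -2, -3], some ([-3, -2, 0], []), [2, 0, -2, -3]⟩,
    ⟨-1, 1, [2, 0, -1, -2, -3], none, [2, 0, -1, -2, -3]⟩,
    ⟨1, 2, [2, 1, -1, -2, -3], some ([-1], [0]), [2, -1, -2, -3]⟩]

/-- The elementary cycles (2), (2,2), (3), (3,3), (4), (4,2), (4,4), (5), (5,5). -/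
def elementaryTypes : List CycleType :=
  [type2, type22, type3, type33, type4, type42, type44, type5, type55]

/-! ### The `π` circuit -/

/-- The position of a line relative to the middle line. -/
def offset {n : ℕ} (i : Fin n) : ℤ := ((i : ℕ) : ℤ) - ((n / 2 : ℕ) : ℤ)

/-- The lines at the given relative positions. -/
def linesAt (n : ℕ) (L : List ℤ) : Finset (Fin n) := Finset.univ.filter (fun i => offset i ∈ L)

/-- The term with `1` exactly at the given relative positions. -/
def bits (n : ℕ) (L : List ℤ) : Term n := fun i => decide (offset i ∈ L)

/-- `F` is the set of terms that are already fixed, `t` is the present value of the term that is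
treated.  Line `q` may control a CNOT with target `j`: it is `1` in `t` and `0` in each of the fixed
terms, and it lies on the given side of the pivot. -/
def Candidate {n : ℕ} (F : Set (Term n)) (side : Fin n → Prop) (t : Term n) (j q : Fin n) : Prop :=
  q ≠ j ∧ t q = true ∧ (∀ f ∈ F, f q = false) ∧ side q

/-- Candidate `p` is as close as possible to `j`. -/
def Nearest {n : ℕ} (F : Set (Term n)) (side : Fin n → Prop) (t : Term n) (j p : Fin n) : Prop :=
  Candidate F side t j p ∧
    ∀ q, Candidate F side t j q → Nat.dist (p : ℕ) (j : ℕ) ≤ Nat.dist (q : ℕ) (j : ℕ)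

/-- `Sweep F side goal js t gs t'`: going through the lines `js`, each bit of `t` that differs
from `goal` is changed by a CNOT with the nearest candidate as control; the gates are `gs` and the
result is `t'`. -/
inductive Sweep {n : ℕ} (F : Set (Term n)) (side : Fin n → Prop) (goal : Term n) :
    List (Fin n) → Term n → List (Toffoli n) → Term n → Prop
  | nil (t : Term n) : Sweep F side goal [] t [] t
  | skip {j : Fin n} {js : List (Fin n)} {t t' : Term n} {gs : List (Toffoli n)} :
      t j = goal j → Sweep F side goal js t gs t' → Sweep F side goal (j :: js) t gs t'
  | fix {j p : Fin n} {js : List (Fin n)} {t t' : Term n} {gs : List (Toffoli n)} :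
      t j ≠ goal j → Nearest F side t j p →
      Sweep F side goal js ((cnotGate p j).act t) gs t' →
      Sweep F side goal (j :: js) t (cnotGate p j :: gs) t'

/-- Setting the pivot bit `p` of `t` with at most one gate, which has `1` up to `c` controls and
does not act on the fixed terms. -/
def SetPivot {n : ℕ} (F : Set (Term n)) (p : Fin n) (c : ℕ) (t : Term n)
    (gs : List (Toffoli n)) : Prop :=
  (t p = true ∧ gs = []) ∨
  (t p = false ∧ ∃ g : Toffoli n, gs = [g] ∧ g.Valid ∧ g.target = p ∧
    1 ≤ g.pos.card + g.neg.card ∧ g.pos.card + g.neg.card ≤ c ∧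
    g.Fires t ∧ ∀ f ∈ F, ¬ g.Fires f)

/-- The static gate of a row (or none), with target the pivot `p`. -/
def staticGates {n : ℕ} (r : Row) (p : Fin n) : List (Toffoli n) :=
  match r.static with
  | none => []
  | some L => [⟨linesAt n L.1, linesAt n L.2, p⟩]

/-- The gates that bring a term `t` which is not the first one to its final value: none if it is
there already, otherwise set the pivot, create the intermediate term by CNOTs on the lines from
`0` up to the pivot and then on the lines from `n - 1` down to the pivot, apply the static gate. -/
def FixTerm {n : ℕ} (F : Set (Term n)) (r : Row) (t : Term n) (gs : List (Toffoli n)) : Prop :=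
  (t = bits n r.final ∧ gs = []) ∨
  (t ≠ bits n r.final ∧ ∃ (p : Fin n) (g₀ g₁ g₂ : List (Toffoli n)) (t₁ : Term n),
    offset p = r.pivot ∧
    SetPivot F p r.maxControls t g₀ ∧
    Sweep F (fun q => q ≤ p) (bits n r.mid) ((List.finRange n).filter (fun j => j ≤ p))
      (Toffoli.run g₀ t) g₁ t₁ ∧
    Sweep F (fun q => p ≤ q) (bits n r.mid) ((List.finRange n).filter (fun j => p < j)).reverse
      t₁ g₂ (bits n r.mid) ∧
    gs = g₀ ++ g₁ ++ g₂ ++ staticGates r p)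

/-- The NOT gates that bring the first term `t` to its final value. -/
def fixFirst {n : ℕ} (r : Row) (t : Term n) : List (Toffoli n) :=
  ((List.finRange n).filter (fun j => t j ≠ bits n r.final j)).map notGate

/-- The gates for the terms with the indices in the list, when the present values of all terms
are given by `v`. -/
inductive PiSteps (n : ℕ) (τ : CycleType) :
    List (Fin τ.size) → (Fin τ.size → Term n) → List (Toffoli n) → Prop
  | nil (v : Fin τ.size → Term n) : PiSteps n τ [] v []
  | first {i : Fin τ.size} {is : List (Fin τ.size)} {v : Fin τ.size → Term n}
      {hs : List (Toffoli n)} :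
      (i : ℕ) = 0 →
      PiSteps n τ is (fun j => Toffoli.run (fixFirst (τ.row i) (v i)) (v j)) hs →
      PiSteps n τ (i :: is) v (fixFirst (τ.row i) (v i) ++ hs)
  | next {i : Fin τ.size} {is : List (Fin τ.size)} {v : Fin τ.size → Term n}
      {gs hs : List (Toffoli n)} :
      (i : ℕ) ≠ 0 →
      FixTerm (v '' {j | j < i}) (τ.row i) (v i) gs →
      PiSteps n τ is (fun j => Toffoli.run gs (v j)) hs →
      PiSteps n τ (i :: is) v (gs ++ hs)

/-- `gs` is a `π` circuit, in terms of NOT, CNOT and Toffoli gates, for the input terms `v`. -/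
def IsPi {n : ℕ} (τ : CycleType) (v : Fin τ.size → Term n) (gs : List (Toffoli n)) : Prop :=
  PiSteps n τ (List.finRange τ.size) v gs

/-! ### Synthesis -/

/-- The elementary cycle (or pair of cycles) of type `τ` on the terms `v`. -/
def cyclePerm {n : ℕ} (τ : CycleType) (v : Fin τ.size → Term n) : Equiv.Perm (Term n) :=
  (τ.cycles.map (fun l => (l.map v).formPerm)).prod

/-- The fixed permutation that is implemented by the `κ₀` circuit. -/
def kappaPerm (n : ℕ) (τ : CycleType) : Equiv.Perm (Term n) :=
  cyclePerm τ (fun i => bits n (τ.row i).final)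

/-- `B` is a subcircuit `π κ₀ π⁻¹` for the elementary cycle(s) of type `τ` on the distinct
terms `v`, every gate being replaced by elementary gates. -/
def IsBlock {n a : ℕ} (τ : CycleType) (v : Fin τ.size → Term n) (B : Circuit (n + a)) : Prop :=
  Function.Injective v ∧
  ∃ (gs : List (Toffoli n)) (Cs : List (Circuit (n + a))) (K : Circuit (n + a)),
    IsPi τ v gs ∧ List.Forall₂ (fun C g => Realizes C (Toffoli.act g)) Cs gs ∧
    Realizes K (kappaPerm n τ) ∧
    B = Cs.flatten ++ K ++ Circuit.inv Cs.flatten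

/-- The cycle written by the list `l` comes from the cycle decomposition of `σ`: its terms
lie on one cycle of `σ`, and it is this cycle of `σ` if that one has length less than `6`. -/
def ComesFrom {n : ℕ} (σ : Equiv.Perm (Term n)) (l : List (Term n)) : Prop :=
  (∀ x ∈ l, ∀ y ∈ l, σ.SameCycle x y) ∧
  ∀ x ∈ l, (σ.cycleOf x).support.card < 6 → l.formPerm = σ.cycleOf x

/-- `Cascade σ ρ C`: `C` is a cascade of subcircuits for elementary cycles that come from the
cycles of `σ`, and `ρ` is the product of these elementary cycles. -/
inductive Cascade {n a : ℕ} (σ : Equiv.Perm (Term n)) :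
    Equiv.Perm (Term n) → Circuit (n + a) → Prop
  | nil : Cascade σ 1 []
  | cons {τ : CycleType} {v : Fin τ.size → Term n} {B C : Circuit (n + a)}
      {ρ : Equiv.Perm (Term n)} :
      τ ∈ elementaryTypes → (∀ l ∈ τ.cycles, ComesFrom σ (l.map v)) → IsBlock τ v B →
      Cascade σ ρ C → Cascade σ (ρ * cyclePerm τ v) (B ++ C)

/-- `C` is obtained for `σ` by the cycle-based synthesis: `σ` is written as a product of
elementary cycles, and these are implemented one after the other. -/
def CycleSynthesis {n a : ℕ} (σ : Equiv.Perm (Term n)) (C : Circuit (n + a)) : Prop :=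
  Cascade σ σ C

/-- Number of ancillae: none for an even permutation, one for an odd permutation. -/
def ancillae {n : ℕ} (σ : Equiv.Perm (Term n)) : ℕ := if Equiv.Perm.sign σ = 1 then 0 else 1

/-! ### Linear nearest neighbour architecture -/

/-- The lines `i` and `j` are adjacent. -/
def Adjacent {m : ℕ} (i j : Fin m) : Prop := Nat.dist (i : ℕ) (j : ℕ) = 1

/-- The gate can be used in the linear nearest neighbour architecture. -/
def Gate.IsLNN {m : ℕ} : Gate m → Prop
  | .not _ => True
  | .ctrl _ c t _ => Adjacent c t

/-- SWAP of two lines by three CNOT gates. -/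
def swapCircuit {m : ℕ} (i j : Fin m) (h : i ≠ j) : Circuit m :=
  [.ctrl .x i j h, .ctrl .x j i h.symm, .ctrl .x i j h]

/-- `SwapInsert g D`: `D` is the gate `g`, with its control or its target moved by SWAPs of
adjacent lines before `g` and moved back after it, until `g` acts on adjacent lines. -/
inductive SwapInsert {m : ℕ} : Gate m → Circuit m → Prop
  | base {g : Gate m} : g.IsLNN → SwapInsert g [g]
  | control {κ : Kind} {c c' t : Fin m} {h : c ≠ t} {h' : c' ≠ t} {D : Circuit m}
      (hc : c ≠ c') : Adjacent c c' → SwapInsert (.ctrl κ c' t h') D →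
      SwapInsert (.ctrl κ c t h) (swapCircuit c c' hc ++ D ++ swapCircuit c c' hc)
  | target {κ : Kind} {c t t' : Fin m} {h : c ≠ t} {h' : c ≠ t'} {D : Circuit m}
      (ht : t ≠ t') : Adjacent t t' → SwapInsert (.ctrl κ c t' h') D →
      SwapInsert (.ctrl κ c t h) (swapCircuit t t' ht ++ D ++ swapCircuit t t' ht)

/-- `D` is obtained from the circuit `C` by inserting SWAPs around its gates. -/
def LNNVersion {m : ℕ} (C D : Circuit m) : Prop :=
  ∃ Ds : List (Circuit m), List.Forall₂ SwapInsert C Ds ∧ D = Ds.flatten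

/-! The cost of a subcircuit is charged to the terms that it removes from the support of the
remaining permutation: `9n + 300` elementary gates per term, and `40n² + 2800n` after the insertion
of SWAPs. The support has at most `2^n` terms, and a bounded number of unpaired blocks is covered by
32 extra charges (`synth_self`). Since 9 < 9.4 and 40 < 42.4, these totals lie below the stated main
terms for large `n`, and the error functions can be taken to vanish eventually.

Two things have to be paid for. The first is `κ₀`. A ladder of relative-phase Toffoli gates realizes
a Toffoli gate with `c` controls by about `12c` gates if nearly half of the lines are free, and a
commutator of two such gates needs about `24c` if only one line is free
(`exists_computes_posToffoli_of_two_mul_card_le`, `exists_computes_posToffoli_of_card_add_two_le`).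
The NOT gates around negative controls add two per control. So a gate controlled by almost all lines
costs about `26n`, and a fixed permutation at most about `52n`. Its SWAP overhead is bounded by a
factor `6(n + a)`, where `a` is the number of ancillae.

The second is `π` and its inverse. A term takes at most `n` CNOTs besides two gates with at most
three controls. The pivot is always an admissible control, so the nearest control is never farther
than the pivot (`exists_sweep`); as the pivot is near the middle, the distances add up to about
`n²/4` and the SWAPs to about `3n²/2` gates (`sum_dist_win_le`).

All data of the nine types live on six lines around the middle, and every prescribed term is 0
elsewhere. Whatever depends on the type is therefore a finite statement about six-bit patterns,
decided by computation and transported along `win` and `embed`.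

For the decomposition (`synth_of_cycleRefines`), disjoint five-element segments are split off in
pairs as long as this is possible, which removes at least 8 terms for about `52n + 2·10·n = 72n`
gates. Then cycles of equal length 2, 3 or 4 are paired. At most four unpaired blocks occur. A final
lone 2-cycle or 4-cycle makes the permutation odd; these are the types whose circuit uses a gate
with `n - 1` controls, so the ancilla is there when it is needed. -/

/-! ### Semantics of elementary circuits -/

/-- The term `x` with bit `t` complemented. -/
def flipBit {m : ℕ} (t : Fin m) (x : Term m) : Term m := Function.update x t (!x t)

theorem flipBit_same {m : ℕ} (t : Fin m) (x : Term m) : flipBit t x t = !x t := by simp [flipBit]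

theorem flipBit_ne {m : ℕ} {t i : Fin m} (h : i ≠ t) (x : Term m) : flipBit t x i = x i := by
  simp [flipBit, h]

theorem flipBit_apply {m : ℕ} (t i : Fin m) (x : Term m) :
    flipBit t x i = (x i ^^ decide (i = t)) := by
  by_cases h : i = t
  · subst h; simp [flipBit_same]
  · simp [flipBit_ne h, h]

theorem flipBit_flipBit {m : ℕ} (t : Fin m) (x : Term m) : flipBit t (flipBit t x) = x := by
  funext i; simp [flipBit_apply]

theorem flipBit_comm {m : ℕ} (s t : Fin m) (x : Term m) :
    flipBit s (flipBit t x) = flipBit t (flipBit s x) := by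
  funext i; simp only [flipBit_apply, Bool.xor_assoc, Bool.xor_comm (decide (i = t))]

/-- The power of NOT with eigenvalue `z` on line `t`. -/
noncomputable def rot {m : ℕ} (z : ℂ) (t : Fin m) (ψ : Term m → ℂ) : Term m → ℂ :=
  fun x => (1 + z) / 2 * ψ x + (1 - z) / 2 * ψ (flipBit t x)

theorem rot_one {m : ℕ} (t : Fin m) (ψ : Term m → ℂ) : rot 1 t ψ = ψ := by
  funext x; simp [rot]

theorem rot_neg_one {m : ℕ} (t : Fin m) (ψ : Term m → ℂ) :
    rot (-1) t ψ = fun x => ψ (flipBit t x) := by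
  funext x; simp only [rot]; ring

theorem rot_rot {m : ℕ} (z z' : ℂ) (t : Fin m) (ψ : Term m → ℂ) :
    rot z t (rot z' t ψ) = rot (z * z') t ψ := by
  funext x; simp only [rot, flipBit_flipBit]; ring

/-- The eigenvalue of the one-line matrix of a gate. -/
noncomputable def Kind.phase : Kind → ℂ
  | .x => -1
  | .v => Complex.I
  | .vdg => -Complex.I

theorem Gate.act_ctrl {m : ℕ} (κ : Kind) (c t : Fin m) (h : c ≠ t) (ψ : Term m → ℂ) :
    (Gate.ctrl κ c t h).act ψ = fun x => if x c = true then rot κ.phase t ψ x else ψ x := by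
  funext x
  have hI : Complex.I * Complex.I = -1 := Complex.I_mul_I
  have key : ∑ b : Bool, κ.mat (x t) b * ψ (Function.update x t b) = rot κ.phase t ψ x := by
    cases hx : x t <;> cases κ <;>
      · have h1 : Function.update x t (x t) = x := Function.update_eq_self _ _
        rw [hx] at h1
        simp only [Fintype.sum_bool, Kind.mat, rot, Kind.phase, flipBit, hx, h1]
        simp
        try ring_nf
        try simp
        try ring
  simp only [Gate.act, key]

theorem Gate.act_not {m : ℕ} (t : Fin m) (ψ : Term m → ℂ) :
    (Gate.not t).act ψ = fun x => ψ (flipBit t x) := rfl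

theorem ket_flipBit {m : ℕ} (t : Fin m) (x y : Term m) :
    ket x (flipBit t y) = ket (flipBit t x) y := by
  have : flipBit t y = x ↔ y = flipBit t x := by
    constructor
    · rintro rfl; rw [flipBit_flipBit]
    · rintro rfl; rw [flipBit_flipBit]
  simp only [ket, Pi.single_apply, this]

theorem ket_injective {m : ℕ} {x y : Term m} (h : ket x = ket y) : x = y := by
  by_contra hne
  have := congrFun h x
  simp [ket, hne] at this

theorem rot_neg_one_ket {m : ℕ} (t : Fin m) (x : Term m) :
    rot (-1) t (ket x) = ket (flipBit t x) := by
  rw [rot_neg_one]; funext y; exact ket_flipBit t x y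

theorem act_not_ket {m : ℕ} (t : Fin m) (x : Term m) :
    (Gate.not t).act (ket x) = ket (flipBit t x) := by
  rw [Gate.act_not]; funext y; exact ket_flipBit t x y

/-- Because `c ≠ t`, the control bit is definite in `rot z t (ket x)`, so a controlled gate only
multiplies the scalar `z`. The circuits below thus reduce to tracking one phase and one classical
term. -/
theorem act_ctrl_rot_ket {m : ℕ} (κ : Kind) (c t : Fin m) (h : c ≠ t) (z : ℂ) (x : Term m) :
    (Gate.ctrl κ c t h).act (rot z t (ket x)) =
      rot ((if x c = true then κ.phase else 1) * z) t (ket x) := by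
  rw [Gate.act_ctrl]
  funext y
  by_cases hc : y c = x c
  · rw [← hc]
    split_ifs
    · rw [rot_rot]
    · rw [one_mul]
  · have hz : ∀ z : ℂ, rot z t (ket x) y = 0 := by
      intro z
      have h1 : y ≠ x := fun e => hc (by rw [e])
      have h2 : flipBit t y ≠ x := fun e => hc (by rw [← e, flipBit_ne h])
      simp [rot, ket, h1, h2]
    rw [rot_rot, hz, hz, hz]; simp

theorem act_cnot_ket {m : ℕ} (c t : Fin m) (h : c ≠ t) (x : Term m) :
    (Gate.ctrl .x c t h).act (ket x) = ket (if x c = true then flipBit t x else x) := by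
  have := act_ctrl_rot_ket .x c t h 1 x
  rw [rot_one] at this
  rw [this]
  split_ifs
  · simp [Kind.phase, rot_neg_one_ket]
  · simp [rot_one]

/-- The gate does not use line `t`. -/
def Gate.Avoids {m : ℕ} (t : Fin m) : Gate m → Prop
  | .not s => s ≠ t
  | .ctrl _ c s _ => c ≠ t ∧ s ≠ t

theorem Gate.Avoids.act_rot {m : ℕ} {t : Fin m} {g : Gate m} (h : g.Avoids t) (z : ℂ)
    (ψ : Term m → ℂ) : g.act (rot z t ψ) = rot z t (g.act ψ) := by
  cases g with
  | not s =>
    funext x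
    simp only [Gate.act_not, rot, flipBit_comm s t]
  | ctrl κ c s hcs =>
    obtain ⟨h1, h2⟩ := h
    funext x
    simp only [Gate.act_ctrl, rot, flipBit_ne h1, flipBit_comm s t]
    split_ifs
    · ring
    · rfl

theorem Circuit.run_nil {m : ℕ} (ψ : Term m → ℂ) : Circuit.run ([] : Circuit m) ψ = ψ := rfl

theorem Circuit.run_cons {m : ℕ} (g : Gate m) (C : Circuit m) (ψ : Term m → ℂ) :
    Circuit.run (g :: C) ψ = Circuit.run C (g.act ψ) := rfl

theorem Circuit.run_append {m : ℕ} (C D : Circuit m) (ψ : Term m → ℂ) :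
    Circuit.run (C ++ D) ψ = Circuit.run D (Circuit.run C ψ) := List.foldl_append

/-- A power of NOT on an unused line commutes with the circuit. In the ladder this carries the
unfinished rotation of the outer target past the inner ladder. -/
theorem Circuit.run_rot {m : ℕ} {t : Fin m} {C : Circuit m} (h : ∀ g ∈ C, g.Avoids t) (z : ℂ)
    (ψ : Term m → ℂ) : Circuit.run C (rot z t ψ) = rot z t (Circuit.run C ψ) := by
  induction C generalizing ψ with
  | nil => rfl
  | cons g C ih =>
    rw [Circuit.run_cons, Circuit.run_cons, (h g (by simp)).act_rot,
      ih fun g' hg' => h g' (by simp [hg'])]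

theorem Gate.act_inv_act {m : ℕ} (g : Gate m) (ψ : Term m → ℂ) : g.inv.act (g.act ψ) = ψ := by
  cases g with
  | not t => funext x; simp [Gate.inv, Gate.act_not, flipBit_flipBit]
  | ctrl κ c t h =>
    obtain ⟨κ', e, hp⟩ : ∃ κ', (Gate.ctrl κ c t h).inv = Gate.ctrl κ' c t h ∧
        κ'.phase * κ.phase = 1 := by
      cases κ
      · exact ⟨.x, rfl, by simp [Kind.phase]⟩
      · exact ⟨.vdg, rfl, by simp [Kind.phase]⟩
      · exact ⟨.v, rfl, by simp [Kind.phase]⟩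
    rw [e]
    funext x
    by_cases hx : x c = true
    · have := congrFun (rot_rot κ'.phase κ.phase t ψ) x
      rw [hp, rot_one] at this
      rw [← this]
      simp only [Gate.act_ctrl, hx, if_true, rot, flipBit_ne h]
    · simp only [Gate.act_ctrl, hx, Bool.false_eq_true, if_false]

theorem Circuit.inv_cons {m : ℕ} (g : Gate m) (C : Circuit m) :
    Circuit.inv (g :: C) = Circuit.inv C ++ [g.inv] := by simp [Circuit.inv]

theorem Circuit.run_inv_run {m : ℕ} (C : Circuit m) (ψ : Term m → ℂ) :
    Circuit.run (Circuit.inv C) (Circuit.run C ψ) = ψ := by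
  induction C generalizing ψ with
  | nil => rfl
  | cons g C ih =>
    rw [Circuit.inv_cons, Circuit.run_append, Circuit.run_cons g C, ih, Circuit.run_cons,
      Gate.act_inv_act, Circuit.run_nil]

/-- The circuit acts as a classical function on basis states. -/
def Computes {m : ℕ} (C : Circuit m) (f : Term m → Term m) : Prop :=
  ∀ x, C.run (ket x) = ket (f x)

theorem Computes.nil {m : ℕ} : Computes ([] : Circuit m) id := fun _ => rfl

theorem Computes.append {m : ℕ} {C D : Circuit m} {f g : Term m → Term m} (hC : Computes C f)
    (hD : Computes D g) : Computes (C ++ D) (g ∘ f) := by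
  intro x; rw [Circuit.run_append, hC, hD]; rfl

theorem Computes.congr {m : ℕ} {C : Circuit m} {f g : Term m → Term m} (hC : Computes C f)
    (h : ∀ x, f x = g x) : Computes C g := fun x => by rw [hC, h]

theorem Realizes.nil {n a : ℕ} : Realizes ([] : Circuit (n + a)) (id : Term n → Term n) :=
  fun _ _ => rfl

theorem Realizes.append {n a : ℕ} {C D : Circuit (n + a)} {f g : Term n → Term n}
    (hC : Realizes C f) (hD : Realizes D g) : Realizes (C ++ D) (g ∘ f) := by
  intro x y; rw [Circuit.run_append, hC, hD]; rfl

theorem Realizes.congr {n a : ℕ} {C : Circuit (n + a)} {f g : Term n → Term n} (hC : Realizes C f)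
    (h : ∀ x, f x = g x) : Realizes C g := fun x y => by rw [hC, h]

theorem Fin.append_injective_left {n a : ℕ} {x x' : Term n} {y y' : Term a}
    (h : (Fin.append x y : Term (n + a)) = Fin.append x' y') : x = x' := by
  funext i
  have := congrFun h (Fin.castAdd a i)
  simpa using this

theorem Realizes.injective {n a : ℕ} {C : Circuit (n + a)} {f : Term n → Term n}
    (hC : Realizes C f) : Function.Injective f := by
  intro x x' h
  have h1 : C.run (ket (Fin.append x (fun _ => false))) =
      C.run (ket (Fin.append x' (fun _ => false))) := by rw [hC, hC, h]
  have h2 := congrArg (Circuit.run (Circuit.inv C)) h1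
  rw [Circuit.run_inv_run, Circuit.run_inv_run] at h2
  exact Fin.append_injective_left (ket_injective h2)

/-- The inverse circuit cancels `C` on the basis state of `f (g x)`. No separate description of what
it computes is needed, and `f` need not be inverted. -/
theorem Realizes.conj {n a : ℕ} {C K : Circuit (n + a)} {f k g : Term n → Term n}
    (hC : Realizes C f) (hK : Realizes K k) (h : ∀ x, k (f x) = f (g x)) :
    Realizes (C ++ K ++ Circuit.inv C) g := by
  intro x y
  rw [Circuit.run_append, Circuit.run_append, hC, hK, h, ← hC, Circuit.run_inv_run]

theorem Toffoli.act_eq {n : ℕ} (g : Toffoli n) (x : Term n) :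
    g.act x = if g.Fires x then flipBit g.target x else x := rfl

/-- The Toffoli gate with positive controls only. -/
def posToffoli {m : ℕ} (P : Finset (Fin m)) (t : Fin m) : Toffoli m := ⟨P, ∅, t⟩

theorem posToffoli_act {m : ℕ} (P : Finset (Fin m)) (t : Fin m) (x : Term m) :
    (posToffoli P t).act x = if ∀ i ∈ P, x i = true then flipBit t x else x := by
  rw [Toffoli.act_eq]; simp [posToffoli, Toffoli.Fires]

/-! ### Costs -/

/-- The number of elementary gates of a gate after the insertion of SWAPs. -/
def Gate.lnn {m : ℕ} : Gate m → ℕ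
  | .not _ => 1
  | .ctrl _ c t _ => 6 * (Nat.dist (c : ℕ) (t : ℕ) - 1) + 1

/-- The number of elementary gates of a circuit after the insertion of SWAPs. -/
def Circuit.lnn {m : ℕ} (C : Circuit m) : ℕ := (C.map Gate.lnn).sum

theorem Circuit.lnn_append {m : ℕ} (C D : Circuit m) :
    Circuit.lnn (C ++ D) = Circuit.lnn C + Circuit.lnn D := by simp [Circuit.lnn]

theorem Gate.lnn_le {m : ℕ} (g : Gate m) : g.lnn ≤ 6 * m := by
  cases g with
  | not t => have := t.2; simp only [Gate.lnn]; omega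
  | ctrl κ c t h =>
    have := c.2
    have := t.2
    simp only [Gate.lnn, Nat.dist]
    omega

theorem Circuit.lnn_le {m : ℕ} (C : Circuit m) : Circuit.lnn C ≤ 6 * m * C.length := by
  have := List.sum_le_card_nsmul (C.map Gate.lnn) (6 * m) (by
    intro x hx
    obtain ⟨g, _, rfl⟩ := List.mem_map.1 hx
    exact g.lnn_le)
  rw [List.length_map, smul_eq_mul] at this
  rw [Circuit.lnn, mul_comm]; exact this

theorem Gate.lnn_inv {m : ℕ} (g : Gate m) : g.inv.lnn = g.lnn := by
  cases g with
  | not t => rfl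
  | ctrl κ c t h => cases κ <;> rfl

theorem Circuit.lnn_inv {m : ℕ} (C : Circuit m) : Circuit.lnn (Circuit.inv C) = Circuit.lnn C := by
  have : (Gate.lnn ∘ Gate.inv : Gate m → ℕ) = Gate.lnn := funext Gate.lnn_inv
  simp [Circuit.lnn, Circuit.inv, List.sum_reverse, this]

theorem Circuit.length_inv {m : ℕ} (C : Circuit m) : (Circuit.inv C).length = C.length := by
  simp [Circuit.inv]

/-! ### Multiple-control Toffoli gates with dirty ancilla lines -/

/-- The one-gate circuit of a two-line gate (empty if the lines coincide). -/
def ctrlList {m : ℕ} (κ : Kind) (c t : Fin m) : Circuit m :=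
  if h : c ≠ t then [.ctrl κ c t h] else []

theorem length_ctrlList_le {m : ℕ} (κ : Kind) (c t : Fin m) : (ctrlList κ c t).length ≤ 1 := by
  unfold ctrlList; split_ifs <;> simp

theorem run_ctrlList_target {m : ℕ} (κ : Kind) {c t : Fin m} (h : c ≠ t) (z : ℂ) (x : Term m) :
    Circuit.run (ctrlList κ c t) (rot z t (ket x)) =
      rot ((if x c = true then κ.phase else 1) * z) t (ket x) := by
  rw [ctrlList, dif_pos h]; exact act_ctrl_rot_ket κ c t h z x

theorem run_cnot_rot {m : ℕ} {c a t : Fin m} (h : c ≠ a) (hc : c ≠ t) (ha : a ≠ t) (z : ℂ)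
    (x : Term m) : Circuit.run (ctrlList .x c a) (rot z t (ket x)) =
      rot z t (ket (if x c = true then flipBit a x else x)) := by
  rw [ctrlList, dif_pos h, Circuit.run_rot, Circuit.run_cons, Circuit.run_nil, act_cnot_ket]
  simp [Gate.Avoids, hc, ha]

/-- The Toffoli gate by five elementary gates. -/
def tofCircuit {m : ℕ} (a b t : Fin m) : Circuit m :=
  ctrlList .v b t ++ ctrlList .x a b ++ ctrlList .vdg b t ++ ctrlList .x a b ++ ctrlList .v a t

/-- The accumulated phase is `i^b · (-i)^(a ⊕ b) · i^a = i^(2ab) = (-1)^(ab)`, which is NOT exactly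
when both controls are set; the two CNOTs restore line `b`. -/
theorem computes_tofCircuit {m : ℕ} {a b t : Fin m} (hab : a ≠ b) (hat : a ≠ t) (hbt : b ≠ t) :
    Computes (tofCircuit a b t)
      (fun x => if x a = true ∧ x b = true then flipBit t x else x) := by
  intro x
  have h0 : ket x = rot 1 t (ket x) := (rot_one _ _).symm
  rw [h0]
  simp only [tofCircuit, Circuit.run_append, run_ctrlList_target _ hbt,
    run_ctrlList_target _ hat, run_cnot_rot hab hat hbt]
  have hI : Complex.I * Complex.I = -1 := Complex.I_mul_I
  cases ha : x a <;> cases hb : x b <;>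
    simp [ha, hb, flipBit_same, flipBit_ne hab, flipBit_flipBit, Kind.phase, rot_one,
      rot_neg_one_ket]

/-- Half of a relative-phase Toffoli gate with controls `a`, `c` and target `t`. -/
def pairStep {m : ℕ} (a c t : Fin m) : Circuit m :=
  ctrlList .v a t ++ ctrlList .x c a ++ ctrlList .vdg a t

theorem run_pairStep {m : ℕ} {a c t : Fin m} (hca : c ≠ a) (hct : c ≠ t) (hat : a ≠ t) (z : ℂ)
    (x : Term m) : Circuit.run (pairStep a c t) (rot z t (ket x)) =
      rot ((if (x a ^^ x c) = true then -Complex.I else 1) *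
        ((if x a = true then Complex.I else 1) * z)) t
        (ket (if x c = true then flipBit a x else x)) := by
  simp only [pairStep, Circuit.run_append, run_ctrlList_target _ hat, run_cnot_rot hca hct hat]
  cases hc : x c <;> cases ha : x a <;> simp [ha, flipBit_same, Kind.phase]

/-- The ladder circuit: for `1 ≤ j ≤ i` it complements line `a j` if the controls
`c 0, …, c j` are all satisfied. -/
def ladder {m : ℕ} (c a : ℕ → Fin m) : ℕ → Circuit m
  | 0 => []
  | 1 => tofCircuit (c 0) (c 1) (a 1)
  | i + 2 => pairStep (a (i + 1)) (c (i + 2)) (a (i + 2)) ++ ladder c a (i + 1) ++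
      pairStep (a (i + 1)) (c (i + 2)) (a (i + 2))

/-- The function computed by the ladder circuit. -/
def ladderFun {m : ℕ} (c a : ℕ → Fin m) : ℕ → Term m → Term m
  | 0, x => x
  | i + 1, x => if ∀ k ≤ i + 1, x (c k) = true then flipBit (a (i + 1)) (ladderFun c a i x)
      else ladderFun c a i x

theorem length_ladder_le {m : ℕ} (c a : ℕ → Fin m) (i : ℕ) : (ladder c a i).length ≤ 6 * i := by
  induction i using ladder.induct with
  | case1 => simp [ladder]
  | case2 =>
    simp only [ladder, tofCircuit, List.length_append]
    have := length_ctrlList_le Kind.v (c 1) (a 1)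
    have := length_ctrlList_le Kind.x (c 0) (c 1)
    have := length_ctrlList_le Kind.vdg (c 1) (a 1)
    have := length_ctrlList_le Kind.v (c 0) (a 1)
    omega
  | case3 i ih =>
    simp only [ladder, pairStep, List.length_append]
    have := length_ctrlList_le Kind.v (a (i + 1)) (a (i + 2))
    have := length_ctrlList_le Kind.x (c (i + 2)) (a (i + 1))
    have := length_ctrlList_le Kind.vdg (a (i + 1)) (a (i + 2))
    omega

theorem ladderFun_of_ne {m : ℕ} (c a : ℕ → Fin m) {i : ℕ} {l : Fin m}
    (h : ∀ j, 1 ≤ j → j ≤ i → a j ≠ l) (x : Term m) : ladderFun c a i x l = x l := by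
  induction i with
  | zero => rfl
  | succ i ih =>
    have ih' := ih fun j h1 h2 => h j h1 (by omega)
    have := (h (i + 1) (by omega) le_rfl).symm
    simp only [ladderFun]
    split_ifs
    · rw [flipBit_ne this, ih']
    · exact ih'

/-- The controls of the ladder read only the lines `c k`, so complementing any other line commutes
with it, even if that line is one of its targets. -/
theorem ladderFun_flipBit {m : ℕ} (c a : ℕ → Fin m) {i : ℕ} {s : Fin m}
    (h : ∀ k ≤ i, c k ≠ s) (x : Term m) :
    ladderFun c a i (flipBit s x) = flipBit s (ladderFun c a i x) := by
  induction i with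
  | zero => rfl
  | succ i ih =>
    have ih' := ih fun k hk => h k (by omega)
    have hiff : (∀ k ≤ i + 1, flipBit s x (c k) = true) ↔ ∀ k ≤ i + 1, x (c k) = true :=
      forall_congr' fun k => forall_congr' fun hk => by rw [flipBit_ne (h k hk)]
    simp only [ladderFun, hiff, ih']
    split_ifs
    · rw [flipBit_comm]
    · rfl

/-- The lines of a ladder are distinct. -/
structure LadderLines {m : ℕ} (c a : ℕ → Fin m) (i : ℕ) : Prop where
  ne : ∀ k ≤ i, ∀ j, 1 ≤ j → j ≤ i → c k ≠ a j
  inj : ∀ j, 1 ≤ j → j ≤ i → ∀ j', 1 ≤ j' → j' ≤ i → a j = a j' → j = j'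
  ne_zero_one : 1 ≤ i → c 0 ≠ c 1

theorem LadderLines.mono {m : ℕ} {c a : ℕ → Fin m} {i i' : ℕ} (h : LadderLines c a i)
    (hi : i' ≤ i) : LadderLines c a i' :=
  ⟨fun k hk j h1 h2 => h.ne k (by omega) j h1 (by omega),
    fun j h1 h2 j' h1' h2' e => h.inj j h1 (by omega) j' h1' (by omega) e,
    fun h1 => h.ne_zero_one (by omega)⟩

theorem avoids_ctrlList {m : ℕ} {κ : Kind} {c t l : Fin m} (hc : c ≠ l) (ht : t ≠ l) :
    ∀ g ∈ ctrlList κ c t, g.Avoids l := by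
  intro g hg
  unfold ctrlList at hg
  split_ifs at hg
  · simp only [List.mem_singleton] at hg; subst hg; exact ⟨hc, ht⟩
  · simp at hg

theorem avoids_ladder {m : ℕ} (c a : ℕ → Fin m) {i : ℕ} {l : Fin m}
    (hc : ∀ k ≤ i, c k ≠ l) (ha : ∀ j, 1 ≤ j → j ≤ i → a j ≠ l) :
    ∀ g ∈ ladder c a i, g.Avoids l := by
  induction i using ladder.induct with
  | case1 => simp [ladder]
  | case2 =>
    have h0 := hc 0 (by omega)
    have h1 := hc 1 (by omega)
    have h2 := ha 1 (by omega) (by omega)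
    simp only [ladder, tofCircuit, List.mem_append]
    rintro g ((((h | h) | h) | h) | h)
    · exact avoids_ctrlList h1 h2 g h
    · exact avoids_ctrlList h0 h1 g h
    · exact avoids_ctrlList h1 h2 g h
    · exact avoids_ctrlList h0 h1 g h
    · exact avoids_ctrlList h0 h2 g h
  | case3 i ih =>
    have ih' := ih (fun k hk => hc k (by omega)) (fun j h1 h2 => ha j h1 (by omega))
    have h0 := hc (i + 2) (by omega)
    have h1 := ha (i + 1) (by omega) (by omega)
    have h2 := ha (i + 2) (by omega) (by omega)
    simp only [ladder, pairStep, List.mem_append]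
    rintro g ((((h | h) | h) | h) | ((h | h) | h))
    · exact avoids_ctrlList h1 h2 g h
    · exact avoids_ctrlList h0 h1 g h
    · exact avoids_ctrlList h1 h2 g h
    · exact ih' g h
    · exact avoids_ctrlList h1 h2 g h
    · exact avoids_ctrlList h0 h1 g h
    · exact avoids_ctrlList h1 h2 g h

/-- Let `p` be the conjunction of the inner controls, `c` the new control and `a` the bit on line `a
(i + 1)`. The two half steps around the inner ladder give the phase exponent `a - (a ⊕ c) + (a ⊕ c ⊕
p) - (a ⊕ p)`. It is 0 unless `p = c = 1`, when it is `±2`, so the new target is complemented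
exactly then; the two CNOTs by `c` on the line `a (i + 1)` cancel. Three gates per half step suffice
where a full Toffoli gate needs five. -/
theorem computes_ladder {m : ℕ} (c a : ℕ → Fin m) {i : ℕ} (h : LadderLines c a i) :
    Computes (ladder c a i) (ladderFun c a i) := by
  induction i using ladder.induct with
  | case1 => exact Computes.nil
  | case2 =>
    refine (computes_tofCircuit (h.ne_zero_one le_rfl) (h.ne 0 (by omega) 1 le_rfl le_rfl)
      (h.ne 1 le_rfl 1 le_rfl le_rfl)).congr fun x => ?_
    have : (∀ k ≤ 0 + 1, x (c k) = true) ↔ x (c 0) = true ∧ x (c 1) = true := by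
      constructor
      · intro h; exact ⟨h 0 (by omega), h 1 (by omega)⟩
      · rintro ⟨h0, h1⟩ k hk
        obtain rfl | rfl : k = 0 ∨ k = 1 := by omega
        exacts [h0, h1]
    simp only [ladderFun, this]
  | case3 i ih =>
    have ih' := ih (h.mono (by omega))
    have hca : c (i + 2) ≠ a (i + 1) := h.ne _ le_rfl _ (by omega) (by omega)
    have hct : c (i + 2) ≠ a (i + 2) := h.ne _ le_rfl _ (by omega) (by omega)
    have hat : a (i + 1) ≠ a (i + 2) := fun e => by
      have := h.inj (i + 1) (by omega) (by omega) (i + 2) (by omega) (by omega) e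
      omega
    have hav : ∀ g ∈ ladder c a (i + 1), g.Avoids (a (i + 2)) :=
      avoids_ladder c a (fun k hk => h.ne k (by omega) _ (by omega) (by omega))
        (fun j h1 h2 e => by
          have := h.inj j h1 (by omega) (i + 2) (by omega) (by omega) e
          omega)
    intro x
    have h0 : ket x = rot 1 (a (i + 2)) (ket x) := (rot_one _ _).symm
    have hf : ladderFun c a (i + 1) (if x (c (i + 2)) = true then flipBit (a (i + 1)) x else x) =
        if x (c (i + 2)) = true then flipBit (a (i + 1)) (ladderFun c a (i + 1) x)
        else ladderFun c a (i + 1) x := by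
      split_ifs
      · exact ladderFun_flipBit c a (fun k hk => h.ne k (by omega) _ (by omega) (by omega)) x
      · rfl
    have hcx : ladderFun c a (i + 1) x (c (i + 2)) = x (c (i + 2)) :=
      ladderFun_of_ne c a (fun j h1 h2 => (h.ne _ le_rfl j h1 (by omega)).symm) x
    have hax : ladderFun c a (i + 1) x (a (i + 1)) =
        (x (a (i + 1)) ^^ decide (∀ k ≤ i + 1, x (c k) = true)) := by
      have h1 : ladderFun c a i x (a (i + 1)) = x (a (i + 1)) :=
        ladderFun_of_ne c a (fun j h1 h2 e => by
          have := h.inj j h1 (by omega) (i + 1) (by omega) (by omega) e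
          omega) x
      simp only [ladderFun]
      split_ifs with hk
      · rw [flipBit_same, h1, decide_eq_true hk, Bool.xor_true]
      · rw [h1, decide_eq_false hk, Bool.xor_false]
    have hprod : (∀ k ≤ i + 2, x (c k) = true) ↔
        (∀ k ≤ i + 1, x (c k) = true) ∧ x (c (i + 2)) = true := by
      constructor
      · intro h; exact ⟨fun k hk => h k (by omega), h _ le_rfl⟩
      · rintro ⟨h1, h2⟩ k hk
        rcases Nat.lt_or_ge k (i + 2) with hlt | hge
        · exact h1 k (by omega)
        · obtain rfl : k = i + 2 := by omega
          exact h2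
    rw [ladder, h0, Circuit.run_append, Circuit.run_append, run_pairStep hca hct hat,
      Circuit.run_rot hav, ih', run_pairStep hca hct hat, hf]
    show _ = ket (if ∀ k ≤ i + 2, x (c k) = true then _ else _)
    simp only [hprod]
    generalize ladderFun c a (i + 1) x = y at *
    generalize hp : decide (∀ k ≤ i + 1, x (c k) = true) = p at *
    have hp' : (∀ k ≤ i + 1, x (c k) = true) ↔ p = true := by rw [← hp]; simp
    simp only [hp']
    have hI : Complex.I * Complex.I = -1 := Complex.I_mul_I
    cases hc : x (c (i + 2)) <;> cases ha : x (a (i + 1)) <;> cases p <;>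
      simp [hc, ha, hax, hcx, flipBit_same, flipBit_ne hca, flipBit_flipBit, rot_one,
        rot_neg_one_ket]

/-- The controls are never among the targets, so the same complementations occur in both runs. This
lets a shorter ladder clean up the auxiliary lines. -/
theorem ladderFun_ladderFun {m : ℕ} (c a : ℕ → Fin m) {i : ℕ} (h : LadderLines c a i)
    (x : Term m) : ladderFun c a i (ladderFun c a i x) = x := by
  induction i generalizing x with
  | zero => rfl
  | succ i ih =>
    have ih' := ih (h.mono (by omega))
    have hy : ∀ k ≤ i + 1, ladderFun c a (i + 1) x (c k) = x (c k) := fun k hk =>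
      ladderFun_of_ne c a (fun j h1 h2 => (h.ne k hk j h1 h2).symm) x
    have hiff : (∀ k ≤ i + 1, ladderFun c a (i + 1) x (c k) = true) ↔
        ∀ k ≤ i + 1, x (c k) = true :=
      forall_congr' fun k => forall_congr' fun hk => by rw [hy k hk]
    rw [ladderFun]
    simp only [hiff]
    by_cases hp : ∀ k ≤ i + 1, x (c k) = true
    · rw [if_pos hp, ladderFun, if_pos hp, ladderFun_flipBit c a
        (fun k hk => h.ne k (by omega) _ (by omega) le_rfl), ih', flipBit_flipBit]
    · rw [if_neg hp, ladderFun, if_neg hp, ih']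

/-- A Toffoli gate whose controls make up about half of the lines. -/
theorem exists_computes_posToffoli_of_two_mul_card_le {m : ℕ} (P : Finset (Fin m)) (t : Fin m)
    (ht : t ∉ P) (hm : 2 * P.card ≤ m + 1) :
    ∃ C : Circuit m, Computes C (posToffoli P t).act ∧ C.length ≤ 12 * P.card + 1 := by
  obtain h0 | h1 | ⟨i, hi⟩ : P.card = 0 ∨ P.card = 1 ∨ ∃ i, P.card = i + 2 := by
    rcases hP : P.card with _ | _ | i <;> simp
  · rw [Finset.card_eq_zero] at h0
    subst h0
    exact ⟨[.not t], fun x => by simp [Circuit.run_cons, Circuit.run_nil, act_not_ket,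
      posToffoli_act], by simp⟩
  · obtain ⟨c, rfl⟩ := Finset.card_eq_one.1 h1
    have hct : c ≠ t := fun e => ht (by simp [e])
    exact ⟨[.ctrl .x c t hct], fun x => by simp [Circuit.run_cons, Circuit.run_nil, act_cnot_ket,
      posToffoli_act], by simp⟩
  · set F : Finset (Fin m) := (insert t P)ᶜ with hF
    have hFc : i ≤ F.card := by
      have h1 : F.card = _ := Finset.card_compl (insert t P)
      have h2 := Finset.card_le_univ (insert t P)
      rw [Finset.card_insert_of_notMem ht, Fintype.card_fin] at h1 h2
      omega
    set c : ℕ → Fin m := fun k => if h : k < P.card then P.orderEmbOfFin rfl ⟨k, h⟩ else t with hc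
    -- The `i + 2` controls require only `i` auxiliary lines `a 1, …, a i`, whose values are
    -- arbitrary; `a (i + 1)` is the target. Outside the used index range, `t` is a default value.
    set a : ℕ → Fin m := fun j => if j = i + 1 then t else
      if h : j - 1 < F.card then F.orderEmbOfFin rfl ⟨j - 1, h⟩ else t with ha
    have hcP : ∀ k ≤ i + 1, c k ∈ P := by
      intro k hk
      simp only [hc]
      rw [dif_pos (by omega)]
      exact Finset.orderEmbOfFin_mem _ _ _
    have haF : ∀ j, 1 ≤ j → j ≤ i → a j ∈ F := by
      intro j h1 h2
      simp only [ha]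
      rw [if_neg (by omega), dif_pos (by omega)]
      exact Finset.orderEmbOfFin_mem _ _ _
    have hat : a (i + 1) = t := by simp [ha]
    have hL : LadderLines c a (i + 1) := by
      refine ⟨?_, ?_, ?_⟩
      · intro k hk j h1 h2 e
        rcases Nat.lt_or_ge i j with hj | hj
        · obtain rfl : j = i + 1 := by omega
          rw [hat] at e
          exact ht (e ▸ hcP k hk)
        · have := haF j h1 hj
          rw [← e, hF, Finset.mem_compl, Finset.mem_insert] at this
          exact this (Or.inr (hcP k hk))
      · intro j h1 h2 j' h1' h2' e
        by_cases hj : j = i + 1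
        · by_cases hj' : j' = i + 1
          · omega
          · have := haF j' h1' (by omega)
            rw [← e, hj, hat, hF] at this
            simp at this
        · by_cases hj' : j' = i + 1
          · have := haF j h1 (by omega)
            rw [e, hj', hat, hF] at this
            simp at this
          · simp only [ha] at e
            rw [if_neg hj, if_neg hj', dif_pos (by omega), dif_pos (by omega)] at e
            have := (F.orderEmbOfFin rfl).injective e
            simp only [Fin.mk.injEq] at this
            omega
      · intro _ e
        simp only [hc] at e
        rw [dif_pos (by omega), dif_pos (by omega)] at e
        have := (P.orderEmbOfFin rfl).injective e
        simp at this
    -- The long ladder also disturbs the auxiliary lines, exactly as the shorter one does; running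
    -- the shorter one afterwards restores them and leaves only the target changed.
    refine ⟨ladder c a (i + 1) ++ ladder c a i,
      ((computes_ladder c a hL).append (computes_ladder c a (hL.mono (by omega)))).congr ?_, ?_⟩
    · intro x
      have hiff : (∀ k ≤ i + 1, x (c k) = true) ↔ ∀ q ∈ P, x q = true := by
        constructor
        · intro h q hq
          have : q ∈ Set.range (P.orderEmbOfFin rfl) := by
            rw [Finset.range_orderEmbOfFin]; exact hq
          obtain ⟨⟨k, hk⟩, rfl⟩ := this
          have := h k (by omega)
          simp only [hc] at this
          rwa [dif_pos hk] at this
        · intro h k hk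
          exact h _ (hcP k hk)
      have hinv := ladderFun_ladderFun c a (hL.mono (show i ≤ i + 1 by omega)) x
      rw [posToffoli_act, Function.comp_apply, ladderFun]
      simp only [hiff]
      split_ifs
      · rw [ladderFun_flipBit c a (fun k hk => hL.ne k (by omega) _ (by omega) le_rfl), hinv, hat]
      · exact hinv
    · have h1 := length_ladder_le c a (i + 1)
      have h2 := length_ladder_le c a i
      rw [List.length_append]
      omega

/-- Line `d` is complemented twice, hence restored. Line `t` is complemented once with the old and
once with the new value of `d`, so it changes in total iff `d` was toggled and `B` holds. -/
theorem flipBit_commutator {m : ℕ} {d t : Fin m} (hdt : d ≠ t) {A B : Term m → Prop}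
    [DecidablePred A] [DecidablePred B] (hAd : ∀ y, A (flipBit d y) ↔ A y)
    (hAt : ∀ y, A (flipBit t y) ↔ A y) (hBd : ∀ y, B (flipBit d y) ↔ B y)
    (hBt : ∀ y, B (flipBit t y) ↔ B y) (x : Term m) :
    let f : Term m → Term m := fun y => if A y then flipBit d y else y
    let g : Term m → Term m := fun y => if y d = true ∧ B y then flipBit t y else y
    g (f (g (f x))) = if A x ∧ B x then flipBit t x else x := by
  intro f g
  by_cases hA : A x <;> by_cases hB : B x <;> cases hxd : x d <;>
    simp [f, g, hA, hB, hAd, hAt, hBd, hBt, hxd, flipBit_same, flipBit_ne hdt, flipBit_flipBit,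
      flipBit_comm d t]

/-- A Toffoli gate in the presence of a line that it does not use. -/
theorem exists_computes_posToffoli_of_card_add_two_le {m : ℕ} (P : Finset (Fin m)) (t : Fin m)
    (ht : t ∉ P) (hm : P.card + 2 ≤ m) :
    ∃ C : Circuit m, Computes C (posToffoli P t).act ∧ C.length ≤ 24 * P.card + 28 := by
  obtain ⟨d, hd⟩ : ∃ d, d ∉ insert t P := by
    by_contra! h
    have h1 : insert t P = Finset.univ := Finset.eq_univ_iff_forall.2 h
    have h2 := congrArg Finset.card h1
    rw [Finset.card_insert_of_notMem ht, Finset.card_univ, Fintype.card_fin] at h2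
    omega
  rw [Finset.mem_insert, not_or] at hd
  -- Splitting the controls evenly, with `d` as target of one half and as an extra control of the
  -- other, makes both gates small enough for the ladder construction.
  obtain ⟨P₁, hP₁, hc₁⟩ := Finset.exists_subset_card_eq (show (P.card + 1) / 2 ≤ P.card by omega)
  have hc₂ : (P \ P₁).card = P.card - (P.card + 1) / 2 := by
    rw [Finset.card_sdiff_of_subset hP₁, hc₁]
  have hd₂ : d ∉ P \ P₁ := fun h => hd.2 (Finset.mem_sdiff.1 h).1
  have hc₃ := Finset.card_insert_of_notMem hd₂
  obtain ⟨C₁, h₁, l₁⟩ := exists_computes_posToffoli_of_two_mul_card_le P₁ d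
    (fun h => hd.2 (hP₁ h)) (by omega)
  obtain ⟨C₂, h₂, l₂⟩ := exists_computes_posToffoli_of_two_mul_card_le (insert d (P \ P₁)) t
    (by simp [Ne.symm hd.1, ht]) (by omega)
  refine ⟨C₁ ++ C₂ ++ (C₁ ++ C₂), ((h₁.append h₂).append (h₁.append h₂)).congr fun x => ?_, ?_⟩
  · have hdt : d ≠ t := hd.1
    have hfd : ∀ y : Term m, (∀ i ∈ P₁, flipBit d y i = true) ↔ ∀ i ∈ P₁, y i = true := fun y =>
      forall_congr' fun i => forall_congr' fun hi => by
        rw [flipBit_ne (fun e : i = d => hd.2 (hP₁ (e ▸ hi)))]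
    have hft : ∀ y : Term m, (∀ i ∈ P₁, flipBit t y i = true) ↔ ∀ i ∈ P₁, y i = true := fun y =>
      forall_congr' fun i => forall_congr' fun hi => by
        rw [flipBit_ne (fun e : i = t => ht (hP₁ (e ▸ hi)))]
    have gfd : ∀ y : Term m, (∀ i ∈ P \ P₁, flipBit d y i = true) ↔
        ∀ i ∈ P \ P₁, y i = true := fun y =>
      forall_congr' fun i => forall_congr' fun hi => by
        rw [flipBit_ne (fun e : i = d => hd₂ (e ▸ hi))]
    have gft : ∀ y : Term m, (∀ i ∈ P \ P₁, flipBit t y i = true) ↔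
        ∀ i ∈ P \ P₁, y i = true := fun y =>
      forall_congr' fun i => forall_congr' fun hi => by
        rw [flipBit_ne (fun e : i = t => ht (e ▸ (Finset.mem_sdiff.1 hi).1))]
    have hP : (∀ i ∈ P, x i = true) ↔ (∀ i ∈ P₁, x i = true) ∧ ∀ i ∈ P \ P₁, x i = true := by
      constructor
      · intro h
        exact ⟨fun i hi => h i (hP₁ hi), fun i hi => h i (Finset.mem_sdiff.1 hi).1⟩
      · rintro ⟨h, h'⟩ i hi
        by_cases hi₁ : i ∈ P₁
        · exact h i hi₁
        · exact h' i (Finset.mem_sdiff.2 ⟨hi, hi₁⟩)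
    simp only [Function.comp_apply, posToffoli_act, Finset.forall_mem_insert, hP]
    exact flipBit_commutator (A := fun y => ∀ i ∈ P₁, y i = true)
      (B := fun y => ∀ i ∈ P \ P₁, y i = true) hdt hfd hft gfd gft x
  · simp only [List.length_append]
    omega

/-- NOT gates on the lines of a set. -/
noncomputable def notList {m : ℕ} (S : Finset (Fin m)) : Circuit m := S.toList.map Gate.not

theorem computes_notList {m : ℕ} (S : Finset (Fin m)) :
    Computes (notList S) (fun x i => x i ^^ decide (i ∈ S)) := by
  have key : ∀ l : List (Fin m), l.Nodup → Computes (l.map Gate.not : Circuit m)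
      (fun x i => x i ^^ decide (i ∈ l)) := by
    intro l
    induction l with
    | nil => exact fun _ x => by simp [Circuit.run_nil]
    | cons t l ih =>
      intro h x
      rw [List.nodup_cons] at h
      rw [List.map_cons, Circuit.run_cons, act_not_ket, ih h.2]
      congr 1
      funext i
      by_cases hit : i = t
      · subst hit; simp [flipBit_same, h.1]
      · simp [flipBit_ne hit, hit]
  exact (key S.toList S.nodup_toList).congr fun x => by simp

theorem length_notList {m : ℕ} (S : Finset (Fin m)) : (notList S).length = S.card := by
  simp [notList]

theorem lnn_notList {m : ℕ} (S : Finset (Fin m)) : Circuit.lnn (notList S) = S.card := by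
  have : (Gate.lnn ∘ Gate.not : Fin m → ℕ) = fun _ => 1 := rfl
  simp [Circuit.lnn, notList, this]

/-- Conjugation by NOT gates turns negative controls into positive ones, at two extra gates per
negative control. -/
theorem realizes_toffoli {n a : ℕ} {g : Toffoli n} (hg : Disjoint g.pos g.neg)
    {C : Circuit (n + a)}
    (hC : Computes C (posToffoli ((g.pos ∪ g.neg).map (Fin.castAddEmb a))
      (Fin.castAdd a g.target)).act) :
    Realizes (notList (g.neg.map (Fin.castAddEmb a)) ++ C ++
      notList (g.neg.map (Fin.castAddEmb a))) g.act := by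
  intro x y
  have h := ((computes_notList (g.neg.map (Fin.castAddEmb a))).append hC).append
    (computes_notList (g.neg.map (Fin.castAddEmb a)))
  rw [h]
  congr 1
  have hmem : ∀ i : Fin n, Fin.castAdd a i ∈ g.neg.map (Fin.castAddEmb a) ↔ i ∈ g.neg := by
    intro i
    rw [Finset.mem_map]
    constructor
    · rintro ⟨j, hj, e⟩
      rwa [← Fin.castAdd_injective n a e]
    · exact fun hi => ⟨i, hi, rfl⟩
  have hmem' : ∀ j : Fin a, Fin.natAdd n j ∉ g.neg.map (Fin.castAddEmb a) := by
    intro j hj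
    obtain ⟨i, -, e⟩ := Finset.mem_map.1 hj
    have := congrArg Fin.val e
    simp at this
    omega
  have hfire : (∀ i ∈ (g.pos ∪ g.neg).map (Fin.castAddEmb a), ((Fin.append x y : Term (n + a)) i ^^
      decide (i ∈ g.neg.map (Fin.castAddEmb a))) = true) ↔ g.Fires x := by
    simp only [Finset.forall_mem_map, Finset.mem_union, Fin.castAddEmb_apply, Fin.append_left, hmem]
    constructor
    · intro h
      refine ⟨fun i hi => ?_, fun i hi => ?_⟩
      · have := h i (Or.inl hi)
        simpa [Finset.disjoint_left.1 hg hi] using this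
      · have := h i (Or.inr hi)
        simpa [hi] using this
    · rintro ⟨h1, h2⟩ i (hi | hi)
      · simp [h1 i hi, Finset.disjoint_left.1 hg hi]
      · simp [h2 i hi, hi]
  simp only [Function.comp_apply, posToffoli_act, hfire]
  rw [Toffoli.act_eq]
  funext i
  have hne : ∀ j : Fin a, Fin.natAdd n j ≠ Fin.castAdd a g.target := by
    intro j e
    have := congrArg Fin.val e
    simp at this
    omega
  split_ifs
  · refine Fin.addCases (fun i => ?_) (fun j => ?_) i
    · simp only [flipBit_apply, Fin.append_left, hmem, Fin.castAdd_inj]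
      cases x i <;> cases decide (i ∈ g.neg) <;> cases decide (i = g.target) <;> rfl
    · simp only [flipBit_apply, Fin.append_right, hmem', hne, decide_false, Bool.xor_false]
  · simp

/-! ### Costs of lists of Toffoli gates -/

/-- The gates can be realized, one by one, by elementary gates, at most `ℓ` in total, and at most
`k` after the insertion of SWAPs. -/
def HasCost {n : ℕ} (a : ℕ) (gs : List (Toffoli n)) (ℓ k : ℕ) : Prop :=
  ∃ Cs : List (Circuit (n + a)), List.Forall₂ (fun C g => Realizes C (Toffoli.act g)) Cs gs ∧
    Cs.flatten.length ≤ ℓ ∧ Circuit.lnn Cs.flatten ≤ k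

theorem HasCost.nil {n a : ℕ} : HasCost a ([] : List (Toffoli n)) 0 0 :=
  ⟨[], List.Forall₂.nil, by simp, by simp [Circuit.lnn]⟩

theorem HasCost.append {n a : ℕ} {gs hs : List (Toffoli n)} {ℓ ℓ' k k' : ℕ}
    (hg : HasCost a gs ℓ k) (hh : HasCost a hs ℓ' k') :
    HasCost a (gs ++ hs) (ℓ + ℓ') (k + k') := by
  obtain ⟨Cs, h1, h2, h3⟩ := hg
  obtain ⟨Ds, h1', h2', h3'⟩ := hh
  refine ⟨Cs ++ Ds, List.rel_append h1 h1', ?_, ?_⟩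
  · rw [List.flatten_append, List.length_append]; omega
  · rw [List.flatten_append, Circuit.lnn_append]; omega

theorem HasCost.mono {n a : ℕ} {gs : List (Toffoli n)} {ℓ ℓ' k k' : ℕ}
    (h : HasCost a gs ℓ k) (hℓ : ℓ ≤ ℓ') (hk : k ≤ k') : HasCost a gs ℓ' k' := by
  obtain ⟨Cs, h1, h2, h3⟩ := h
  exact ⟨Cs, h1, h2.trans hℓ, h3.trans hk⟩

theorem HasCost.singleton {n a : ℕ} {g : Toffoli n} {C : Circuit (n + a)} {ℓ k : ℕ}
    (h : Realizes C g.act) (hℓ : C.length ≤ ℓ) (hk : Circuit.lnn C ≤ k) : HasCost a [g] ℓ k :=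
  ⟨[C], List.Forall₂.cons h List.Forall₂.nil, by simpa using hℓ, by simpa using hk⟩

theorem Toffoli.run_cons {n : ℕ} (g : Toffoli n) (gs : List (Toffoli n)) (x : Term n) :
    Toffoli.run (g :: gs) x = Toffoli.run gs (g.act x) := rfl

theorem Toffoli.run_append {n : ℕ} (gs hs : List (Toffoli n)) (x : Term n) :
    Toffoli.run (gs ++ hs) x = Toffoli.run hs (Toffoli.run gs x) := List.foldl_append

theorem realizes_flatten {n a : ℕ} {Cs : List (Circuit (n + a))} {gs : List (Toffoli n)}
    (h : List.Forall₂ (fun C g => Realizes C (Toffoli.act g)) Cs gs) :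
    Realizes Cs.flatten (Toffoli.run gs) := by
  induction h with
  | nil => exact Realizes.nil
  | cons h1 _ ih => rw [List.flatten_cons]; exact h1.append ih

/-- Injectivity comes from the reversibility of the elementary circuit, so validity of the
individual Toffoli gates need not be tracked. -/
theorem HasCost.injective {n a : ℕ} {gs : List (Toffoli n)} {ℓ k : ℕ} (h : HasCost a gs ℓ k) :
    Function.Injective (Toffoli.run gs) := by
  obtain ⟨Cs, h1, -⟩ := h
  exact (realizes_flatten h1).injective

theorem hasCost_of_computes {n a : ℕ} {g : Toffoli n} (hg : Disjoint g.pos g.neg) {ℓ : ℕ}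
    (h : ∃ C : Circuit (n + a), Computes C (posToffoli ((g.pos ∪ g.neg).map (Fin.castAddEmb a))
      (Fin.castAdd a g.target)).act ∧ C.length ≤ ℓ) :
    HasCost a [g] (ℓ + 2 * g.neg.card) (6 * (n + a) * ℓ + 2 * g.neg.card) := by
  obtain ⟨C, hC, hl⟩ := h
  refine HasCost.singleton (realizes_toffoli hg hC) ?_ ?_
  · simp only [List.length_append, length_notList, Finset.card_map]; omega
  · simp only [Circuit.lnn_append, lnn_notList, Finset.card_map]
    have := C.lnn_le
    have := Nat.mul_le_mul_left (6 * (n + a)) hl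
    omega

theorem Toffoli.Valid.target_notMem_map {n : ℕ} {g : Toffoli n} (hg : g.Valid) (a : ℕ) :
    Fin.castAdd a g.target ∉ (g.pos ∪ g.neg).map (Fin.castAddEmb a) := by
  intro h
  obtain ⟨i, hi, e⟩ := Finset.mem_map.1 h
  rw [Fin.castAdd_injective n a e, Finset.mem_union] at hi
  exact hi.elim hg.2.1 hg.2.2

theorem Toffoli.Valid.card_map {n : ℕ} {g : Toffoli n} (hg : g.Valid) (a : ℕ) :
    ((g.pos ∪ g.neg).map (Fin.castAddEmb a)).card = g.pos.card + g.neg.card := by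
  rw [Finset.card_map, Finset.card_union_of_disjoint hg.1]

theorem Toffoli.Valid.hasCost_of_two_mul_le {n : ℕ} {g : Toffoli n} (hg : g.Valid) (a : ℕ)
    (hm : 2 * (g.pos.card + g.neg.card) ≤ n + a + 1) :
    HasCost a [g] (12 * (g.pos.card + g.neg.card) + 1 + 2 * g.neg.card)
      (6 * (n + a) * (12 * (g.pos.card + g.neg.card) + 1) + 2 * g.neg.card) := by
  have := exists_computes_posToffoli_of_two_mul_card_le _ _ (hg.target_notMem_map a)
    (by rw [hg.card_map]; exact hm)
  rw [hg.card_map] at this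
  exact hasCost_of_computes hg.1 this

theorem Toffoli.Valid.hasCost_of_add_two_le {n : ℕ} {g : Toffoli n} (hg : g.Valid) (a : ℕ)
    (hm : g.pos.card + g.neg.card + 2 ≤ n + a) :
    HasCost a [g] (24 * (g.pos.card + g.neg.card) + 28 + 2 * g.neg.card)
      (6 * (n + a) * (24 * (g.pos.card + g.neg.card) + 28) + 2 * g.neg.card) := by
  have := exists_computes_posToffoli_of_card_add_two_le _ _ (hg.target_notMem_map a)
    (by rw [hg.card_map]; exact hm)
  rw [hg.card_map] at this
  exact hasCost_of_computes hg.1 this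

/-! ### Insertion of SWAPs -/

theorem act_cnot {m : ℕ} (c t : Fin m) (h : c ≠ t) (ψ : Term m → ℂ) :
    (Gate.ctrl .x c t h).act ψ = fun x => ψ (if x c = true then flipBit t x else x) := by
  rw [Gate.act_ctrl]
  funext x
  simp only [Kind.phase, rot_neg_one]
  split_ifs <;> rfl

theorem run_swapCircuit {m : ℕ} (i j : Fin m) (h : i ≠ j) (ψ : Term m → ℂ) :
    Circuit.run (swapCircuit i j h) ψ = fun x => ψ (x ∘ Equiv.swap i j) := by
  simp only [swapCircuit, Circuit.run_cons, Circuit.run_nil, act_cnot]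
  funext x
  congr 1
  funext l
  by_cases hi : l = i
  · subst hi
    cases hxi : x l <;> cases hxj : x j <;>
      simp [hxi, hxj, flipBit_same, flipBit_ne h]
  · by_cases hj : l = j
    · subst hj
      cases hxi : x i <;> cases hxj : x l <;>
        simp [hxi, hxj, flipBit_same, flipBit_ne h, flipBit_ne h.symm]
    · cases hxi : x i <;> cases hxj : x j <;>
        simp [hxi, hxj, flipBit_same, flipBit_ne h, flipBit_ne hi, flipBit_ne hj,
          Equiv.swap_apply_of_ne_of_ne hi hj]

theorem flipBit_comp_swap {m : ℕ} (t i j : Fin m) (x : Term m) :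
    flipBit t x ∘ Equiv.swap i j = flipBit (Equiv.swap i j t) (x ∘ Equiv.swap i j) := by
  funext l
  simp only [Function.comp_apply, flipBit_apply]
  congr 2
  rw [eq_iff_iff]
  constructor
  · intro e; rw [← e, Equiv.swap_apply_self]
  · rintro rfl; rw [Equiv.swap_apply_self]

/-- A SWAP only renames lines, so conjugation by it renames the lines of the gate. -/
theorem run_swap_conj {m : ℕ} (i j : Fin m) (h : i ≠ j) {D : Circuit m} {κ : Kind} {c t : Fin m}
    {hct : c ≠ t} (hct' : Equiv.swap i j c ≠ Equiv.swap i j t)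
    (hD : ∀ ψ, Circuit.run D ψ = (Gate.ctrl κ c t hct).act ψ) (ψ : Term m → ℂ) :
    Circuit.run (swapCircuit i j h ++ D ++ swapCircuit i j h) ψ =
      (Gate.ctrl κ (Equiv.swap i j c) (Equiv.swap i j t) hct').act ψ := by
  rw [Circuit.run_append, Circuit.run_append, run_swapCircuit, hD, run_swapCircuit]
  funext x
  have hx : (x ∘ Equiv.swap i j) ∘ Equiv.swap i j = x := by funext l; simp
  simp only [Gate.act_ctrl, rot, flipBit_comp_swap, hx, Function.comp_apply]

theorem SwapInsert.run_eq {m : ℕ} {g : Gate m} {D : Circuit m} (h : SwapInsert g D)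
    (ψ : Term m → ℂ) : Circuit.run D ψ = g.act ψ := by
  induction h generalizing ψ with
  | base _ => rfl
  | @control κ c c' t h h' D hc _ _ ih =>
    have h1 : Equiv.swap c c' c' = c := Equiv.swap_apply_right _ _
    have h2 : Equiv.swap c c' t = t := Equiv.swap_apply_of_ne_of_ne h.symm h'.symm
    have := run_swap_conj c c' hc (by rw [h1, h2]; exact h) ih ψ
    rw [this]
    congr 1
    simp only [h1, h2]
  | @target κ c t t' h h' D ht _ _ ih =>
    have h1 : Equiv.swap t t' t' = t := Equiv.swap_apply_right _ _
    have h2 : Equiv.swap t t' c = c := Equiv.swap_apply_of_ne_of_ne h h'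
    have := run_swap_conj t t' ht (by rw [h1, h2]; exact h) ih ψ
    rw [this]
    congr 1
    simp only [h1, h2]

theorem isLNN_swapCircuit {m : ℕ} {i j : Fin m} (h : i ≠ j) (ha : Adjacent i j) :
    ∀ g ∈ swapCircuit i j h, g.IsLNN := by
  have hb : Adjacent j i := by rw [Adjacent, Nat.dist_comm]; exact ha
  simp [swapCircuit, Gate.IsLNN, ha, hb]

theorem SwapInsert.isLNN {m : ℕ} {g : Gate m} {D : Circuit m} (h : SwapInsert g D) :
    ∀ g' ∈ D, g'.IsLNN := by
  induction h with
  | base h => simpa using h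
  | control hc ha _ ih =>
    have := isLNN_swapCircuit hc ha
    simp only [List.mem_append]
    rintro g' ((h | h) | h)
    exacts [this g' h, ih g' h, this g' h]
  | target hc ha _ ih =>
    have := isLNN_swapCircuit hc ha
    simp only [List.mem_append]
    rintro g' ((h | h) | h)
    exacts [this g' h, ih g' h, this g' h]

/-- The target is moved one line towards the control at a time; every such move costs two SWAPs,
that is six CNOTs. -/
theorem exists_swapInsert_ctrl {m : ℕ} (κ : Kind) (d : ℕ) (c t : Fin m) (h : c ≠ t)
    (hd : Nat.dist (c : ℕ) (t : ℕ) = d + 1) :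
    ∃ D, SwapInsert (.ctrl κ c t h) D ∧ D.length = 6 * d + 1 := by
  induction d generalizing t with
  | zero => exact ⟨_, .base (by simpa [Gate.IsLNN, Adjacent] using hd), rfl⟩
  | succ d ih =>
    have hc := c.2
    have ht := t.2
    obtain ⟨t', h1, h2⟩ : ∃ t' : Fin m, Nat.dist (t : ℕ) (t' : ℕ) = 1 ∧
        Nat.dist (c : ℕ) (t' : ℕ) = d + 1 := by
      simp only [Nat.dist] at hd ⊢
      rcases Nat.lt_or_ge (c : ℕ) (t : ℕ) with hlt | hge
      · exact ⟨⟨t - 1, by omega⟩, by simp only; omega, by simp only; omega⟩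
      · exact ⟨⟨t + 1, by omega⟩, by simp only; omega, by simp only; omega⟩
    have hct' : c ≠ t' := by
      rintro rfl
      simp at h2
    have htt' : t ≠ t' := by
      rintro rfl
      simp at h1
    obtain ⟨D, hD, hl⟩ := ih t' hct' h2
    refine ⟨_, .target htt' h1 hD, ?_⟩
    simp only [List.length_append, swapCircuit, List.length_cons, List.length_nil, hl]
    ring

theorem exists_swapInsert {m : ℕ} (g : Gate m) : ∃ D, SwapInsert g D ∧ D.length = g.lnn := by
  cases g with
  | not t => exact ⟨_, .base trivial, rfl⟩
  | ctrl κ c t h =>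
    have hne : Nat.dist (c : ℕ) (t : ℕ) ≠ 0 := fun e => h (Fin.ext (Nat.eq_of_dist_eq_zero e))
    obtain ⟨D, hD, hl⟩ := exists_swapInsert_ctrl κ (Nat.dist (c : ℕ) (t : ℕ) - 1) c t h (by omega)
    exact ⟨D, hD, hl⟩

theorem exists_lnnVersion {m : ℕ} (C : Circuit m) :
    ∃ D, LNNVersion C D ∧ (∀ g ∈ D, g.IsLNN) ∧ (∀ ψ, Circuit.run D ψ = Circuit.run C ψ) ∧
      D.length = Circuit.lnn C := by
  induction C with
  | nil => exact ⟨[], ⟨[], .nil, rfl⟩, by simp, fun _ => rfl, rfl⟩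
  | cons g C ih =>
    obtain ⟨D, ⟨Ds, hDs, rfl⟩, h1, h2, h3⟩ := ih
    obtain ⟨E, hE, hl⟩ := exists_swapInsert g
    refine ⟨E ++ Ds.flatten, ⟨E :: Ds, .cons hE hDs, rfl⟩, ?_, ?_, ?_⟩
    · simp only [List.mem_append]
      rintro g' (h | h)
      exacts [hE.isLNN g' h, h1 g' h]
    · intro ψ
      rw [Circuit.run_append, hE.run_eq, h2, Circuit.run_cons]
    · rw [List.length_append, hl, h3]; simp [Circuit.lnn]

/-! ### Cycles under injective maps -/

theorem List.formPerm_map_apply {α β : Type*} [DecidableEq α] [DecidableEq β] {f : α → β}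
    (hf : Function.Injective f) (l : List α) (x : α) :
    (l.map f).formPerm (f x) = f (l.formPerm x) := by
  induction l with
  | nil => simp
  | cons a l ih =>
    cases l with
    | nil => simp
    | cons b l =>
      rw [List.map_cons, List.map_cons, List.formPerm_cons_cons, List.formPerm_cons_cons,
        Equiv.Perm.mul_apply, Equiv.Perm.mul_apply, ← hf.swap_apply]
      rw [List.map_cons] at ih
      rw [ih]

/-- Naturality of cycles under injections. It is used for the embedding of the six lines, and for
`π`, which carries the input terms to the prescribed ones. -/
theorem cyclePerm_comp_apply {n m : ℕ} (τ : CycleType) {f : Term n → Term m}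
    (hf : Function.Injective f) (v : Fin τ.size → Term n) (x : Term n) :
    cyclePerm τ (f ∘ v) (f x) = f (cyclePerm τ v x) := by
  unfold cyclePerm
  induction τ.cycles with
  | nil => simp
  | cons l L ih =>
    rw [List.map_cons, List.map_cons, List.prod_cons, List.prod_cons, Equiv.Perm.mul_apply,
      Equiv.Perm.mul_apply, ih, ← List.map_map, List.formPerm_map_apply hf]

theorem cyclePerm_apply_of_notMem {n : ℕ} (τ : CycleType) (v : Fin τ.size → Term n) {x : Term n}
    (hx : ∀ i, v i ≠ x) : cyclePerm τ v x = x := by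
  unfold cyclePerm
  induction τ.cycles with
  | nil => simp
  | cons l L ih =>
    rw [List.map_cons, List.prod_cons, Equiv.Perm.mul_apply, ih, List.formPerm_apply_of_notMem]
    simp [hx]

/-! ### The six lines around the middle line -/

section Window

variable {n : ℕ} (hn : 6 ≤ n)

/-- The lines with relative positions from `-3` to `2`. -/
def win : Fin 6 ↪ Fin n where
  toFun j := ⟨n / 2 - 3 + j, by omega⟩
  inj' i j h := by
    simp only [Fin.mk.injEq] at h
    exact Fin.ext (by omega)

theorem val_win (j : Fin 6) : (win hn j : ℕ) = n / 2 - 3 + j := rfl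

theorem offset_win (j : Fin 6) : offset (win hn j) = offset j := by
  have : 3 ≤ n / 2 := by omega
  simp only [offset, val_win]
  omega

theorem exists_win_eq_iff (i : Fin n) : (∃ j, win hn j = i) ↔ -3 ≤ offset i ∧ offset i ≤ 2 := by
  constructor
  · rintro ⟨j, rfl⟩
    rw [offset_win]
    have := j.2
    simp only [offset]
    omega
  · rintro ⟨h1, h2⟩
    simp only [offset] at h1 h2
    refine ⟨⟨i - (n / 2 - 3), by omega⟩, Fin.ext ?_⟩
    rw [val_win]
    simp only
    omega

/-- All positions of the list are those of window lines. -/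
def InWindow (L : List ℤ) : Prop := ∀ o ∈ L, -3 ≤ o ∧ o ≤ 2

instance (L : List ℤ) : Decidable (InWindow L) := inferInstanceAs (Decidable (∀ _ ∈ _, _))

/-- The term on `n` lines with the given bits on the window lines and `0` elsewhere. -/
def embed (w : Term 6) : Term n := fun i => decide (∃ j, win hn j = i ∧ w j = true)

theorem embed_win (w : Term 6) (j : Fin 6) : embed hn w (win hn j) = w j := by
  simp [embed]

theorem embed_of_ne (w : Term 6) {i : Fin n} (hi : ∀ j, win hn j ≠ i) : embed hn w i = false := by
  simp [embed, hi]

theorem embed_injective : Function.Injective (embed hn) := by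
  intro w w' h
  funext j
  rw [← embed_win hn w, h, embed_win]

theorem embed_comp_win {x : Term n} (hx : ∀ i, (∀ j, win hn j ≠ i) → x i = false) :
    embed hn (x ∘ win hn) = x := by
  funext i
  by_cases hi : ∃ j, win hn j = i
  · obtain ⟨j, rfl⟩ := hi
    rw [embed_win]; rfl
  · push Not at hi
    rw [embed_of_ne hn _ hi, hx i hi]

theorem embed_bits {L : List ℤ} (hL : InWindow L) : embed hn (bits 6 L) = bits n L := by
  funext i
  by_cases hi : ∃ j, win hn j = i
  · obtain ⟨j, rfl⟩ := hi
    rw [embed_win, bits, bits, offset_win]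
  · have h : offset i ∉ L := fun h => hi ((exists_win_eq_iff hn i).2 (hL _ h))
    push Not at hi
    rw [embed_of_ne hn _ hi, bits, decide_eq_false h]

theorem map_linesAt {L : List ℤ} (hL : InWindow L) :
    (linesAt 6 L).map (win hn) = linesAt n L := by
  ext i
  simp only [Finset.mem_map, linesAt, Finset.mem_filter, Finset.mem_univ, true_and]
  constructor
  · rintro ⟨j, hj, rfl⟩
    rwa [offset_win]
  · intro h
    obtain ⟨j, rfl⟩ := (exists_win_eq_iff hn i).2 (hL _ h)
    exact ⟨j, by rwa [offset_win] at h, rfl⟩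

/-- The lines outside of the window. -/
def outside : Finset (Fin n) := (Finset.univ.map (win hn))ᶜ

theorem mem_outside {i : Fin n} : i ∈ outside hn ↔ ∀ j, win hn j ≠ i := by
  simp [outside]

theorem card_outside : (outside hn).card = n - 6 := by
  rw [outside, Finset.card_compl]; simp

/-- A gate on the window lines with additional negative controls. -/
def liftGate (A : Finset (Fin n)) (g : Toffoli 6) : Toffoli n :=
  ⟨g.pos.map (win hn), g.neg.map (win hn) ∪ A, win hn g.target⟩

theorem liftGate_act_of {A : Finset (Fin n)} {g : Toffoli 6} {x : Term n}
    (hA : ∀ i ∈ A, x i = false) :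
    (liftGate hn A g).act x ∘ win hn = g.act (x ∘ win hn) ∧
      ∀ i ∈ outside hn, (liftGate hn A g).act x i = x i := by
  have hf : (liftGate hn A g).Fires x ↔ g.Fires (x ∘ win hn) := by
    simp only [Toffoli.Fires, liftGate, Finset.forall_mem_map, Finset.mem_union, or_imp,
      forall_and, Function.comp_apply]
    constructor
    · rintro ⟨h1, h2, -⟩
      exact ⟨h1, h2⟩
    · rintro ⟨h1, h2⟩
      exact ⟨h1, h2, hA⟩
  simp only [Toffoli.act_eq, hf]
  split_ifs
  · refine ⟨?_, fun i hi => flipBit_ne (fun e => ?_) _⟩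
    · funext j
      simp [flipBit_apply, liftGate]
    · exact (mem_outside hn).1 hi _ e.symm
  · exact ⟨rfl, fun _ _ => rfl⟩

theorem liftGate_act_of_not {A : Finset (Fin n)} {g : Toffoli 6} {x : Term n}
    (hA : ¬ ∀ i ∈ A, x i = false) : (liftGate hn A g).act x = x := by
  rw [Toffoli.act_eq, if_neg]
  rintro ⟨-, h⟩
  exact hA fun i hi => h i (Finset.mem_union_right _ hi)

theorem run_liftGate_empty (gs : List (Toffoli 6)) (w : Term 6) :
    Toffoli.run (gs.map (liftGate hn ∅)) (embed hn w) = embed hn (Toffoli.run gs w) := by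
  induction gs generalizing w with
  | nil => rfl
  | cons g gs ih =>
    rw [List.map_cons, Toffoli.run_cons, Toffoli.run_cons, ← ih]
    congr 1
    obtain ⟨h1, h2⟩ := liftGate_act_of hn (A := ∅) (g := g) (x := embed hn w) (by simp)
    have h3 : embed hn w ∘ win hn = w := funext fun j => embed_win hn w j
    rw [h3] at h1
    rw [← h1, embed_comp_win]
    intro i hi
    rw [h2 i ((mem_outside hn).2 hi), embed_of_ne hn _ hi]

theorem liftGate_valid {A : Finset (Fin n)} (hA : A ⊆ outside hn) {g : Toffoli 6}
    (hg : g.Valid) : (liftGate hn A g).Valid := by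
  obtain ⟨h1, h2, h3⟩ := hg
  have hout : ∀ j, win hn j ∉ A := fun j hj => (mem_outside hn).1 (hA hj) j rfl
  refine ⟨?_, ?_, ?_⟩
  · rw [Finset.disjoint_left]
    intro i hi hi'
    obtain ⟨j, hj, rfl⟩ := Finset.mem_map.1 hi
    rcases Finset.mem_union.1 hi' with h | h
    · exact Finset.disjoint_left.1 h1 hj ((Finset.mem_map' _).1 h)
    · exact hout j h
  · exact fun h => h2 ((Finset.mem_map' _).1 h)
  · intro h
    rcases Finset.mem_union.1 h with h | h
    · exact h3 ((Finset.mem_map' _).1 h)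
    · exact hout _ h

theorem card_liftGate {A : Finset (Fin n)} (hA : A ⊆ outside hn) (g : Toffoli 6) :
    (liftGate hn A g).pos.card = g.pos.card ∧
      (liftGate hn A g).neg.card = g.neg.card + A.card := by
  refine ⟨Finset.card_map _, ?_⟩
  rw [liftGate, Finset.card_union_of_disjoint, Finset.card_map]
  rw [Finset.disjoint_left]
  intro i hi hi'
  obtain ⟨j, hj, rfl⟩ := Finset.mem_map.1 hi
  exact (mem_outside hn).1 (hA hi') j rfl

/-! ### Realization of the fixed permutations -/

/-- A gate on the window lines which is further controlled by the first, the second half of the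
other lines. -/
structure SplitGate : Type where
  first : Bool
  second : Bool
  gate : Toffoli 6

/-- The additional controls of a split gate. -/
def SplitGate.extra (A B : Finset (Fin n)) (g : SplitGate) : Finset (Fin n) :=
  (if g.first then A else ∅) ∪ (if g.second then B else ∅)

/-- The gates that remain if the first and the second half of the other lines are (not) `0`. -/
def activeGates (p q : Bool) (L : List SplitGate) : List (Toffoli 6) :=
  (L.filter fun g => (!g.first || p) && (!g.second || q)).map SplitGate.gate

/-- The gates realize the fixed permutation if the other lines are `0`, and the identity
otherwise. -/
def RealizesKappa (τ : CycleType) (L : List SplitGate) : Prop :=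
  (∀ i, InWindow (τ.row i).final) ∧
  (∀ w, Toffoli.run (activeGates true true L) w = kappaPerm 6 τ w) ∧
  (∀ w, Toffoli.run (activeGates true false L) w = w) ∧
  (∀ w, Toffoli.run (activeGates false true L) w = w) ∧
  (∀ w, Toffoli.run (activeGates false false L) w = w)

/-- No gate has a target outside the window, so whether each half is all 0 stays constant during the
run, and it decides which gates are switched on. -/
theorem run_splitGates {A B : Finset (Fin n)} (hA : A ⊆ outside hn) (hB : B ⊆ outside hn)
    (L : List SplitGate) (x : Term n) (p q : Bool) (hp : (∀ i ∈ A, x i = false) ↔ p = true)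
    (hq : (∀ i ∈ B, x i = false) ↔ q = true) :
    Toffoli.run (L.map fun g => liftGate hn (g.extra A B) g.gate) x ∘ win hn =
        Toffoli.run (activeGates p q L) (x ∘ win hn) ∧
      ∀ i ∈ outside hn,
        Toffoli.run (L.map fun g => liftGate hn (g.extra A B) g.gate) x i = x i := by
  induction L generalizing x with
  | nil => exact ⟨rfl, fun _ _ => rfl⟩
  | cons g L ih =>
    have hiff : (∀ i ∈ g.extra A B, x i = false) ↔
        ((!g.first || p) && (!g.second || q)) = true := by
      rw [SplitGate.extra]
      cases g.first <;> cases g.second <;>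
        simp [Finset.mem_union, or_imp, forall_and, hp, hq]
    rw [List.map_cons, Toffoli.run_cons]
    by_cases h : ∀ i ∈ g.extra A B, x i = false
    · obtain ⟨h1, h2⟩ := liftGate_act_of hn (g := g.gate) h
      set y := (liftGate hn (g.extra A B) g.gate).act x
      have hyA : ∀ i ∈ A, y i = x i := fun i hi => h2 i (hA hi)
      have hyB : ∀ i ∈ B, y i = x i := fun i hi => h2 i (hB hi)
      obtain ⟨h3, h4⟩ := ih y
        ((forall_congr' fun i => forall_congr' fun hi => by rw [hyA i hi]).trans hp)
        ((forall_congr' fun i => forall_congr' fun hi => by rw [hyB i hi]).trans hq)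
      refine ⟨?_, fun i hi => (h4 i hi).trans (h2 i hi)⟩
      rw [h3, h1]
      simp only [activeGates, List.filter_cons, hiff.1 h, if_true, List.map_cons, Toffoli.run_cons]
    · rw [liftGate_act_of_not hn h]
      obtain ⟨h3, h4⟩ := ih x hp hq
      refine ⟨?_, h4⟩
      have h' := mt hiff.2 h
      rw [h3]
      simp only [activeGates, List.filter_cons, h', Bool.false_eq_true, if_false]

/-- If all outside lines are 0, the term is embedded from six lines and all gates are active.
Otherwise some half is switched off and the remaining gates cancel, in agreement with the fixed
permutation, whose terms all vanish outside the window. -/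
theorem RealizesKappa.run_eq {τ : CycleType} {L : List SplitGate} (h : RealizesKappa τ L)
    {A B : Finset (Fin n)} (hAB : A ∪ B = outside hn) (x : Term n) :
    Toffoli.run (L.map fun g => liftGate hn (g.extra A B) g.gate) x = kappaPerm n τ x := by
  obtain ⟨hw, h11, h10, h01, h00⟩ := h
  have hA : A ⊆ outside hn := hAB ▸ Finset.subset_union_left
  have hB : B ⊆ outside hn := hAB ▸ Finset.subset_union_right
  have hk : (fun i => bits n (τ.row i).final) =
      embed hn ∘ fun i => bits 6 (τ.row i).final := by
    funext i
    exact (embed_bits hn (hw i)).symm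
  have key := run_splitGates hn hA hB L x (decide (∀ i ∈ A, x i = false))
    (decide (∀ i ∈ B, x i = false)) (by simp) (by simp)
  have hext : ∀ y : Term n, y ∘ win hn = x ∘ win hn → (∀ i ∈ outside hn, y i = x i) → y = x := by
    intro y h1 h2
    funext i
    by_cases hi : ∃ j, win hn j = i
    · obtain ⟨j, rfl⟩ := hi
      exact congrFun h1 j
    · push Not at hi
      exact h2 i ((mem_outside hn).2 hi)
  by_cases hx : ∀ i ∈ outside hn, x i = false
  · have hxA : ∀ i ∈ A, x i = false := fun i hi => hx i (hA hi)
    have hxB : ∀ i ∈ B, x i = false := fun i hi => hx i (hB hi)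
    rw [decide_eq_true hxA, decide_eq_true hxB, h11] at key
    obtain ⟨k1, k2⟩ := key
    have hxe : embed hn (x ∘ win hn) = x :=
      embed_comp_win hn fun i hi => hx i ((mem_outside hn).2 hi)
    rw [kappaPerm, hk]
    conv_rhs => rw [← hxe]
    rw [cyclePerm_comp_apply τ (embed_injective hn)]
    rw [← embed_comp_win hn (x := Toffoli.run _ x), k1]
    · rfl
    · intro i hi
      have := (mem_outside hn).2 hi
      rw [k2 i this, hx i this]
  · have hkx : kappaPerm n τ x = x := by
      refine cyclePerm_apply_of_notMem _ _ fun i hi => hx fun l hl => ?_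
      rw [← hi, ← embed_bits hn (hw i), embed_of_ne]
      exact (mem_outside hn).1 hl
    rw [hkx]
    have hnot : ¬ ((∀ i ∈ A, x i = false) ∧ ∀ i ∈ B, x i = false) := by
      rintro ⟨h1, h2⟩
      refine hx fun i hi => ?_
      rw [← hAB, Finset.mem_union] at hi
      exact hi.elim (h1 i) (h2 i)
    refine hext _ ?_ key.2
    rw [key.1]
    by_cases hxA : ∀ i ∈ A, x i = false <;> by_cases hxB : ∀ i ∈ B, x i = false
    · exact absurd ⟨hxA, hxB⟩ hnot
    · rw [decide_eq_true hxA, decide_eq_false hxB, h10]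
    · rw [decide_eq_false hxA, decide_eq_true hxB, h01]
    · rw [decide_eq_false hxA, decide_eq_false hxB, h00]

end Window

/-! ### Toffoli cascades for the nine fixed permutations -/

/-- The cascade is a commutator of two involutions whose supports share a single term, hence a
3-cycle. Each involution carries only half of the outside controls. For (3,3) the supports share two
terms, giving two 3-cycles. -/
theorem realizesKappa_type3 : RealizesKappa type3
    [⟨true, false, ⟨∅, {3, 0, 1}, 4⟩⟩, ⟨false, true, ⟨{2, 4}, {5}, 3⟩⟩,
     ⟨true, false, ⟨∅, {3, 0, 1}, 4⟩⟩, ⟨false, true, ⟨{2, 4}, {5}, 3⟩⟩] := by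
  refine ⟨?_, ?_, ?_, ?_, ?_⟩ <;> decide +kernel
theorem realizesKappa_type33 : RealizesKappa type33
    [⟨true, false, ⟨{1}, {3, 0}, 2⟩⟩, ⟨false, true, ⟨{2}, {4}, 3⟩⟩,
     ⟨true, false, ⟨{1}, {3, 0}, 2⟩⟩, ⟨false, true, ⟨{2}, {4}, 3⟩⟩] := by
  refine ⟨?_, ?_, ?_, ?_, ?_⟩ <;> decide +kernel
theorem realizesKappa_type2 : RealizesKappa type2 [⟨true, true, ⟨{4}, {0, 1, 2, 5}, 3⟩⟩] := by
  refine ⟨?_, ?_, ?_, ?_, ?_⟩ <;> decide +kernel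
theorem realizesKappa_type22 : RealizesKappa type22 [⟨true, true, ⟨{5}, {0, 1, 4}, 2⟩⟩] := by
  refine ⟨?_, ?_, ?_, ?_, ?_⟩ <;> decide +kernel
theorem realizesKappa_type4 : RealizesKappa type4
    [⟨true, true, ⟨{5, 2}, {0, 1, 4}, 3⟩⟩, ⟨true, true, ⟨{5}, {0, 1, 4}, 2⟩⟩] := by
  refine ⟨?_, ?_, ?_, ?_, ?_⟩ <;> decide +kernel
theorem realizesKappa_type42 : RealizesKappa type42
    [⟨true, true, ⟨{5, 2}, {0, 4}, 3⟩⟩, ⟨true, true, ⟨{5}, {0, 1, 4}, 2⟩⟩] := by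
  refine ⟨?_, ?_, ?_, ?_, ?_⟩ <;> decide +kernel
theorem realizesKappa_type44 : RealizesKappa type44
    [⟨true, true, ⟨{5, 1}, {0, 4}, 2⟩⟩, ⟨true, true, ⟨{5}, {0, 4}, 1⟩⟩] := by
  refine ⟨?_, ?_, ?_, ?_, ?_⟩ <;> decide +kernel
-- The window gate occurs twice and cancels when the fully controlled gates are inactive, so it
-- needs no outside controls and has bounded cost. The same holds for (5,5).
theorem realizesKappa_type5 : RealizesKappa type5
    [⟨false, false, ⟨{1, 2}, ∅, 3⟩⟩, ⟨true, true, ⟨{5}, {0, 3, 4}, 1⟩⟩,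
     ⟨false, false, ⟨{1, 2}, ∅, 3⟩⟩, ⟨true, true, ⟨{5}, {0, 3, 4}, 2⟩⟩] := by
  refine ⟨?_, ?_, ?_, ?_, ?_⟩ <;> decide +kernel
theorem realizesKappa_type55 : RealizesKappa type55
    [⟨false, false, ⟨{0, 1}, ∅, 2⟩⟩, ⟨true, true, ⟨{5}, {2, 4}, 0⟩⟩,
     ⟨false, false, ⟨{0, 1}, ∅, 2⟩⟩, ⟨true, true, ⟨{5}, {2, 4}, 1⟩⟩] := by
  refine ⟨?_, ?_, ?_, ?_, ?_⟩ <;> decide +kernel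

/-! ### Costs of the fixed permutations -/

theorem exists_halves {n : ℕ} (hn : 6 ≤ n) : ∃ A B : Finset (Fin n), A ∪ B = outside hn ∧
    A.card = (n - 5) / 2 ∧ B.card = (n - 6) / 2 := by
  obtain ⟨A, hA, hc⟩ := Finset.exists_subset_card_eq
    (show (n - 5) / 2 ≤ (outside hn).card by rw [card_outside]; omega)
  refine ⟨A, outside hn \ A, Finset.union_sdiff_of_subset hA, hc, ?_⟩
  rw [Finset.card_sdiff_of_subset hA, hc, card_outside]
  omega

/-- At most `4 + a` window controls and `n - 6` outside ones leave one of the `n + a` lines free, as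
the commutator construction requires. The `26n` is 24 per control plus 2 for a negative one; the
SWAP count uses only that a gate spans at most all lines. -/
theorem hasCost_full {n a : ℕ} (hn : 6 ≤ n) (ha : a ≤ 1) {A B : Finset (Fin n)}
    (hAB : A ∪ B = outside hn) {g : Toffoli 6} (hg : g.Valid)
    (hc : g.pos.card + g.neg.card ≤ 4 + a) :
    HasCost a [liftGate hn (SplitGate.extra A B ⟨true, true, g⟩) g] (26 * n + 30)
      (144 * n ^ 2 + 500 * n) := by
  have he : SplitGate.extra A B ⟨true, true, g⟩ = outside hn := by simp [SplitGate.extra, hAB]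
  rw [he]
  obtain ⟨h1, h2⟩ := card_liftGate hn (subset_refl (outside hn)) g
  have h3 := card_outside hn
  refine ((liftGate_valid hn (subset_refl _) hg).hasCost_of_add_two_le a (by omega)).mono ?_ ?_
  · omega
  · have h4 : (liftGate hn (outside hn) g).pos.card +
        (liftGate hn (outside hn) g).neg.card ≤ n := by
      omega
    have h5 : 6 * (n + a) * (24 * ((liftGate hn (outside hn) g).pos.card +
        (liftGate hn (outside hn) g).neg.card) + 28) ≤ 6 * (n + 1) * (24 * n + 28) := by gcongr
    nlinarith

/-- With half of the outside lines and three window lines there are at most `(n + 1) / 2` controls,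
just within reach of the ladder: `12 · (n + 1) / 2` gates, plus two per negative control. -/
theorem hasCost_half {n a : ℕ} (hn : 6 ≤ n) (ha : a ≤ 1) {E : Finset (Fin n)}
    (hE : E ⊆ outside hn) (hc' : E.card ≤ (n - 5) / 2) {g : Toffoli 6} (hg : g.Valid)
    (hc : g.pos.card + g.neg.card ≤ 3) :
    HasCost a [liftGate hn E g] (7 * n + 8) (36 * n ^ 2 + 200 * n) := by
  obtain ⟨h1, h2⟩ := card_liftGate hn hE g
  refine ((liftGate_valid hn hE hg).hasCost_of_two_mul_le a (by omega)).mono ?_ ?_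
  · omega
  · have h4 : 12 * ((liftGate hn E g).pos.card + (liftGate hn E g).neg.card) + 1 ≤ 6 * n + 7 := by
      omega
    have h6 : (liftGate hn E g).neg.card ≤ n := by omega
    have h5 : 6 * (n + a) * (12 * ((liftGate hn E g).pos.card + (liftGate hn E g).neg.card) + 1) ≤
        6 * (n + 1) * (6 * n + 7) := by gcongr
    nlinarith

theorem hasCost_few {n a : ℕ} (hn : 6 ≤ n) (ha : a ≤ 1) {g : Toffoli n} (hg : g.Valid)
    (hc : g.pos.card + g.neg.card ≤ 3) : HasCost a [g] 43 (300 * n) := by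
  refine (hg.hasCost_of_two_mul_le a (by omega)).mono ?_ ?_
  · omega
  · have h5 : 6 * (n + a) * (12 * (g.pos.card + g.neg.card) + 1) ≤ 6 * (n + 1) * 37 := by
      gcongr
      omega
    omega

theorem hasCost_first_half {n a : ℕ} (hn : 6 ≤ n) (ha : a ≤ 1) {A B : Finset (Fin n)}
    (hAB : A ∪ B = outside hn) (hA : A.card = (n - 5) / 2) {g : Toffoli 6} (hg : g.Valid)
    (hc : g.pos.card + g.neg.card ≤ 3) :
    HasCost a [liftGate hn (SplitGate.extra A B ⟨true, false, g⟩) g] (7 * n + 8)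
      (36 * n ^ 2 + 200 * n) := by
  have he : SplitGate.extra A B ⟨true, false, g⟩ = A := by simp [SplitGate.extra]
  rw [he]
  exact hasCost_half hn ha (hAB ▸ Finset.subset_union_left) hA.le hg hc

theorem hasCost_second_half {n a : ℕ} (hn : 6 ≤ n) (ha : a ≤ 1) {A B : Finset (Fin n)}
    (hAB : A ∪ B = outside hn) (hB : B.card = (n - 6) / 2) {g : Toffoli 6} (hg : g.Valid)
    (hc : g.pos.card + g.neg.card ≤ 3) :
    HasCost a [liftGate hn (SplitGate.extra A B ⟨false, true, g⟩) g] (7 * n + 8)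
      (36 * n ^ 2 + 200 * n) := by
  have he : SplitGate.extra A B ⟨false, true, g⟩ = B := by simp [SplitGate.extra]
  rw [he]
  exact hasCost_half hn ha (hAB ▸ Finset.subset_union_right) (by omega) hg hc

theorem hasCost_window {n a : ℕ} (hn : 6 ≤ n) (ha : a ≤ 1) {A B : Finset (Fin n)}
    {g : Toffoli 6} (hg : g.Valid) (hc : g.pos.card + g.neg.card ≤ 3) :
    HasCost a [liftGate hn (SplitGate.extra A B ⟨false, false, g⟩) g] 43 (300 * n) := by
  have he : SplitGate.extra A B ⟨false, false, g⟩ = ∅ := by simp [SplitGate.extra]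
  rw [he]
  obtain ⟨h1, h2⟩ := card_liftGate hn (Finset.empty_subset (outside hn)) g
  refine hasCost_few hn ha (liftGate_valid hn (Finset.empty_subset _) hg) ?_
  rw [h1, h2]
  simpa using hc

instance {n : ℕ} (g : Toffoli n) : Decidable g.Valid :=
  inferInstanceAs (Decidable (_ ∧ _ ∧ _))

/-- The fixed permutation of the type can be realized within the given cost. -/
def KappaCost (n a : ℕ) (τ : CycleType) (ℓ k : ℕ) : Prop :=
  ∃ K : Circuit (n + a), Realizes K (kappaPerm n τ) ∧ K.length ≤ ℓ ∧ Circuit.lnn K ≤ k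

theorem RealizesKappa.kappaCost {n a : ℕ} (hn : 6 ≤ n) {τ : CycleType} {L : List SplitGate}
    (h : RealizesKappa τ L) {A B : Finset (Fin n)} (hAB : A ∪ B = outside hn) {ℓ k ℓ' k' : ℕ}
    (hc : HasCost a (L.map fun g => liftGate hn (g.extra A B) g.gate) ℓ k) (hℓ : ℓ ≤ ℓ')
    (hk : k ≤ k') : KappaCost n a τ ℓ' k' := by
  obtain ⟨Cs, h1, h2, h3⟩ := hc.mono hℓ hk
  exact ⟨Cs.flatten, (realizes_flatten h1).congr fun x => h.run_eq hn hAB x, h2, h3⟩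

/-- A single transposition needs `n - 1` controls, so without the ancilla no line would be free. -/
theorem kappaCost_type2 {n a : ℕ} (hn : 6 ≤ n) (ha : a ≤ 1) (ha' : a = 1) :
    KappaCost n a type2 (52 * n + 150) (288 * n ^ 2 + 1600 * n) := by
  obtain ⟨A, B, hAB, -, -⟩ := exists_halves hn
  exact realizesKappa_type2.kappaCost hn hAB
    (hasCost_full hn ha hAB (by decide) (by subst ha'; decide))
    (by omega) (by nlinarith)

theorem kappaCost_type22 {n a : ℕ} (hn : 6 ≤ n) (ha : a ≤ 1) :
    KappaCost n a type22 (26 * n + 30) (144 * n ^ 2 + 500 * n) := by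
  obtain ⟨A, B, hAB, -, -⟩ := exists_halves hn
  exact realizesKappa_type22.kappaCost hn hAB
    (hasCost_full hn ha hAB (by decide) (le_trans (by decide) (Nat.le_add_right 4 a)))
    (by omega) (by nlinarith)

theorem kappaCost_type3 {n a : ℕ} (hn : 6 ≤ n) (ha : a ≤ 1) :
    KappaCost n a type3 (28 * n + 32) (144 * n ^ 2 + 800 * n) := by
  obtain ⟨A, B, hAB, hA, hB⟩ := exists_halves hn
  exact realizesKappa_type3.kappaCost hn hAB
    ((hasCost_first_half hn ha hAB hA (by decide) (by decide)).append
      ((hasCost_second_half hn ha hAB hB (by decide) (by decide)).append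
      ((hasCost_first_half hn ha hAB hA (by decide) (by decide)).append
      (hasCost_second_half hn ha hAB hB (by decide) (by decide)))))
    (by omega) (by nlinarith)

theorem kappaCost_type33 {n a : ℕ} (hn : 6 ≤ n) (ha : a ≤ 1) :
    KappaCost n a type33 (28 * n + 32) (144 * n ^ 2 + 800 * n) := by
  obtain ⟨A, B, hAB, hA, hB⟩ := exists_halves hn
  exact realizesKappa_type33.kappaCost hn hAB
    ((hasCost_first_half hn ha hAB hA (by decide) (by decide)).append
      ((hasCost_second_half hn ha hAB hB (by decide) (by decide)).append
      ((hasCost_first_half hn ha hAB hA (by decide) (by decide)).append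
      (hasCost_second_half hn ha hAB hB (by decide) (by decide)))))
    (by omega) (by nlinarith)

theorem kappaCost_type4 {n a : ℕ} (hn : 6 ≤ n) (ha : a ≤ 1) (ha' : a = 1) :
    KappaCost n a type4 (52 * n + 150) (288 * n ^ 2 + 1600 * n) := by
  obtain ⟨A, B, hAB, -, -⟩ := exists_halves hn
  exact realizesKappa_type4.kappaCost hn hAB
    ((hasCost_full hn ha hAB (by decide) (by subst ha'; decide)).append
      (hasCost_full hn ha hAB (by decide) (le_trans (by decide) (Nat.le_add_right 4 a))))
    (by omega) (by nlinarith)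

theorem kappaCost_type42 {n a : ℕ} (hn : 6 ≤ n) (ha : a ≤ 1) :
    KappaCost n a type42 (52 * n + 150) (288 * n ^ 2 + 1600 * n) := by
  obtain ⟨A, B, hAB, -, -⟩ := exists_halves hn
  exact realizesKappa_type42.kappaCost hn hAB
    ((hasCost_full hn ha hAB (by decide) (le_trans (by decide) (Nat.le_add_right 4 a))).append
      (hasCost_full hn ha hAB (by decide) (le_trans (by decide) (Nat.le_add_right 4 a))))
    (by omega) (by nlinarith)

theorem kappaCost_type44 {n a : ℕ} (hn : 6 ≤ n) (ha : a ≤ 1) :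
    KappaCost n a type44 (52 * n + 150) (288 * n ^ 2 + 1600 * n) := by
  obtain ⟨A, B, hAB, -, -⟩ := exists_halves hn
  exact realizesKappa_type44.kappaCost hn hAB
    ((hasCost_full hn ha hAB (by decide) (le_trans (by decide) (Nat.le_add_right 4 a))).append
      (hasCost_full hn ha hAB (by decide) (le_trans (by decide) (Nat.le_add_right 4 a))))
    (by omega) (by nlinarith)

theorem kappaCost_type5 {n a : ℕ} (hn : 6 ≤ n) (ha : a ≤ 1) :
    KappaCost n a type5 (52 * n + 150) (288 * n ^ 2 + 1600 * n) := by
  obtain ⟨A, B, hAB, -, -⟩ := exists_halves hn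
  exact realizesKappa_type5.kappaCost hn hAB
    ((hasCost_window hn ha (by decide) (by decide)).append
      ((hasCost_full hn ha hAB (by decide) (le_trans (by decide) (Nat.le_add_right 4 a))).append
      ((hasCost_window hn ha (by decide) (by decide)).append
      (hasCost_full hn ha hAB (by decide) (le_trans (by decide) (Nat.le_add_right 4 a))))))
    (by omega) (by nlinarith)

theorem kappaCost_type55 {n a : ℕ} (hn : 6 ≤ n) (ha : a ≤ 1) :
    KappaCost n a type55 (52 * n + 150) (288 * n ^ 2 + 1600 * n) := by
  obtain ⟨A, B, hAB, -, -⟩ := exists_halves hn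
  exact realizesKappa_type55.kappaCost hn hAB
    ((hasCost_window hn ha (by decide) (by decide)).append
      ((hasCost_full hn ha hAB (by decide) (le_trans (by decide) (Nat.le_add_right 4 a))).append
      ((hasCost_window hn ha (by decide) (by decide)).append
      (hasCost_full hn ha hAB (by decide) (le_trans (by decide) (Nat.le_add_right 4 a))))))
    (by omega) (by nlinarith)

/-! ### Gates that set the pivot bit -/

/-- The gate with target `p` which is controlled by the bits of `t` on the lines of `Q`. -/
def literalGate {n : ℕ} (Q : Finset (Fin n)) (t : Term n) (p : Fin n) : Toffoli n :=
  ⟨Q.filter (fun i => t i = true), Q.filter (fun i => ¬ t i = true), p⟩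

theorem literalGate_fires {n : ℕ} (Q : Finset (Fin n)) (t : Term n) (p : Fin n) (x : Term n) :
    (literalGate Q t p).Fires x ↔ ∀ i ∈ Q, x i = t i := by
  simp only [Toffoli.Fires, literalGate, Finset.mem_filter, and_imp]
  constructor
  · rintro ⟨h1, h2⟩ i hi
    cases ht : t i
    · exact h2 i hi (by simp [ht])
    · exact h1 i hi ht
  · intro h
    refine ⟨fun i hi ht => (h i hi).trans ht, fun i hi ht => (h i hi).trans ?_⟩
    simpa using ht

theorem literalGate_card {n : ℕ} (Q : Finset (Fin n)) (t : Term n) (p : Fin n) :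
    (literalGate Q t p).pos.card + (literalGate Q t p).neg.card = Q.card :=
  Finset.card_filter_add_card_filter_not _

theorem literalGate_valid {n : ℕ} {Q : Finset (Fin n)} (t : Term n) {p : Fin n} (hp : p ∉ Q) :
    (literalGate Q t p).Valid :=
  ⟨Finset.disjoint_filter_filter_not _ _ _, fun h => hp (Finset.mem_filter.1 h).1,
    fun h => hp (Finset.mem_filter.1 h).1⟩

/-- There are at most `c ≤ 2` lines other than `p` on which `w` differs from each of the terms. -/
def Separable (Fs : List (Term 6)) (c : ℕ) (p : Fin 6) (w : Term 6) : Prop :=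
  (∃ q, q ≠ p ∧ ∀ f ∈ Fs, f q ≠ w q) ∨
    (2 ≤ c ∧ ∃ q q', q ≠ p ∧ q' ≠ p ∧ q ≠ q' ∧ ∀ f ∈ Fs, f q ≠ w q ∨ f q' ≠ w q')

instance (Fs : List (Term 6)) (c : ℕ) (p : Fin 6) (w : Term 6) : Decidable (Separable Fs c p w) :=
  inferInstanceAs (Decidable (_ ∨ _))

/-- Every term whose bit `p` is not set, and which is not excluded, can be separated from
the terms of the list. -/
def AllSeparable (Fs : List (Term 6)) (r : Row) (p : Fin 6) : Prop :=
  ∀ w : Term 6, w p = false → w ∉ Fs → w ≠ bits 6 r.final → Separable Fs r.maxControls p w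

instance (Fs : List (Term 6)) (r : Row) (p : Fin 6) : Decidable (AllSeparable Fs r p) :=
  inferInstanceAs (Decidable (∀ _ : Term 6, _))

/-- The fixed terms are 0 outside the window. A 1 of `t` out there therefore separates it from all
of them by one control; otherwise `t` is a six-bit pattern covered by the finite check. -/
theorem exists_setPivot {n : ℕ} (hn : 6 ≤ n) {Fs : List (Term 6)} {r : Row} {p : Fin 6}
    (hc : 1 ≤ r.maxControls) (hr : InWindow r.final) (hs : AllSeparable Fs r p) {t : Term n}
    (hp : t (win hn p) = false) (htF : ∀ f ∈ Fs, t ≠ embed hn f) (ht : t ≠ bits n r.final) :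
    ∃ Q : Finset (Fin n), win hn p ∉ Q ∧ 1 ≤ Q.card ∧ Q.card ≤ r.maxControls ∧ Q.card ≤ 2 ∧
      ∀ f ∈ Fs, ∃ i ∈ Q, embed hn f i ≠ t i := by
  by_cases hx : ∀ i, (∀ j, win hn j ≠ i) → t i = false
  · have he := embed_comp_win hn hx
    set w := t ∘ win hn with hw
    have hwp : w p = false := hp
    rcases hs w hwp (fun h => htF w h he.symm)
      (fun h => ht (by rw [← he, h, embed_bits hn hr]))
      with ⟨q, hq, h⟩ | ⟨h2, q, q', hq, hq', hqq, h⟩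
    · refine ⟨{win hn q}, ?_, by simp, by simpa using hc, by simp, fun f hf => ?_⟩
      · simpa using hq.symm
      · refine ⟨win hn q, by simp, ?_⟩
        rw [embed_win]
        exact h f hf
    · have hne : win hn q ≠ win hn q' := fun e => hqq ((win hn).injective e)
      refine ⟨{win hn q, win hn q'}, ?_, ?_, ?_, ?_, fun f hf => ?_⟩
      · simpa using ⟨hq.symm, hq'.symm⟩
      · rw [Finset.card_pair hne]; omega
      · rw [Finset.card_pair hne]; exact h2
      · rw [Finset.card_pair hne]
      · rcases h f hf with h | h
        · refine ⟨win hn q, by simp, ?_⟩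
          rw [embed_win]
          exact h
        · refine ⟨win hn q', by simp, ?_⟩
          rw [embed_win]
          exact h
  · push Not at hx
    obtain ⟨i, hi, hti⟩ := hx
    refine ⟨{i}, ?_, by simp, by simpa using hc, by simp, fun f _ => ⟨i, by simp, ?_⟩⟩
    · simpa using hi p
    · rw [embed_of_ne hn _ hi]
      exact fun e => hti e.symm

/-! ### Correcting bits by CNOT gates -/

theorem cnotGate_act {n : ℕ} (c t : Fin n) (x : Term n) :
    (cnotGate c t).act x = if x c = true then flipBit t x else x := by
  rw [Toffoli.act_eq]; simp [cnotGate, Toffoli.Fires]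

theorem flipBit_castAdd_append {n a : ℕ} (t : Fin n) (x : Term n) (y : Term a) :
    flipBit (Fin.castAdd a t) (Fin.append x y : Term (n + a)) = Fin.append (flipBit t x) y := by
  funext i
  refine Fin.addCases (fun i => ?_) (fun j => ?_) i
  · simp [flipBit_apply]
  · have hne : Fin.natAdd n j ≠ Fin.castAdd a t := by
      intro e
      have := congrArg Fin.val e
      simp at this
      omega
    simp [flipBit_apply, hne]

theorem hasCost_cnotGate {n : ℕ} (a : ℕ) {c t : Fin n} (h : c ≠ t) :
    HasCost a [cnotGate c t] 1 (6 * Nat.dist (c : ℕ) (t : ℕ)) := by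
  have h' : Fin.castAdd a c ≠ Fin.castAdd a t := fun e => h (Fin.castAdd_injective n a e)
  have hne : Nat.dist (c : ℕ) (t : ℕ) ≠ 0 := fun e => h (Fin.ext (Nat.eq_of_dist_eq_zero e))
  refine HasCost.singleton (C := [.ctrl .x _ _ h']) (fun x y => ?_) le_rfl ?_
  · rw [Circuit.run_cons, Circuit.run_nil, act_cnot_ket, cnotGate_act, Fin.append_left,
      flipBit_castAdd_append]
    split_ifs <;> rfl
  · simp only [Circuit.lnn, List.map_cons, List.map_nil, List.sum_cons, List.sum_nil, Gate.lnn,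
      Fin.val_castAdd]
    omega

theorem hasCost_notGate {n : ℕ} (a : ℕ) (t : Fin n) : HasCost a [notGate t] 1 1 := by
  refine HasCost.singleton (C := [.not (Fin.castAdd a t)]) (fun x y => ?_) le_rfl le_rfl
  rw [Circuit.run_cons, Circuit.run_nil, act_not_ket, Toffoli.act_eq, flipBit_castAdd_append]
  simp [notGate, Toffoli.Fires]

theorem exists_nearest {n : ℕ} {F : Set (Term n)} {side : Fin n → Prop} {t : Term n} {j p : Fin n}
    (h : Candidate F side t j p) : ∃ q, Nearest F side t j q := by
  obtain ⟨q, hq, hmin⟩ := Set.exists_min_image {q | Candidate F side t j q}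
    (fun q : Fin n => Nat.dist (q : ℕ) (j : ℕ)) (Set.toFinite _) ⟨p, h⟩
  exact ⟨q, hq, hmin⟩

/-- The pivot is 1 in the present term and 0 in every fixed one, and the sweep never changes it, so
it is a candidate throughout. The nearest candidate is thus at most as far from the target as the
pivot, while its value 0 on the fixed terms keeps them in place. -/
theorem exists_sweep {n : ℕ} (a : ℕ) {F : Set (Term n)} {side : Fin n → Prop} {goal : Term n}
    {p : Fin n} (hside : side p) (hF : ∀ f ∈ F, f p = false) (hgoal : goal p = true)
    (js : List (Fin n)) (hjs : js.Nodup) (t : Term n) (ht : t p = true) :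
    ∃ gs, Sweep F side goal js t gs (fun i => if i ∈ js then goal i else t i) ∧
      Toffoli.run gs t = (fun i => if i ∈ js then goal i else t i) ∧
      (∀ f ∈ F, Toffoli.run gs f = f) ∧
      HasCost a gs js.length (js.map fun j : Fin n => 6 * Nat.dist (j : ℕ) (p : ℕ)).sum := by
  induction js generalizing t with
  | nil => exact
    ⟨[], by simpa using Sweep.nil t, by simp [Toffoli.run], fun _ _ => rfl, HasCost.nil⟩
  | cons j js ih =>
    rw [List.nodup_cons] at hjs
    by_cases hj : t j = goal j
    · obtain ⟨gs, h1, h2, h3, h4⟩ := ih hjs.2 t ht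
      have he : (fun i => if i ∈ js then goal i else t i) =
          fun i => if i ∈ j :: js then goal i else t i := by
        funext i
        by_cases hij : i = j
        · subst hij; simp [hj]
        · simp [hij]
      rw [he] at h1 h2
      refine ⟨gs, Sweep.skip hj h1, h2, h3, h4.mono (by simp) ?_⟩
      rw [List.map_cons, List.sum_cons]
      omega
    · have hjp : p ≠ j := by
        rintro rfl
        exact hj (ht.trans hgoal.symm)
      obtain ⟨q, hq, hmin⟩ := exists_nearest
        (show Candidate F side t j p from ⟨hjp, ht, hF, hside⟩)
      have hd := hmin p ⟨hjp, ht, hF, hside⟩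
      have hact : (cnotGate q j).act t = flipBit j t := by rw [cnotGate_act, if_pos hq.2.1]
      have htp : (cnotGate q j).act t p = true := by rw [hact, flipBit_ne hjp, ht]
      obtain ⟨gs, h1, h2, h3, h4⟩ := ih hjs.2 _ htp
      have he : (fun i => if i ∈ js then goal i else (cnotGate q j).act t i) =
          fun i => if i ∈ j :: js then goal i else t i := by
        funext i
        rw [hact]
        by_cases hij : i = j
        · subst hij
          simp only [hjs.1, if_false, flipBit_same, List.mem_cons, true_or, if_true]
          cases h5 : t i <;> cases h6 : goal i <;> simp_all
        · simp [hij, flipBit_ne hij]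
      rw [he] at h1 h2
      refine ⟨cnotGate q j :: gs, Sweep.fix hj ⟨hq, hmin⟩ h1, h2, fun f hf => ?_, ?_⟩
      · rw [Toffoli.run_cons, cnotGate_act, if_neg (by rw [hq.2.2.1 f hf]; simp), h3 f hf]
      · refine ((hasCost_cnotGate a hq.1).append h4).mono ?_ ?_
        · simp; omega
        · rw [List.map_cons, List.sum_cons, Nat.dist_comm (j : ℕ)]
          omega

/-! ### The total distance to a line near the middle -/

theorem two_mul_sum_dist (p e : ℕ) :
    2 * ∑ j ∈ Finset.range (p + e), Nat.dist j p + e = p * (p + 1) + e * e := by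
  have h0 : ∀ q ≤ p, 2 * ∑ j ∈ Finset.range q, Nat.dist j p + q * q = q * (2 * p + 1) := by
    intro q hq
    induction q with
    | zero => simp
    | succ q ih =>
      have h := ih (by omega)
      have hd : Nat.dist q p = p - q := by simp only [Nat.dist]; omega
      obtain ⟨s, rfl⟩ : ∃ s, p = q + s := ⟨p - q, by omega⟩
      rw [Finset.sum_range_succ, hd, Nat.add_sub_cancel_left]
      nlinarith
  induction e with
  | zero => have := h0 p le_rfl; simp only [add_zero]; nlinarith
  | succ e ih =>
    have hd : Nat.dist (p + e) p = e := by simp only [Nat.dist]; omega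
    rw [show p + (e + 1) = p + e + 1 from rfl, Finset.sum_range_succ, hd]
    nlinarith

/-- For a pivot at bounded distance from the middle the distances sum to `n²/4 + O(n)`; each unit of
distance is charged six gates. -/
theorem sum_dist_win_le {n : ℕ} (hn : 6 ≤ n) (p : Fin 6) :
    ((List.finRange n).map fun j : Fin n => 6 * Nat.dist (j : ℕ) (win hn p : ℕ)).sum ≤
      3 * n ^ 2 / 2 + 100 * n := by
  have h1 : ((List.finRange n).map fun j : Fin n => 6 * Nat.dist (j : ℕ) (win hn p : ℕ)).sum =
      6 * ∑ j ∈ Finset.range n, Nat.dist j (win hn p : ℕ) := by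
    rw [← Fin.sum_univ_def, Finset.mul_sum,
      ← Fin.sum_univ_eq_sum_range (fun j => 6 * Nat.dist j (win hn p : ℕ))]
  rw [h1, val_win]
  have hp := p.2
  obtain ⟨k, δ, hk⟩ : ∃ k δ, n = 2 * k + δ ∧ δ ≤ 1 ∧ 3 ≤ k := ⟨n / 2, n % 2, by omega⟩
  obtain ⟨rfl, hδ, hk3⟩ := hk
  obtain ⟨l, rfl⟩ : ∃ l, k = l + 3 := ⟨k - 3, by omega⟩
  have h2 : (2 * (l + 3) + δ) / 2 - 3 + (p : ℕ) = l + p := by omega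
  rw [h2]
  have h3 := two_mul_sum_dist (l + p) (2 * (l + 3) + δ - (l + p))
  rw [show l + (p : ℕ) + (2 * (l + 3) + δ - (l + p)) = 2 * (l + 3) + δ by omega] at h3
  obtain ⟨e, he, he'⟩ : ∃ e, 2 * (l + 3) + δ - (l + p) = l + e ∧ e + p = 6 + δ :=
    ⟨6 + δ - p, by omega⟩
  rw [he] at h3
  generalize ∑ j ∈ Finset.range (2 * (l + 3) + δ), Nat.dist j (l + p) = S at *
  generalize (p : ℕ) = p' at *
  have h4 : 12 * S ≤ 3 * (2 * (l + 3) + δ) ^ 2 + 200 * (2 * (l + 3) + δ) := by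
    have h5 : p' ≤ 5 := by omega
    have h6 : e ≤ 7 := by omega
    have h7 : p' * p' ≤ 25 := by nlinarith
    have h8 : e * e ≤ 49 := by nlinarith
    nlinarith
  omega

/-! ### The `π` circuits -/

/-- The finite conditions under which a row can be handled: `Fs` are the terms already fixed. -/
def RowSpec (Fs : List (Term 6)) (r : Row) (p : Fin 6) : Prop :=
  offset p = r.pivot ∧ (∀ f ∈ Fs, f p = false) ∧ bits 6 r.mid p = true ∧ 1 ≤ r.maxControls ∧
  (InWindow r.mid ∧ InWindow r.final ∧ ∀ L ∈ r.static, InWindow L.1 ∧ InWindow L.2) ∧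
  AllSeparable Fs r p ∧
  Toffoli.run (staticGates r p) (bits 6 r.mid) = bits 6 r.final ∧
  (∀ f ∈ Fs, Toffoli.run (staticGates r p) f = f) ∧
  ∀ g ∈ staticGates r p, g.Valid ∧ g.pos.card + g.neg.card ≤ 3

instance (Fs : List (Term 6)) (r : Row) (p : Fin 6) : Decidable (RowSpec Fs r p) :=
  inferInstanceAs (Decidable (_ ∧ _))

theorem staticGates_win {n : ℕ} (hn : 6 ≤ n) {r : Row} (p : Fin 6)
    (h : ∀ L, r.static = some L → InWindow L.1 ∧ InWindow L.2) :
    staticGates r (win hn p) = (staticGates r p).map (liftGate hn ∅) := by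
  unfold staticGates
  cases hr : r.static with
  | none => rfl
  | some L =>
    obtain ⟨h1, h2⟩ := h L hr
    simp [liftGate, map_linesAt hn h1, map_linesAt hn h2]

theorem length_staticGates_le {n : ℕ} (r : Row) (p : Fin n) : (staticGates r p).length ≤ 1 := by
  unfold staticGates
  cases r.static <;> simp

theorem sum_map_filter_add {α : Type*} (P : α → Prop) [DecidablePred P] (f : α → ℕ) (l : List α) :
    ((l.filter fun x => P x).map f).sum + ((l.filter fun x => ¬ P x).map f).sum =
      (l.map f).sum := by
  induction l with
  | nil => rfl
  | cons x l ih => by_cases h : P x <;> simp_all <;> omega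

/-- A bound for the number of elementary gates for one term after the insertion of SWAPs. -/
def rowLnn (n : ℕ) : ℕ := 3 * n ^ 2 / 2 + 1000 * n

/-- The gates for the pivot and the CNOTs do not fire on the fixed terms, and the static gate fixes
them by the finite check. The linear cost is one CNOT per line; both remaining gates are of bounded
size and are charged 43 each. -/
theorem exists_fixTerm {n a : ℕ} (hn : 6 ≤ n) (ha : a ≤ 1) {Fs : List (Term 6)} {r : Row}
    {p : Fin 6} (h : RowSpec Fs r p) {F : Set (Term n)} (hF : F = {f | ∃ w ∈ Fs, f = embed hn w})
    {t : Term n} (ht : t ∉ F) :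
    ∃ gs, FixTerm F r t gs ∧ Toffoli.run gs t = bits n r.final ∧
      (∀ f ∈ F, Toffoli.run gs f = f) ∧ HasCost a gs (n + 100) (rowLnn n) := by
  obtain ⟨hpiv, hfix, hmid, hmax, ⟨hwm, hwf, hws⟩, hsep, hsm, hsf, hsv⟩ := h
  have hFp : ∀ f ∈ F, f (win hn p) = false := by
    rw [hF]
    rintro f ⟨w, hw, rfl⟩
    rw [embed_win]
    exact hfix w hw
  by_cases htf : t = bits n r.final
  · exact ⟨[], Or.inl ⟨htf, rfl⟩, htf, fun _ _ => rfl, HasCost.nil.mono (by omega) (by omega)⟩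
  obtain ⟨g₀, hg₀, hp₀, hf₀, hc₀⟩ : ∃ g₀, SetPivot F (win hn p) r.maxControls t g₀ ∧
      Toffoli.run g₀ t (win hn p) = true ∧ (∀ f ∈ F, Toffoli.run g₀ f = f) ∧
      HasCost a g₀ 43 (300 * n) := by
    by_cases htp : t (win hn p) = true
    · exact ⟨[], Or.inl ⟨htp, rfl⟩, htp, fun _ _ => rfl, HasCost.nil.mono (by omega) (by omega)⟩
    · have htp' : t (win hn p) = false := by simpa using htp
      obtain ⟨Q, hQp, hQ1, hQc, hQ2, hQF⟩ := exists_setPivot hn hmax hwf hsep htp'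
        (fun f hf e => ht (by rw [hF]; exact ⟨f, hf, e⟩)) htf
      have hfire : (literalGate Q t (win hn p)).Fires t :=
        (literalGate_fires _ _ _ _).2 fun _ _ => rfl
      have hnot : ∀ f ∈ F, ¬ (literalGate Q t (win hn p)).Fires f := by
        rw [hF]
        rintro f ⟨w, hw, rfl⟩ hfi
        obtain ⟨i, hi, hne⟩ := hQF w hw
        exact hne ((literalGate_fires _ _ _ _).1 hfi i hi)
      refine ⟨[literalGate Q t (win hn p)], Or.inr ⟨htp', _, rfl, literalGate_valid t hQp, rfl,
        by rw [literalGate_card]; exact hQ1, by rw [literalGate_card]; exact hQc, hfire, hnot⟩,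
        ?_, ?_, ?_⟩
      · rw [Toffoli.run_cons, Toffoli.act_eq, if_pos hfire]
        show flipBit (win hn p) t (win hn p) = true
        rw [flipBit_same, htp']; rfl
      · intro f hf
        rw [Toffoli.run_cons, Toffoli.act_eq, if_neg (hnot f hf)]; rfl
      · exact hasCost_few hn ha (literalGate_valid t hQp) (by rw [literalGate_card]; omega)
  have hgoal : bits n r.mid (win hn p) = true := by
    rw [← embed_bits hn hwm, embed_win, hmid]
  obtain ⟨g₁, hs₁, hr₁, hf₁, hc₁⟩ := exists_sweep a (side := fun q => q ≤ win hn p)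
    (goal := bits n r.mid) (le_refl (win hn p)) hFp hgoal
    ((List.finRange n).filter (fun j => j ≤ win hn p)) ((List.nodup_finRange n).filter _) _ hp₀
  set t₁ : Term n := fun i => if i ∈ (List.finRange n).filter (fun j => j ≤ win hn p) then
    bits n r.mid i else Toffoli.run g₀ t i with ht₁
  have hp₁ : t₁ (win hn p) = true := by simp [ht₁, hgoal]
  obtain ⟨g₂, hs₂, hr₂, hf₂, hc₂⟩ := exists_sweep a (side := fun q => win hn p ≤ q)
    (goal := bits n r.mid) (le_refl (win hn p)) hFp hgoal
    ((List.finRange n).filter (fun j => win hn p < j)).reverse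
    (List.nodup_reverse.2 ((List.nodup_finRange n).filter _)) t₁ hp₁
  have ht₂ : (fun i => if i ∈ ((List.finRange n).filter (fun j => win hn p < j)).reverse then
      bits n r.mid i else t₁ i) = bits n r.mid := by
    funext i
    by_cases hi : win hn p < i
    · simp [hi]
    · have : i ≤ win hn p := not_lt.1 hi
      simp [hi, ht₁, this]
  rw [ht₂] at hs₂ hr₂
  have hstat := staticGates_win hn p hws
  have hcs : HasCost a (staticGates r (win hn p)) 43 (300 * n) := by
    rw [hstat]
    have hlen := length_staticGates_le r p
    rcases hsg : staticGates r p with _ | ⟨g, _ | ⟨g', L⟩⟩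
    · exact HasCost.nil.mono (by omega) (by omega)
    · obtain ⟨hv, hc⟩ := hsv g (by simp [hsg])
      obtain ⟨k1, k2⟩ := card_liftGate hn (Finset.empty_subset (outside hn)) g
      refine hasCost_few hn ha (liftGate_valid hn (Finset.empty_subset _) hv) ?_
      rw [k1, k2]
      simpa using hc
    · rw [hsg] at hlen
      simp at hlen
  refine ⟨g₀ ++ g₁ ++ g₂ ++ staticGates r (win hn p), Or.inr ⟨htf, win hn p, g₀, g₁, g₂, t₁,
    (offset_win hn p).trans hpiv, hg₀, hs₁, hs₂, rfl⟩, ?_, ?_, ?_⟩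
  · rw [Toffoli.run_append, Toffoli.run_append, Toffoli.run_append, hr₁, hr₂, hstat,
      ← embed_bits hn hwm, run_liftGate_empty, hsm, embed_bits hn hwf]
  · intro f hf
    rw [Toffoli.run_append, Toffoli.run_append, Toffoli.run_append, hf₀ f hf, hf₁ f hf, hf₂ f hf,
      hstat]
    rw [hF] at hf
    obtain ⟨w, hw, rfl⟩ := hf
    rw [run_liftGate_empty, hsf w hw]
  · have hsum := sum_map_filter_add (fun j : Fin n => j ≤ win hn p)
      (fun j : Fin n => 6 * Nat.dist (j : ℕ) (win hn p : ℕ)) (List.finRange n)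
    have hlen := sum_map_filter_add (fun j : Fin n => j ≤ win hn p) (fun _ => 1) (List.finRange n)
    have hle := sum_dist_win_le hn p
    simp only [not_le] at hsum hlen
    simp only [List.map_const', List.sum_replicate, smul_eq_mul, mul_one,
      List.length_finRange] at hlen
    refine (((hc₀.append hc₁).append hc₂).append hcs).mono ?_ ?_
    · rw [List.length_reverse]
      omega
    · rw [List.map_reverse, List.sum_reverse]
      rw [rowLnn]
      omega

/-- The final terms of the rows before row `i`, on six lines. -/
def fixedTerms (τ : CycleType) (i : Fin τ.size) : List (Term 6) :=
  ((List.finRange τ.size).filter (· < i)).map fun j => bits 6 (τ.row j).final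

/-- The finite conditions under which the terms of the type can be moved to their places. -/
def TypeSpec (τ : CycleType) : Prop :=
  ∀ i : Fin τ.size, InWindow (τ.row i).final ∧
    ((i : ℕ) ≠ 0 → ∃ p, RowSpec (fixedTerms τ i) (τ.row i) p)

instance (τ : CycleType) : Decidable (TypeSpec τ) :=
  inferInstanceAs (Decidable (∀ _ : Fin _, _))

theorem run_notGates {n : ℕ} (l : List (Fin n)) (hl : l.Nodup) (x : Term n) :
    Toffoli.run (l.map notGate) x = fun i => x i ^^ decide (i ∈ l) := by
  induction l generalizing x with
  | nil => simp [Toffoli.run]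
  | cons t l ih =>
    rw [List.nodup_cons] at hl
    have : (notGate t).act x = flipBit t x := by
      rw [Toffoli.act_eq]; simp [notGate, Toffoli.Fires]
    rw [List.map_cons, Toffoli.run_cons, this, ih hl.2]
    funext i
    by_cases hit : i = t
    · subst hit; simp [flipBit_same, hl.1]
    · simp [flipBit_ne hit, hit]

theorem run_fixFirst {n : ℕ} (r : Row) (t : Term n) :
    Toffoli.run (fixFirst r t) t = bits n r.final := by
  rw [fixFirst, run_notGates _ ((List.nodup_finRange n).filter _)]
  funext i
  cases h1 : t i <;> cases h2 : bits n r.final i <;> simp [h1, h2]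

theorem hasCost_notGates {n : ℕ} (a : ℕ) (l : List (Fin n)) :
    HasCost a (l.map notGate) l.length l.length := by
  induction l with
  | nil => exact HasCost.nil
  | cons t l ih =>
    refine ((hasCost_notGate a t).append ih).mono ?_ ?_ <;> simp <;> omega

theorem hasCost_fixFirst {n a : ℕ} (r : Row) (t : Term n) :
    HasCost a (fixFirst r t) (n + 100) (rowLnn n) := by
  have h : ((List.finRange n).filter (fun j => t j ≠ bits n r.final j)).length ≤ n :=
    (List.length_filter_le _ _).trans (List.length_finRange).le
  refine (hasCost_notGates a _).mono (by omega) ?_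
  rw [rowLnn]
  omega

/-- Induction over the terms not yet treated. The invariants are that the first `m` values are final
and that all values stay distinct, so the next term is never one of the fixed ones. -/
theorem exists_piSteps {n a : ℕ} (hn : 6 ≤ n) (ha : a ≤ 1) {τ : CycleType} (hτ : TypeSpec τ)
    (is : List (Fin τ.size)) (m : ℕ) (his : is = (List.finRange τ.size).drop m)
    (v : Fin τ.size → Term n) (hv : Function.Injective v)
    (hfix : ∀ j : Fin τ.size, (j : ℕ) < m → v j = bits n (τ.row j).final) :
    ∃ gs, PiSteps n τ is v gs ∧ (∀ j, Toffoli.run gs (v j) = bits n (τ.row j).final) ∧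
      HasCost a gs (is.length * (n + 100)) (is.length * rowLnn n) := by
  induction is generalizing m v with
  | nil =>
    refine ⟨[], PiSteps.nil v, fun j => hfix j ?_, HasCost.nil.mono (by simp) (by simp)⟩
    have := congrArg List.length his
    simp at this
    have := j.2
    omega
  | cons i is ih =>
    have hm : m < (List.finRange τ.size).length := by
      by_contra hm
      rw [List.drop_eq_nil_of_le (by omega)] at his
      simp at his
    rw [List.drop_eq_getElem_cons hm, List.cons.injEq] at his
    obtain ⟨hi, his⟩ := his
    have him : (i : ℕ) = m := by rw [hi]; simp
    obtain ⟨gs, hstep, hruni, hrunj, hc⟩ : ∃ gs,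
        (∀ hs, PiSteps n τ is (fun j => Toffoli.run gs (v j)) hs →
          PiSteps n τ (i :: is) v (gs ++ hs)) ∧
        Toffoli.run gs (v i) = bits n (τ.row i).final ∧
        (∀ j : Fin τ.size, j < i → Toffoli.run gs (v j) = v j) ∧
        HasCost a gs (n + 100) (rowLnn n) := by
      by_cases h0 : (i : ℕ) = 0
      · refine ⟨_, fun hs h => PiSteps.first h0 h, run_fixFirst _ _, fun j hj => ?_,
          hasCost_fixFirst _ _⟩
        have : (j : ℕ) < i := hj
        omega
      · obtain ⟨p, hp⟩ := (hτ i).2 h0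
        have hF : v '' {j | j < i} = {f | ∃ w ∈ fixedTerms τ i, f = embed hn w} := by
          ext f
          simp only [Set.mem_image, Set.mem_ofPred_eq, fixedTerms, List.mem_map, List.mem_filter,
            List.mem_finRange, true_and, decide_eq_true_eq]
          constructor
          · rintro ⟨j, hj, rfl⟩
            have : (j : ℕ) < i := hj
            exact ⟨_, ⟨j, hj, rfl⟩, by rw [hfix j (by omega), embed_bits hn (hτ j).1]⟩
          · rintro ⟨w, ⟨j, hj, rfl⟩, rfl⟩
            have : (j : ℕ) < i := hj
            exact ⟨j, hj, by rw [hfix j (by omega), embed_bits hn (hτ j).1]⟩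
        have hvi : v i ∉ v '' {j | j < i} := by
          rintro ⟨j, hj, e⟩
          have : j < i := hj
          rw [hv e] at this
          exact lt_irrefl _ this
        obtain ⟨gs, h1, h2, h3, h4⟩ := exists_fixTerm hn ha hp hF hvi
        exact ⟨gs, fun hs h => PiSteps.next h0 h1 h, h2, fun j hj => h3 _ ⟨j, hj, rfl⟩, h4⟩
    obtain ⟨hs, h1, h2, h3⟩ := ih (m + 1) his (fun j => Toffoli.run gs (v j))
      (hc.injective.comp hv) (fun j hj => by
        rcases Nat.lt_or_ge (j : ℕ) m with hlt | hge
        · have hji : j < i := by rw [Fin.lt_def]; omega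
          rw [hrunj j hji, hfix j hlt]
        · have hji : j = i := Fin.ext (by omega)
          rw [hji, hruni])
    refine ⟨gs ++ hs, hstep hs h1, fun j => by rw [Toffoli.run_append, h2],
      (hc.append h3).mono ?_ ?_⟩
    · rw [List.length_cons]; nlinarith
    · rw [List.length_cons]; nlinarith

theorem exists_isPi {n a : ℕ} (hn : 6 ≤ n) (ha : a ≤ 1) {τ : CycleType} (hτ : TypeSpec τ)
    {v : Fin τ.size → Term n} (hv : Function.Injective v) :
    ∃ gs, IsPi τ v gs ∧ (∀ j, Toffoli.run gs (v j) = bits n (τ.row j).final) ∧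
      HasCost a gs (τ.size * (n + 100)) (τ.size * rowLnn n) := by
  have := exists_piSteps (a := a) hn ha hτ (List.finRange τ.size) 0 rfl v hv (fun j hj => by omega)
  rwa [List.length_finRange] at this

/-- A subcircuit for an elementary cycle exists within the given cost. -/
def BlockCost (n a : ℕ) (τ : CycleType) (ℓ k : ℕ) : Prop :=
  ∀ v : Fin τ.size → Term n, Function.Injective v → ∃ B : Circuit (n + a),
    IsBlock τ v B ∧ Realizes B (cyclePerm τ v) ∧ B.length ≤ ℓ ∧ Circuit.lnn B ≤ k

/-- Since `π` carries the input terms to the prescribed ones, conjugation turns the fixed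
permutation into the desired cycles. The factor 2 accounts for `π` and `π⁻¹`. -/
theorem KappaCost.blockCost {n a : ℕ} (hn : 6 ≤ n) (ha : a ≤ 1) {τ : CycleType} (hτ : TypeSpec τ)
    {ℓ k : ℕ} (h : KappaCost n a τ ℓ k) :
    BlockCost n a τ (ℓ + 2 * (τ.size * (n + 100))) (k + 2 * (τ.size * rowLnn n)) := by
  intro v hv
  obtain ⟨K, hK, hl, hk⟩ := h
  obtain ⟨gs, hpi, hrun, hc⟩ := exists_isPi (a := a) hn ha hτ hv
  have hinj := hc.injective
  obtain ⟨Cs, hCs, hl', hk'⟩ := hc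
  have hC := realizes_flatten hCs
  refine ⟨Cs.flatten ++ K ++ Circuit.inv Cs.flatten, ⟨hv, gs, Cs, K, hpi, hCs, hK, rfl⟩,
    hC.conj hK fun x => ?_, ?_, ?_⟩
  · rw [kappaPerm, ← cyclePerm_comp_apply τ hinj]
    congr 2
    funext j
    exact (hrun j).symm
  · rw [List.length_append, List.length_append, Circuit.length_inv]
    omega
  · rw [Circuit.lnn_append, Circuit.lnn_append, Circuit.lnn_inv]
    omega

/-! ### Costs of the elementary cycles -/

/-- A subcircuit for an elementary cycle exists, and its cost is at most `s` times the cost that is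
allowed for one term. -/
def BlockBound (n a : ℕ) (τ : CycleType) (s : ℕ) : Prop :=
  BlockCost n a τ (s * (9 * n + 300)) (s * (40 * n ^ 2 + 2800 * n))

theorem BlockCost.blockBound {n a : ℕ} {τ : CycleType} {ℓ k s : ℕ} (h : BlockCost n a τ ℓ k)
    (hℓ : ℓ ≤ s * (9 * n + 300)) (hk : k ≤ s * (40 * n ^ 2 + 2800 * n)) : BlockBound n a τ s := by
  intro v hv
  obtain ⟨B, h1, h2, h3, h4⟩ := h v hv
  exact ⟨B, h1, h2, h3.trans hℓ, h4.trans hk⟩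

theorem typeSpec_type2 : TypeSpec type2 := by decide +kernel

theorem typeSpec_type22 : TypeSpec type22 := by decide +kernel

theorem typeSpec_type3 : TypeSpec type3 := by decide +kernel

theorem typeSpec_type33 : TypeSpec type33 := by decide +kernel

theorem typeSpec_type4 : TypeSpec type4 := by decide +kernel

theorem typeSpec_type42 : TypeSpec type42 := by decide +kernel

theorem typeSpec_type44 : TypeSpec type44 := by decide +kernel

theorem typeSpec_type5 : TypeSpec type5 := by decide +kernel

theorem typeSpec_type55 : TypeSpec type55 := by decide +kernel

/-- The unpaired types get a generous 8 charges, since only boundedly many of them occur. -/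
theorem blockBound_type2 {n a : ℕ} (hn : 6 ≤ n) (ha : a ≤ 1) (ha' : a = 1) :
    BlockBound n a type2 8 := by
  have hs : type2.size = 2 := rfl
  refine ((kappaCost_type2 hn ha ha').blockCost hn ha typeSpec_type2).blockBound ?_ ?_ <;>
    rw [hs]
  · omega
  · rw [rowLnn]; omega

theorem blockBound_type22 {n a : ℕ} (hn : 6 ≤ n) (ha : a ≤ 1) :
    BlockBound n a type22 4 := by
  have hs : type22.size = 4 := rfl
  refine ((kappaCost_type22 hn ha).blockCost hn ha typeSpec_type22).blockBound ?_ ?_ <;>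
    rw [hs]
  · omega
  · rw [rowLnn]; omega

theorem blockBound_type3 {n a : ℕ} (hn : 6 ≤ n) (ha : a ≤ 1) :
    BlockBound n a type3 8 := by
  have hs : type3.size = 3 := rfl
  refine ((kappaCost_type3 hn ha).blockCost hn ha typeSpec_type3).blockBound ?_ ?_ <;>
    rw [hs]
  · omega
  · rw [rowLnn]; omega

theorem blockBound_type33 {n a : ℕ} (hn : 6 ≤ n) (ha : a ≤ 1) :
    BlockBound n a type33 6 := by
  have hs : type33.size = 6 := rfl
  refine ((kappaCost_type33 hn ha).blockCost hn ha typeSpec_type33).blockBound ?_ ?_ <;>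
    rw [hs]
  · omega
  · rw [rowLnn]; omega

theorem blockBound_type4 {n a : ℕ} (hn : 6 ≤ n) (ha : a ≤ 1) (ha' : a = 1) :
    BlockBound n a type4 8 := by
  have hs : type4.size = 4 := rfl
  refine ((kappaCost_type4 hn ha ha').blockCost hn ha typeSpec_type4).blockBound ?_ ?_ <;>
    rw [hs]
  · omega
  · rw [rowLnn]; omega

theorem blockBound_type42 {n a : ℕ} (hn : 6 ≤ n) (ha : a ≤ 1) :
    BlockBound n a type42 8 := by
  have hs : type42.size = 6 := rfl
  refine ((kappaCost_type42 hn ha).blockCost hn ha typeSpec_type42).blockBound ?_ ?_ <;>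
    rw [hs]
  · omega
  · rw [rowLnn]; omega

theorem blockBound_type44 {n a : ℕ} (hn : 6 ≤ n) (ha : a ≤ 1) :
    BlockBound n a type44 8 := by
  have hs : type44.size = 8 := rfl
  refine ((kappaCost_type44 hn ha).blockCost hn ha typeSpec_type44).blockBound ?_ ?_ <;>
    rw [hs]
  · omega
  · rw [rowLnn]; omega

theorem blockBound_type5 {n a : ℕ} (hn : 6 ≤ n) (ha : a ≤ 1) :
    BlockBound n a type5 8 := by
  have hs : type5.size = 5 := rfl
  refine ((kappaCost_type5 hn ha).blockCost hn ha typeSpec_type5).blockBound ?_ ?_ <;>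
    rw [hs]
  · omega
  · rw [rowLnn]; omega

/-- The critical case: ten terms, but only 8 charges, because two segments split off longer cycles
may remove only `4 + 4` terms from the support. The leading term `52 + 2·10 = 8·9` is attained with
equality, and for SWAPs `288 + 2·10·3/2 = 318 ≤ 320`. -/
theorem blockBound_type55 {n a : ℕ} (hn : 6 ≤ n) (ha : a ≤ 1) :
    BlockBound n a type55 8 := by
  have hs : type55.size = 10 := rfl
  refine ((kappaCost_type55 hn ha).blockCost hn ha typeSpec_type55).blockBound ?_ ?_ <;>
    rw [hs]
  · omega
  · rw [rowLnn]; omega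

/-! ### Peeling segments off the cycles of a permutation -/

section Peel

open Equiv Function

variable {α : Type*}

/-- The length of the cycle of `x`. -/
noncomputable def per (ρ : Perm α) (x : α) : ℕ := minimalPeriod ρ x

/-- The first `m` elements of the cycle of `x`. -/
def seg (ρ : Perm α) (x : α) (m : ℕ) : List α := List.iterate ρ x m

theorem iterate_per (ρ : Perm α) (x : α) : ρ^[per ρ x] x = x := iterate_minimalPeriod

theorem per_eq_one_iff (ρ : Perm α) (x : α) : per ρ x = 1 ↔ ρ x = x :=
  minimalPeriod_eq_one_iff_isFixedPt

theorem length_seg (ρ : Perm α) (x : α) (m : ℕ) : (seg ρ x m).length = m :=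
  List.length_iterate _ _ _

theorem getElem_seg (ρ : Perm α) (x : α) (m i : ℕ) (h : i < (seg ρ x m).length) :
    (seg ρ x m)[i] = ρ^[i] x := List.getElem_iterate _ _ _ _ _

theorem mem_seg {ρ : Perm α} {x y : α} {m : ℕ} : y ∈ seg ρ x m ↔ ∃ i < m, y = ρ^[i] x :=
  List.mem_iterate

theorem mem_seg_self (ρ : Perm α) (x : α) {m : ℕ} (h : 0 < m) : x ∈ seg ρ x m :=
  mem_seg.2 ⟨0, h, rfl⟩

theorem nodup_seg {ρ : Perm α} {x : α} {m : ℕ} (h : m ≤ per ρ x) : (seg ρ x m).Nodup := by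
  rw [List.nodup_iff_injective_getElem]
  rintro ⟨i, hi⟩ ⟨j, hj⟩ e
  simp only [getElem_seg] at e
  rw [length_seg] at hi hj
  have := (iterate_eq_iterate_iff_of_lt_minimalPeriod (lt_of_lt_of_le hi h)
    (lt_of_lt_of_le hj h)).1 e
  exact Fin.ext this

theorem mem_periodicPts_perm [Finite α] (ρ : Perm α) (x : α) : x ∈ periodicPts ρ :=
  ρ.injective.mem_periodicPts x

theorem per_pos [Finite α] (ρ : Perm α) (x : α) : 0 < per ρ x :=
  minimalPeriod_pos_of_mem_periodicPts (mem_periodicPts_perm ρ x)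

theorem per_iterate [Finite α] (ρ : Perm α) (x : α) (i : ℕ) : per ρ (ρ^[i] x) = per ρ x :=
  minimalPeriod_apply_iterate (mem_periodicPts_perm ρ x) i

/-- A full cycle is closed under iteration. -/
theorem iterate_mem_seg_per [Finite α] (ρ : Perm α) (x : α) (i : ℕ) : ρ^[i] x ∈ seg ρ x (per ρ x) :=
  mem_seg.2 ⟨i % per ρ x, Nat.mod_lt _ (per_pos ρ x), iterate_mod_minimalPeriod_eq.symm⟩

theorem notMem_seg_apply [Finite α] {ρ : Perm α} {x y : α} {m : ℕ} (h : m = per ρ x)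
    (hy : y ∉ seg ρ x m) :
    ρ y ∉ seg ρ x m := by
  intro hm
  obtain ⟨i, hi, e⟩ := mem_seg.1 hm
  apply hy
  rw [h]
  rcases i with _ | i
  · have e' : ρ y = x := e
    have h1 : ρ (ρ^[per ρ x - 1] x) = x := by
      rw [← iterate_succ_apply' ρ, Nat.succ_eq_add_one, Nat.sub_add_cancel (per_pos ρ x),
        iterate_per]
    rw [ρ.injective (e'.trans h1.symm)]
    exact iterate_mem_seg_per ρ x _
  · rw [iterate_succ_apply' ρ] at e
    rw [ρ.injective e]
    exact iterate_mem_seg_per ρ x _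

variable [DecidableEq α]

/-- The permutation without the segment. -/
def peel (ρ : Perm α) (x : α) (m : ℕ) : Perm α := ρ * (seg ρ x m).formPerm⁻¹

theorem peel_mul_formPerm (ρ : Perm α) (x : α) (m : ℕ) :
    peel ρ x m * (seg ρ x m).formPerm = ρ := by rw [peel, inv_mul_cancel_right]

theorem peel_apply_of_notMem {ρ : Perm α} {x y : α} {m : ℕ} (hy : y ∉ seg ρ x m) :
    peel ρ x m y = ρ y := by
  rw [peel, Perm.mul_apply, Perm.inv_eq_iff_eq.2 (List.formPerm_apply_of_notMem hy).symm]

theorem formPerm_seg_apply {ρ : Perm α} {x : α} {m i : ℕ} (h : m ≤ per ρ x) (hi : i + 1 < m) :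
    (seg ρ x m).formPerm (ρ^[i] x) = ρ^[i + 1] x := by
  have := List.formPerm_apply_lt_getElem (seg ρ x m) (nodup_seg h) i (by rw [length_seg]; exact hi)
  rwa [getElem_seg, getElem_seg] at this

theorem formPerm_seg_apply_last {ρ : Perm α} {x : α} {m : ℕ} (h : m + 1 ≤ per ρ x) :
    (seg ρ x (m + 1)).formPerm (ρ^[m] x) = x := by
  have := List.formPerm_apply_getElem (seg ρ x (m + 1)) (nodup_seg h) m (by rw [length_seg]; omega)
  simp only [getElem_seg, length_seg, Nat.mod_self] at this
  exact this

theorem formPerm_seg_apply_of_iterate {ρ : Perm α} {x y : α} {m : ℕ} (h : m = per ρ x)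
    (hy : y ∈ seg ρ x m) : (seg ρ x m).formPerm y = ρ y := by
  obtain ⟨i, hi, rfl⟩ := mem_seg.1 hy
  rw [← iterate_succ_apply' ρ i x]
  rcases Nat.lt_or_ge (i + 1) m with h1 | h1
  · exact formPerm_seg_apply h.le h1
  · obtain rfl : m = i + 1 := by omega
    rw [formPerm_seg_apply_last h.le, Nat.succ_eq_add_one, h, iterate_per]

theorem peel_iterate_succ {ρ : Perm α} {x : α} {m i : ℕ} (h : m ≤ per ρ x) (hi : i + 1 < m) :
    peel ρ x m (ρ^[i + 1] x) = ρ^[i + 1] x := by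
  rw [peel, Perm.mul_apply, Perm.inv_eq_iff_eq.2 (formPerm_seg_apply h hi).symm,
    ← iterate_succ_apply' ρ i x]

/-- Peeling shortcuts the cycle: `x` jumps past the segment, whose other elements become fixed. A
proper segment thus removes `m - 1` terms, and a full cycle disappears. -/
theorem peel_self {ρ : Perm α} {x : α} {m : ℕ} (h : m ≤ per ρ x) (hm : 0 < m) :
    peel ρ x m x = ρ^[m] x := by
  obtain ⟨m, rfl⟩ : ∃ k, m = k + 1 := ⟨m - 1, by omega⟩
  rw [peel, Perm.mul_apply, Perm.inv_eq_iff_eq.2 (formPerm_seg_apply_last h).symm,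
    ← iterate_succ_apply' ρ m x]

theorem peel_of_mem {ρ : Perm α} {x y : α} {m : ℕ} (h : m ≤ per ρ x) (hy : y ∈ seg ρ x m)
    (hne : y ≠ x) : peel ρ x m y = y := by
  obtain ⟨i, hi, rfl⟩ := mem_seg.1 hy
  rcases i with _ | i
  · exact absurd rfl hne
  · exact peel_iterate_succ h hi

theorem peel_of_mem_full [Finite α] {ρ : Perm α} {x y : α} {m : ℕ} (h : m = per ρ x)
    (hy : y ∈ seg ρ x m) :
    peel ρ x m y = y := by
  by_cases hne : y = x
  · subst hne
    rw [peel_self h.le (h ▸ per_pos _ _), h, iterate_per]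
  · exact peel_of_mem h.le hy hne

/-- Successive peeling yields the two cycles in reverse order; being disjoint, they commute. -/
theorem peel_peel_mul {ρ : Perm α} {x y : α} {m k : ℕ} (h : m ≤ per ρ x) (hm2 : 2 ≤ m)
    (hk : k ≤ per (peel ρ x m) y) (hk2 : 2 ≤ k)
    (hd : List.Disjoint (seg ρ x m) (seg (peel ρ x m) y k)) :
    peel (peel ρ x m) y k * ((seg ρ x m).formPerm * (seg (peel ρ x m) y k).formPerm) = ρ := by
  have hdis := (List.formPerm_disjoint_iff (nodup_seg h) (nodup_seg hk)
    (by rw [length_seg]; exact hm2) (by rw [length_seg]; exact hk2)).2 hd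
  rw [hdis.commute.eq, ← mul_assoc, peel_mul_formPerm, peel_mul_formPerm]

variable [Fintype α]

theorem card_support_peel {ρ : Perm α} {x : α} {m : ℕ} (h : m ≤ per ρ x) (hm : 2 ≤ m) :
    (peel ρ x m).support.card + (m - 1) ≤ ρ.support.card := by
  have h1 : (peel ρ x m).support ⊆ ρ.support \ ((seg ρ x m).toFinset.erase x) := by
    intro y hy
    rw [Perm.mem_support] at hy
    rw [Finset.mem_sdiff, Finset.mem_erase, List.mem_toFinset, Perm.mem_support]
    refine ⟨fun e => hy ?_, fun ⟨h2, h3⟩ => hy (peel_of_mem h h3 h2)⟩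
    by_cases hs : y ∈ seg ρ x m
    · by_cases hx : y = x
      · have h5 : per ρ x = 1 := (per_eq_one_iff ρ x).2 (hx ▸ e)
        omega
      · exact peel_of_mem h hs hx
    · rw [peel_apply_of_notMem hs, e]
  have h2 : ((seg ρ x m).toFinset.erase x) ⊆ ρ.support := by
    intro y hy
    rw [Finset.mem_erase, List.mem_toFinset] at hy
    obtain ⟨i, hi, rfl⟩ := mem_seg.1 hy.2
    rw [Perm.mem_support]
    intro e
    have := (per_eq_one_iff ρ _).2 e
    rw [per_iterate] at this
    omega
  have h3 := Finset.card_le_card h1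
  rw [Finset.card_sdiff_of_subset h2, Finset.card_erase_of_mem
    (List.mem_toFinset.2 (mem_seg_self ρ x (by omega))), List.toFinset_card_of_nodup (nodup_seg h),
    length_seg] at h3
  have h4 := Finset.card_le_card h2
  rw [Finset.card_erase_of_mem
    (List.mem_toFinset.2 (mem_seg_self ρ x (by omega))), List.toFinset_card_of_nodup (nodup_seg h),
    length_seg] at h4
  omega

theorem card_support_peel_full {ρ : Perm α} {x : α} {m : ℕ} (h : m = per ρ x) (hm : 2 ≤ m) :
    (peel ρ x m).support.card + m ≤ ρ.support.card := by
  have h1 : (peel ρ x m).support ⊆ ρ.support \ (seg ρ x m).toFinset := by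
    intro y hy
    rw [Perm.mem_support] at hy
    rw [Finset.mem_sdiff, List.mem_toFinset, Perm.mem_support]
    have hs : y ∉ seg ρ x m := fun h3 => hy (peel_of_mem_full h h3)
    exact ⟨fun e => hy (by rw [peel_apply_of_notMem hs, e]), hs⟩
  have h2 : (seg ρ x m).toFinset ⊆ ρ.support := by
    intro y hy
    obtain ⟨i, hi, rfl⟩ := mem_seg.1 (List.mem_toFinset.1 hy)
    rw [Perm.mem_support]
    intro e
    have := (per_eq_one_iff ρ _).2 e
    rw [per_iterate] at this
    omega
  have h3 := Finset.card_le_card h1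
  have h4 := Finset.card_le_card h2
  rw [Finset.card_sdiff_of_subset h2] at h3
  rw [List.toFinset_card_of_nodup (nodup_seg h.le), length_seg] at h3 h4
  omega

theorem iterate_peel_of_notMem {ρ : Perm α} {x y : α} {m : ℕ} (h : m = per ρ x)
    (hy : y ∉ seg ρ x m) (i : ℕ) : (peel ρ x m)^[i] y = ρ^[i] y ∧ ρ^[i] y ∉ seg ρ x m := by
  induction i with
  | zero => exact ⟨rfl, hy⟩
  | succ i ih =>
    rw [iterate_succ_apply', iterate_succ_apply', ih.1]
    exact ⟨peel_apply_of_notMem ih.2, notMem_seg_apply h ih.2⟩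

theorem seg_peel_of_notMem {ρ : Perm α} {x y : α} {m : ℕ} (h : m = per ρ x)
    (hy : y ∉ seg ρ x m) (k : ℕ) : seg (peel ρ x m) y k = seg ρ y k := by
  apply List.ext_getElem
  · rw [length_seg, length_seg]
  · intro i h1 h2
    rw [getElem_seg, getElem_seg, (iterate_peel_of_notMem h hy i).1]

theorem per_peel_of_notMem {ρ : Perm α} {x y : α} {m : ℕ} (h : m = per ρ x)
    (hy : y ∉ seg ρ x m) : per (peel ρ x m) y = per ρ y := by
  refine minimalPeriod_eq_minimalPeriod_iff.2 fun i => ?_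
  rw [IsPeriodicPt, IsFixedPt, (iterate_peel_of_notMem h hy i).1]
  rfl

theorem per_peel_of_mem {ρ : Perm α} {x y : α} {m : ℕ} (h : m = per ρ x)
    (hy : y ∈ seg ρ x m) : per (peel ρ x m) y = 1 :=
  (per_eq_one_iff _ _).2 (peel_of_mem_full h hy)

/-- Cycles of length at least two of the remaining permutation are cycles of the former one. -/
theorem of_two_le_per_peel {ρ : Perm α} {x y : α} {m : ℕ} (h : m = per ρ x)
    (hy : 2 ≤ per (peel ρ x m) y) : y ∉ seg ρ x m ∧ per (peel ρ x m) y = per ρ y := by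
  have hs : y ∉ seg ρ x m := fun hs => by rw [per_peel_of_mem h hs] at hy; omega
  exact ⟨hs, per_peel_of_notMem h hs⟩

theorem sign_formPerm_seg {ρ : Perm α} {x : α} {m : ℕ} (h : m ≤ per ρ x) (hm : 2 ≤ m) :
    Perm.sign (seg ρ x m).formPerm = -(-1) ^ m := by
  have hc := List.isCycle_formPerm (nodup_seg h) (by rw [length_seg]; exact hm)
  rw [hc.sign, List.support_formPerm_of_nodup _ (nodup_seg h), List.toFinset_card_of_nodup
    (nodup_seg h), length_seg]
  intro y e
  have := congrArg List.length e
  rw [length_seg] at this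
  simp at this
  omega

theorem sign_peel {ρ : Perm α} {x : α} {m : ℕ} (h : m ≤ per ρ x) (hm : 2 ≤ m) :
    Perm.sign (peel ρ x m) = Perm.sign ρ * -(-1) ^ m := by
  rw [peel, Perm.sign_mul, Perm.sign_inv, sign_formPerm_seg h hm]

/-- After peeling, `x` is the only element of the first segment that may still be moved, so it is
the only possible common element. -/
theorem disjoint_seg_peel {ρ : Perm α} {x y : α} {m k : ℕ} (h : m ≤ per ρ x)
    (hk : k ≤ per (peel ρ x m) y) (hk2 : 2 ≤ k) (hx : x ∉ seg (peel ρ x m) y k) :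
    List.Disjoint (seg ρ x m) (seg (peel ρ x m) y k) := by
  intro z hz hz'
  have hne : z ≠ x := fun e => hx (e ▸ hz')
  have h1 := (per_eq_one_iff _ _).2 (peel_of_mem h hz hne)
  obtain ⟨i, hi, rfl⟩ := mem_seg.1 hz'
  rw [per_iterate] at h1
  omega

end Peel

/-! ### Decomposition into elementary cycles -/

section Refine

open Equiv Function

variable {α : Type*} [DecidableEq α] [Fintype α]

/-- The cycles of `ρ` lie in those of `σ`, and on a short cycle of `σ` the permutation `ρ` is
either the identity or equal to `σ`. -/
structure CycleRefines (σ ρ : Perm α) : Prop where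
  sameCycle : ∀ y, σ.SameCycle y (ρ y)
  short : ∀ y, (σ.cycleOf y).support.card < 6 → ρ y ≠ y → ∀ z, σ.SameCycle y z → ρ z = σ z

theorem CycleRefines.refl (σ : Perm α) : CycleRefines σ σ :=
  ⟨fun _ => Perm.sameCycle_apply_right.2 (Perm.SameCycle.refl _ _), fun _ _ _ _ _ => rfl⟩

/-- The segment of length `m` may be split off: it is a cycle of `ρ`, or it belongs to a long cycle
of `σ`. -/
structure Peelable (σ ρ : Perm α) (x : α) (m : ℕ) : Prop where
  two_le : 2 ≤ m
  le_per : m ≤ per ρ x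
  full_or_long : m = per ρ x ∨ 6 ≤ (σ.cycleOf x).support.card

variable {σ ρ : Perm α}

theorem CycleRefines.sameCycle_iterate (h : CycleRefines σ ρ) (x : α) (i : ℕ) :
    σ.SameCycle x (ρ^[i] x) := by
  induction i with
  | zero => exact Perm.SameCycle.refl _ _
  | succ i ih => rw [iterate_succ_apply']; exact ih.trans (h.sameCycle _)

theorem CycleRefines.per_le_card (h : CycleRefines σ ρ) {x : α} (hx : 2 ≤ per ρ x) :
    per ρ x ≤ (σ.cycleOf x).support.card := by
  have hρ : ρ x ≠ x := fun e => by rw [(per_eq_one_iff ρ x).2 e] at hx; omega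
  have hσ : σ x ≠ x := fun e => hρ ((h.sameCycle x).eq_of_left e).symm
  have hsub : (seg ρ x (per ρ x)).toFinset ⊆ (σ.cycleOf x).support := by
    intro y hy
    obtain ⟨i, -, rfl⟩ := mem_seg.1 (List.mem_toFinset.1 hy)
    exact Perm.mem_support_cycleOf_iff.2 ⟨h.sameCycle_iterate x i, Perm.mem_support.2 hσ⟩
  have := Finset.card_le_card hsub
  rwa [List.toFinset_card_of_nodup (nodup_seg le_rfl), length_seg] at this

theorem Peelable.full {x : α} {m : ℕ} (hm : 2 ≤ m) (hx : per ρ x = m) : Peelable σ ρ x m :=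
  ⟨hm, hx.ge, Or.inl hx.symm⟩

/-- A cycle of `ρ` longer than five forces the surrounding cycle of `σ` to have length at least six,
where free decomposition is allowed. -/
theorem CycleRefines.peelable_five (h : CycleRefines σ ρ) {x : α} (hx : 5 ≤ per ρ x) :
    Peelable σ ρ x 5 := by
  refine ⟨by omega, hx, ?_⟩
  have := h.per_le_card (x := x) (by omega)
  omega

/-- On a short cycle of `σ` where `ρ` is not the identity, the iterates of both permutations agree,
so the `ρ`-cycle exhausts the `σ`-cycle. -/
theorem CycleRefines.mem_seg_of_sameCycle (h : CycleRefines σ ρ) {x y : α}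
    (hs : (σ.cycleOf x).support.card < 6) (hx : ρ x ≠ x) (hy : σ.SameCycle x y) :
    y ∈ seg ρ x (per ρ x) := by
  have hit : ∀ i : ℕ, (σ ^ i) x = ρ^[i] x := by
    intro i
    induction i with
    | zero => rfl
    | succ i ih =>
      rw [iterate_succ_apply', pow_succ', Perm.mul_apply, ih,
        h.short x hs hx _ (h.sameCycle_iterate x i)]
  obtain ⟨i, -, rfl⟩ := hy.exists_pow_eq'
  rw [hit]
  exact iterate_mem_seg_per ρ x i

theorem Peelable.apply_ne {x : α} {m : ℕ} (h : Peelable σ ρ x m) : ρ x ≠ x := fun e => by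
  have h1 := h.le_per
  have h2 := h.two_le
  rw [(per_eq_one_iff ρ x).2 e] at h1
  omega

/-- On the cycle of `σ` through `x`, if it is short, the segment is everything and the result is the
identity; the other cycles of `σ` are untouched. -/
theorem CycleRefines.peel (h : CycleRefines σ ρ) {x : α} {m : ℕ} (hp : Peelable σ ρ x m) :
    CycleRefines σ (peel ρ x m) := by
  refine ⟨fun y => ?_, fun y hs hy z hz => ?_⟩
  · by_cases hm : y ∈ seg ρ x m
    · by_cases hne : y = x
      · subst hne
        rw [peel_self hp.le_per (by have := hp.two_le; omega)]
        exact h.sameCycle_iterate _ _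
      · rw [peel_of_mem hp.le_per hm hne]
    · rw [peel_apply_of_notMem hm]
      exact h.sameCycle y
  · by_cases hxy : σ.SameCycle x y
    · have hs' : (σ.cycleOf x).support.card < 6 := by rwa [hxy.cycleOf_eq]
      have hfull : m = per ρ x := hp.full_or_long.resolve_right (by omega)
      have := h.mem_seg_of_sameCycle hs' hp.apply_ne hxy
      rw [← hfull] at this
      exact absurd (peel_of_mem_full hfull this) hy
    · have hout : ∀ w, σ.SameCycle y w → w ∉ seg ρ x m := by
        intro w hw hwm
        obtain ⟨i, -, rfl⟩ := mem_seg.1 hwm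
        exact hxy ((h.sameCycle_iterate x i).trans hw.symm)
      rw [peel_apply_of_notMem (hout y (Perm.SameCycle.refl _ _))] at hy
      rw [peel_apply_of_notMem (hout z hz)]
      exact h.short y hs hy z hz

end Refine

theorem Peelable.comesFrom {n : ℕ} {σ ρ : Equiv.Perm (Term n)} (h : CycleRefines σ ρ) {x : Term n}
    {m : ℕ} (hp : Peelable σ ρ x m) : ComesFrom σ (seg ρ x m) := by
  have hsame : ∀ y ∈ seg ρ x m, σ.SameCycle x y := by
    intro y hy
    obtain ⟨i, -, rfl⟩ := mem_seg.1 hy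
    exact h.sameCycle_iterate x i
  refine ⟨fun y hy z hz => (hsame y hy).symm.trans (hsame z hz), fun y hy hs => ?_⟩
  rw [← (hsame y hy).cycleOf_eq] at hs ⊢
  have hfull : m = per ρ x := hp.full_or_long.resolve_right (by omega)
  ext1 z
  by_cases hz : z ∈ seg ρ x m
  · rw [formPerm_seg_apply_of_iterate hfull hz, (hsame z hz).cycleOf_apply]
    exact h.short x hs hp.apply_ne z (hsame z hz)
  · rw [List.formPerm_apply_of_notMem hz, Equiv.Perm.cycleOf_apply_of_not_sameCycle]
    intro hxz
    have := h.mem_seg_of_sameCycle hs hp.apply_ne hxz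
    rw [← hfull] at this
    exact hz this

/-- `ρ` can be synthesized within `s` times the cost that is allowed for one term. -/
def Synth {n : ℕ} (a : ℕ) (σ ρ : Equiv.Perm (Term n)) (s : ℕ) : Prop :=
  ∃ C : Circuit (n + a), Cascade σ ρ C ∧ Realizes C ρ ∧ C.length ≤ s * (9 * n + 300) ∧
    Circuit.lnn C ≤ s * (40 * n ^ 2 + 2800 * n)

/-! ### Splitting off one elementary cycle or pair -/

section Synth

variable {n a : ℕ} {σ ρ : Equiv.Perm (Term n)}

theorem Synth.one (s : ℕ) : Synth a σ (1 : Equiv.Perm (Term n)) s :=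
  ⟨[], Cascade.nil, Realizes.nil, by simp, by simp [Circuit.lnn]⟩

theorem Synth.mono {s s' : ℕ} (h : Synth a σ ρ s) (hs : s ≤ s') : Synth a σ ρ s' := by
  obtain ⟨C, h1, h2, h3, h4⟩ := h
  exact ⟨C, h1, h2, h3.trans (by gcongr), h4.trans (by gcongr)⟩

theorem Synth.cons {τ : CycleType} (hτ : τ ∈ elementaryTypes) {s s' : ℕ}
    (hB : BlockBound n a τ s) {v : Fin τ.size → Term n} (hv : Function.Injective v)
    {ls : List (List (Term n))} (hls : τ.cycles.map (List.map v) = ls)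
    (hc : ∀ l ∈ ls, ComesFrom σ l) {ρ' : Equiv.Perm (Term n)}
    (hρ : ρ' * (ls.map List.formPerm).prod = ρ) (h : Synth a σ ρ' s') : Synth a σ ρ (s + s') := by
  obtain ⟨C, h1, h2, h3, h4⟩ := h
  obtain ⟨B, hB1, hB2, hB3, hB4⟩ := hB v hv
  have hcyc : cyclePerm τ v = (ls.map List.formPerm).prod := by
    rw [← hls, List.map_map]; rfl
  rw [← hcyc] at hρ
  subst hρ
  refine ⟨B ++ C, Cascade.cons hτ (fun l hl => hc _ ?_) hB1 h1, ?_, ?_, ?_⟩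
  · rw [← hls]
    exact List.mem_map_of_mem hl
  · exact (hB2.append h2).congr fun x => by rw [Function.comp_apply, Equiv.Perm.mul_apply]
  · rw [List.length_append, add_mul]; omega
  · rw [Circuit.lnn_append, add_mul]; omega

theorem injective_get_comp {α : Type*} {k : ℕ} (l : List α) (hl : l.Nodup)
    (e : Fin k → Fin l.length) (he : Function.Injective e) : Function.Injective fun i => l.get (e i) :=
  (List.nodup_iff_injective_get.1 hl).comp he

theorem Synth.cons_one {τ : CycleType} (hτ : τ ∈ elementaryTypes) {s s' : ℕ}
    (hB : BlockBound n a τ s) (h : CycleRefines σ ρ) {x : Term n} {m : ℕ} (hp : Peelable σ ρ x m)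
    (e : Fin τ.size → Fin (seg ρ x m).length) (he : Function.Injective e)
    (hls : τ.cycles.map (List.map fun i => (seg ρ x m).get (e i)) = [seg ρ x m])
    (hs : Synth a σ (peel ρ x m) s') : Synth a σ ρ (s + s') := by
  refine Synth.cons hτ hB (injective_get_comp _ (nodup_seg hp.le_per) e he) hls ?_ ?_ hs
  · simpa using hp.comesFrom h
  · simpa using peel_mul_formPerm ρ x m

theorem Synth.cons_two {τ : CycleType} (hτ : τ ∈ elementaryTypes) {s s' : ℕ}
    (hB : BlockBound n a τ s) (h : CycleRefines σ ρ) {x y : Term n} {m k : ℕ}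
    (hp : Peelable σ ρ x m) (hq : Peelable σ (peel ρ x m) y k)
    (hx : x ∉ seg (peel ρ x m) y k)
    (e : Fin τ.size → Fin (seg ρ x m ++ seg (peel ρ x m) y k).length) (he : Function.Injective e)
    (hls : τ.cycles.map (List.map fun i => (seg ρ x m ++ seg (peel ρ x m) y k).get (e i)) =
      [seg ρ x m, seg (peel ρ x m) y k])
    (hs : Synth a σ (peel (peel ρ x m) y k) s') : Synth a σ ρ (s + s') := by
  have hd := disjoint_seg_peel hp.le_per hq.le_per hq.two_le hx
  refine Synth.cons hτ hB (injective_get_comp _ (List.nodup_append'.2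
    ⟨nodup_seg hp.le_per, nodup_seg hq.le_per, hd⟩) e he) hls ?_ ?_ hs
  · intro l hl
    simp only [List.mem_cons, List.not_mem_nil, or_false] at hl
    rcases hl with rfl | rfl
    · exact hp.comesFrom h
    · exact hq.comesFrom (h.peel hp)
  · simpa using peel_peel_mul hp.le_per hp.two_le hq.le_per hq.two_le hd

theorem Synth.cons_type55 (hn : 6 ≤ n) (ha : a ≤ 1) (h : CycleRefines σ ρ) {x y : Term n}
    {s : ℕ} (hp : Peelable σ ρ x 5) (hq : Peelable σ (peel ρ x 5) y 5)
    (hx : x ∉ seg (peel ρ x 5) y 5) (hs : Synth a σ (peel (peel ρ x 5) y 5) s) :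
    Synth a σ ρ (8 + s) :=
  Synth.cons_two (by simp [elementaryTypes]) (blockBound_type55 hn ha) h hp hq hx
    -- The type lists its cycles as `[0, 3, 1, 2, 9]` and `[4, 7, 5, 6, 8]`; the table inverts this,
    -- sending each term index to its place in the concatenated segments.
    (![0, 2, 3, 1, 5, 7, 8, 6, 9, 4] : Fin 10 → Fin 10)
    (show Function.Injective (![0, 2, 3, 1, 5, 7, 8, 6, 9, 4] : Fin 10 → Fin 10) by decide) rfl hs

theorem Synth.cons_type22 (hn : 6 ≤ n) (ha : a ≤ 1) (h : CycleRefines σ ρ) {x y : Term n}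
    {s : ℕ} (hp : Peelable σ ρ x 2) (hq : Peelable σ (peel ρ x 2) y 2)
    (hx : x ∉ seg (peel ρ x 2) y 2) (hs : Synth a σ (peel (peel ρ x 2) y 2) s) :
    Synth a σ ρ (4 + s) :=
  Synth.cons_two (by simp [elementaryTypes]) (blockBound_type22 hn ha) h hp hq hx
    (![0, 1, 2, 3] : Fin 4 → Fin 4)
    (show Function.Injective (![0, 1, 2, 3] : Fin 4 → Fin 4) by decide) rfl hs

theorem Synth.cons_type33 (hn : 6 ≤ n) (ha : a ≤ 1) (h : CycleRefines σ ρ) {x y : Term n}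
    {s : ℕ} (hp : Peelable σ ρ x 3) (hq : Peelable σ (peel ρ x 3) y 3)
    (hx : x ∉ seg (peel ρ x 3) y 3) (hs : Synth a σ (peel (peel ρ x 3) y 3) s) :
    Synth a σ ρ (6 + s) :=
  Synth.cons_two (by simp [elementaryTypes]) (blockBound_type33 hn ha) h hp hq hx
    (![0, 1, 2, 3, 4, 5] : Fin 6 → Fin 6)
    (show Function.Injective (![0, 1, 2, 3, 4, 5] : Fin 6 → Fin 6) by decide) rfl hs

theorem Synth.cons_type44 (hn : 6 ≤ n) (ha : a ≤ 1) (h : CycleRefines σ ρ) {x y : Term n}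
    {s : ℕ} (hp : Peelable σ ρ x 4) (hq : Peelable σ (peel ρ x 4) y 4)
    (hx : x ∉ seg (peel ρ x 4) y 4) (hs : Synth a σ (peel (peel ρ x 4) y 4) s) :
    Synth a σ ρ (8 + s) :=
  Synth.cons_two (by simp [elementaryTypes]) (blockBound_type44 hn ha) h hp hq hx
    (![0, 1, 2, 3, 4, 5, 6, 7] : Fin 8 → Fin 8)
    (show Function.Injective (![0, 1, 2, 3, 4, 5, 6, 7] : Fin 8 → Fin 8) by decide) rfl hs

theorem Synth.cons_type42 (hn : 6 ≤ n) (ha : a ≤ 1) (h : CycleRefines σ ρ) {x y : Term n}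
    {s : ℕ} (hp : Peelable σ ρ x 4) (hq : Peelable σ (peel ρ x 4) y 2)
    (hx : x ∉ seg (peel ρ x 4) y 2) (hs : Synth a σ (peel (peel ρ x 4) y 2) s) :
    Synth a σ ρ (8 + s) :=
  Synth.cons_two (by simp [elementaryTypes]) (blockBound_type42 hn ha) h hp hq hx
    (![0, 1, 2, 3, 4, 5] : Fin 6 → Fin 6)
    (show Function.Injective (![0, 1, 2, 3, 4, 5] : Fin 6 → Fin 6) by decide) rfl hs

theorem Synth.cons_type5 (hn : 6 ≤ n) (ha : a ≤ 1) (h : CycleRefines σ ρ) {x : Term n}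
    {s : ℕ} (hp : Peelable σ ρ x 5) (hs : Synth a σ (peel ρ x 5) s) : Synth a σ ρ (8 + s) :=
  Synth.cons_one (by simp [elementaryTypes]) (blockBound_type5 hn ha) h hp
    (![0, 2, 3, 1, 4] : Fin 5 → Fin 5)
    (show Function.Injective (![0, 2, 3, 1, 4] : Fin 5 → Fin 5) by decide) rfl hs

theorem Synth.cons_type3 (hn : 6 ≤ n) (ha : a ≤ 1) (h : CycleRefines σ ρ) {x : Term n}
    {s : ℕ} (hp : Peelable σ ρ x 3) (hs : Synth a σ (peel ρ x 3) s) : Synth a σ ρ (8 + s) :=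
  Synth.cons_one (by simp [elementaryTypes]) (blockBound_type3 hn ha) h hp
    (![0, 1, 2] : Fin 3 → Fin 3)
    (show Function.Injective (![0, 1, 2] : Fin 3 → Fin 3) by decide) rfl hs

theorem Synth.cons_type2 (hn : 6 ≤ n) (ha : a = 1) (h : CycleRefines σ ρ) {x : Term n}
    {s : ℕ} (hp : Peelable σ ρ x 2) (hs : Synth a σ (peel ρ x 2) s) : Synth a σ ρ (8 + s) :=
  Synth.cons_one (by simp [elementaryTypes]) (blockBound_type2 hn (by omega) ha) h hp
    (![0, 1] : Fin 2 → Fin 2)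
    (show Function.Injective (![0, 1] : Fin 2 → Fin 2) by decide) rfl hs

theorem Synth.cons_type4 (hn : 6 ≤ n) (ha : a = 1) (h : CycleRefines σ ρ) {x : Term n}
    {s : ℕ} (hp : Peelable σ ρ x 4) (hs : Synth a σ (peel ρ x 4) s) : Synth a σ ρ (8 + s) :=
  Synth.cons_one (by simp [elementaryTypes]) (blockBound_type4 hn (by omega) ha) h hp
    (![0, 1, 2, 3] : Fin 4 → Fin 4)
    (show Function.Injective (![0, 1, 2, 3] : Fin 4 → Fin 4) by decide) rfl hs

end Synth

/-! ### Selecting the elementary cycles -/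

section Select

open Equiv Function

variable {α : Type*} [Fintype α] {ρ : Perm α}

theorem eq_one_of_per_le_one (h : ∀ y, per ρ y ≤ 1) : ρ = 1 := by
  ext1 y
  exact (per_eq_one_iff ρ y).1 (le_antisymm (h y) (per_pos ρ y))

theorem per_of_mem_seg {x y : α} {m : ℕ} (hy : y ∈ seg ρ x m) : per ρ y = per ρ x := by
  obtain ⟨i, -, rfl⟩ := mem_seg.1 hy
  exact per_iterate ρ x i

/-- There is at most one cycle of length `m`. -/
def UniqueCycle (ρ : Perm α) (m : ℕ) : Prop :=
  ∀ x y, per ρ x = m → per ρ y = m → y ∈ seg ρ x m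

variable [DecidableEq α]

/-- Peeling a full cycle fixes `x`, so `x` cannot lie on a nontrivial cycle of what remains. -/
theorem notMem_seg_peel_self {x y : α} {m k : ℕ} (h : m = per ρ x)
    (hy : 2 ≤ per (peel ρ x m) y) : x ∉ seg (peel ρ x m) y k := by
  intro hx
  rw [← per_of_mem_seg hx, per_peel_of_mem h (mem_seg_self ρ x (h ▸ per_pos ρ x))] at hy
  omega

theorem per_peel_le {x : α} {m b : ℕ} (h : m = per ρ x) (hb : ∀ y, per ρ y ≤ b) (y : α) :
    per (peel ρ x m) y ≤ b := by
  rcases Nat.lt_or_ge (per (peel ρ x m) y) 2 with h1 | h1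
  · have := per_pos ρ y
    have := hb y
    omega
  · rw [(of_two_le_per_peel h h1).2]
    exact hb y

theorem UniqueCycle.peel {x : α} {m k : ℕ} (hk : 2 ≤ k) (hu : UniqueCycle ρ k)
    (h : m = per ρ x) : UniqueCycle (peel ρ x m) k := by
  intro y z hy hz
  obtain ⟨hy1, hy2⟩ := of_two_le_per_peel h (by omega : 2 ≤ per (_root_.peel ρ x m) y)
  obtain ⟨hz1, hz2⟩ := of_two_le_per_peel h (by omega : 2 ≤ per (_root_.peel ρ x m) z)
  rw [seg_peel_of_notMem h hy1]
  exact hu y z (by omega) (by omega)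

theorem UniqueCycle.per_peel_ne {x : α} {m : ℕ} (hm : 2 ≤ m) (hu : UniqueCycle ρ m)
    (h : m = per ρ x) (y : α) : per (_root_.peel ρ x m) y ≠ m := by
  intro hy
  obtain ⟨hy1, hy2⟩ := of_two_le_per_peel h (by omega : 2 ≤ per (_root_.peel ρ x m) y)
  exact hy1 (hu x y h.symm (by omega))

theorem per_peel_ne {x : α} {m k : ℕ} (hk : 2 ≤ k) (hρ : ∀ y, per ρ y ≠ k) (h : m = per ρ x)
    (y : α) : per (peel ρ x m) y ≠ k := by
  intro hy
  obtain ⟨-, hy2⟩ := of_two_le_per_peel h (by omega : 2 ≤ per (peel ρ x m) y)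
  exact hρ y (by omega)

/-- Two cycles of the same length can be split off together. -/
theorem Peelable.pair {σ : Perm α} {x y : α} {m : ℕ}
    (hm : 2 ≤ m) (hx : per ρ x = m) (hy : per ρ y = m) (hxy : y ∉ seg ρ x m) :
    Peelable σ ρ x m ∧ Peelable σ (_root_.peel ρ x m) y m ∧ x ∉ seg (_root_.peel ρ x m) y m ∧
      (_root_.peel (_root_.peel ρ x m) y m).support.card + 2 * m ≤ ρ.support.card ∧
      Perm.sign (_root_.peel (_root_.peel ρ x m) y m) = Perm.sign ρ ∧
      ∀ b, (∀ z, per ρ z ≤ b) → ∀ z, per (_root_.peel (_root_.peel ρ x m) y m) z ≤ b := by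
  have hp : Peelable σ ρ x m := .full hm hx
  have hy' : per (_root_.peel ρ x m) y = m := by rw [per_peel_of_notMem hx.symm hxy, hy]
  have hq : Peelable σ (_root_.peel ρ x m) y m := .full hm hy'
  refine ⟨hp, hq, notMem_seg_peel_self hx.symm (by omega), ?_, ?_, fun b hb =>
    per_peel_le hy'.symm (per_peel_le hx.symm hb)⟩
  · have h1 := card_support_peel_full hx.symm hm
    have h2 := card_support_peel_full hy'.symm hm
    omega
  · rw [sign_peel hy'.ge hm, sign_peel hx.ge hm, mul_assoc, neg_mul_neg, ← mul_pow]
    simp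

end Select

/-! ### Synthesis by induction on the support -/

section Synth

variable {n a : ℕ} {σ ρ : Equiv.Perm (Term n)}

theorem Synth.of_eq_one (h : ρ = 1) (s : ℕ) : Synth a σ ρ s := h ▸ Synth.one s

/-- What is left is a 4-cycle with a 2-cycle, one of the two alone, or nothing, so one block
suffices. -/
theorem synth_of_unique_two_four (hn : 6 ≤ n) (ha : a ≤ 1) (h : CycleRefines σ ρ)
    (hs : a = 1 ∨ Equiv.Perm.sign ρ = 1) (h4 : ∀ y, per ρ y ≤ 4) (h3 : ∀ y, per ρ y ≠ 3)
    (hu2 : UniqueCycle ρ 2) (hu4 : UniqueCycle ρ 4) : Synth a σ ρ 8 := by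
  by_cases hx : ∃ x, per ρ x = 4
  · obtain ⟨x, hx⟩ := hx
    have hp : Peelable σ ρ x 4 := Peelable.full (by omega) hx
    have h4' := per_peel_le hx.symm h4
    have h3' := per_peel_ne (by omega) h3 hx.symm
    have hn4 := hu4.per_peel_ne (by omega) hx.symm
    by_cases hy : ∃ y, per (peel ρ x 4) y = 2
    · obtain ⟨y, hy⟩ := hy
      have hq : Peelable σ (peel ρ x 4) y 2 := Peelable.full (by omega) hy
      refine (Synth.cons_type42 hn ha h hp hq (notMem_seg_peel_self hx.symm (by omega))
        (Synth.of_eq_one (eq_one_of_per_le_one fun z => ?_) 0)).mono le_rfl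
      have e1 := per_peel_le hy.symm h4' z
      have e2 := per_peel_ne (by omega) h3' hy.symm z
      have e3 := per_peel_ne (by omega) hn4 hy.symm z
      have e4 := (hu2.peel le_rfl hx.symm).per_peel_ne le_rfl hy.symm z
      omega
    · have h1 : peel ρ x 4 = 1 := eq_one_of_per_le_one fun z => by
        have e1 := h4' z
        have e2 := h3' z
        have e3 := hn4 z
        have e4 : per (peel ρ x 4) z ≠ 2 := fun e => hy ⟨z, e⟩
        omega
      -- A single 4-cycle is odd, so the even alternative is impossible and the ancilla is present.
      have ha1 : a = 1 := by
        refine hs.resolve_right fun e => ?_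
        have := sign_peel hx.ge (by omega)
        rw [h1, e, map_one] at this
        revert this
        decide
      exact (Synth.cons_type4 hn ha1 h hp (Synth.of_eq_one h1 0)).mono le_rfl
  · by_cases hy : ∃ y, per ρ y = 2
    · obtain ⟨y, hy⟩ := hy
      have hp : Peelable σ ρ y 2 := Peelable.full (by omega) hy
      have h1 : peel ρ y 2 = 1 := eq_one_of_per_le_one fun z => by
        have e1 := per_peel_le hy.symm h4 z
        have e2 := per_peel_ne (by omega) h3 hy.symm z
        have e3 := per_peel_ne (by omega) (fun w e => hx ⟨w, e⟩) hy.symm z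
        have e4 := hu2.per_peel_ne le_rfl hy.symm z
        omega
      have ha1 : a = 1 := by
        refine hs.resolve_right fun e => ?_
        have := sign_peel hy.ge le_rfl
        rw [h1, e, map_one] at this
        revert this
        decide
      exact (Synth.cons_type2 hn ha1 h hp (Synth.of_eq_one h1 0)).mono le_rfl
    · refine Synth.of_eq_one (eq_one_of_per_le_one fun z => ?_) 8
      have e1 := h4 z
      have e2 := h3 z
      have e3 : per ρ z ≠ 4 := fun e => hx ⟨z, e⟩
      have e4 : per ρ z ≠ 2 := fun e => hy ⟨z, e⟩
      omega

theorem synth_of_unique (hn : 6 ≤ n) (ha : a ≤ 1) (h : CycleRefines σ ρ)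
    (hs : a = 1 ∨ Equiv.Perm.sign ρ = 1) (h4 : ∀ y, per ρ y ≤ 4)
    (hu2 : UniqueCycle ρ 2) (hu3 : UniqueCycle ρ 3) (hu4 : UniqueCycle ρ 4) :
    Synth a σ ρ 16 := by
  by_cases hx : ∃ x, per ρ x = 3
  · obtain ⟨x, hx⟩ := hx
    have hp : Peelable σ ρ x 3 := Peelable.full (by omega) hx
    refine (Synth.cons_type3 hn ha h hp (synth_of_unique_two_four hn ha (h.peel hp) ?_
      (per_peel_le hx.symm h4) (hu3.per_peel_ne (by omega) hx.symm) (hu2.peel le_rfl hx.symm)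
      (hu4.peel (by omega) hx.symm))).mono le_rfl
    refine hs.imp_right fun e => ?_
    rw [sign_peel hx.ge (by omega), e]
    decide
  · exact (synth_of_unique_two_four hn ha h hs h4 (fun y e => hx ⟨y, e⟩) hu2 hu4).mono (by omega)

/-- Pairs of full cycles of equal length `m` remove `2m` terms, which covers the 4, 6 or 8 charges
of their block. Pairing preserves the sign; the final 16 pays for a lone 3-cycle and one more block.
-/
theorem synth_of_per_le_four (hn : 6 ≤ n) (ha : a ≤ 1) (h : CycleRefines σ ρ)
    (hs : a = 1 ∨ Equiv.Perm.sign ρ = 1) (h4 : ∀ y, per ρ y ≤ 4) :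
    Synth a σ ρ (ρ.support.card + 16) := by
  induction hN : ρ.support.card using Nat.strong_induction_on generalizing ρ with
  | _ N ih =>
    by_cases hu2 : UniqueCycle ρ 2
    · by_cases hu3 : UniqueCycle ρ 3
      · by_cases hu4 : UniqueCycle ρ 4
        · exact (synth_of_unique hn ha h hs h4 hu2 hu3 hu4).mono (by omega)
        · unfold UniqueCycle at hu4
          push Not at hu4
          obtain ⟨x, y, hx, hy, hxy⟩ := hu4
          obtain ⟨hp, hq, hxq, hc, hsg, hb⟩ := Peelable.pair (σ := σ) (by omega) hx hy hxy
          exact (Synth.cons_type44 hn ha h hp hq hxq (ih _ (by omega) ((h.peel hp).peel hq)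
            (by rwa [hsg]) (hb 4 h4) rfl)).mono (by omega)
      · unfold UniqueCycle at hu3
        push Not at hu3
        obtain ⟨x, y, hx, hy, hxy⟩ := hu3
        obtain ⟨hp, hq, hxq, hc, hsg, hb⟩ := Peelable.pair (σ := σ) (by omega) hx hy hxy
        exact (Synth.cons_type33 hn ha h hp hq hxq (ih _ (by omega) ((h.peel hp).peel hq)
          (by rwa [hsg]) (hb 4 h4) rfl)).mono (by omega)
    · unfold UniqueCycle at hu2
      push Not at hu2
      obtain ⟨x, y, hx, hy, hxy⟩ := hu2
      obtain ⟨hp, hq, hxq, hc, hsg, hb⟩ := Peelable.pair (σ := σ) (by omega) hx hy hxy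
      exact (Synth.cons_type22 hn ha h hp hq hxq (ih _ (by omega) ((h.peel hp).peel hq)
        (by rwa [hsg]) (hb 4 h4) rfl)).mono (by omega)

theorem sign_peel_five {x : Term n} (h : 5 ≤ per ρ x) :
    Equiv.Perm.sign (peel ρ x 5) = Equiv.Perm.sign ρ := by
  rw [sign_peel h (by omega)]
  simp [show ((-1 : ℤˣ)) ^ 5 = -1 by decide]

/-- If each five-element segment of a cycle contains `x`, the cycle has at most five elements. -/
theorem per_le_five {x y : Term n} (h : ∀ z, 5 ≤ per ρ z → x ∈ seg ρ z 5) (hy : 5 ≤ per ρ y) :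
    per ρ y ≤ 5 := by
  obtain ⟨i, -, hi⟩ := mem_seg.1 (h y hy)
  have hx : per ρ x = per ρ y := by rw [hi, per_iterate]
  by_contra hlt
  -- The segment starting just after `x` meets `x` only by going round the whole cycle, within at
  -- most five steps.
  obtain ⟨j, hj, e⟩ := mem_seg.1 (h (ρ x) (by rw [show ρ x = ρ^[1] x from rfl, per_iterate]; omega))
  rw [← Function.iterate_succ_apply] at e
  have := (Function.iterate_eq_iterate_iff_of_lt_minimalPeriod (f := ρ) (x := x) (m := 0)
    (n := j + 1) (per_pos ρ x) (by change _ < per ρ x; omega)).1 e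
  omega

/-- Each paired step removes at least `4 + 4` terms and uses 8 charges. Pairing fails only if every
five-element segment left contains `x`; then at most one long cycle is left, of length exactly five.
Two single 5-cycles and the 16 of the short case give the constant 32. -/
theorem synth_of_cycleRefines (hn : 6 ≤ n) (ha : a ≤ 1) (h : CycleRefines σ ρ)
    (hs : a = 1 ∨ Equiv.Perm.sign ρ = 1) : Synth a σ ρ (ρ.support.card + 32) := by
  induction hN : ρ.support.card using Nat.strong_induction_on generalizing ρ with
  | _ N ih =>
    by_cases h4 : ∀ y, per ρ y ≤ 4
    · exact (synth_of_per_le_four hn ha h hs h4).mono (by omega)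
    · push Not at h4
      obtain ⟨x, hx⟩ := h4
      have hp := h.peelable_five hx
      have hr := h.peel hp
      have hc := card_support_peel hp.le_per hp.two_le
      have hsx : a = 1 ∨ Equiv.Perm.sign (peel ρ x 5) = 1 := by rwa [sign_peel_five hp.le_per]
      by_cases hex : ∃ y, 5 ≤ per (peel ρ x 5) y ∧ x ∉ seg (peel ρ x 5) y 5
      · obtain ⟨y, hy, hxy⟩ := hex
        have hq := hr.peelable_five hy
        have hc' := card_support_peel hq.le_per hq.two_le
        exact (Synth.cons_type55 hn ha h hp hq hxy (ih _ (by omega) (hr.peel hq)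
          (by rwa [sign_peel_five hq.le_per]) rfl)).mono (by omega)
      · push Not at hex
        by_cases h4 : ∀ y, per (peel ρ x 5) y ≤ 4
        · exact (Synth.cons_type5 hn ha h hp (synth_of_per_le_four hn ha hr hsx h4)).mono
            (by omega)
        · push Not at h4
          obtain ⟨y, hy⟩ := h4
          have hy5 : 5 = per (peel ρ x 5) y := le_antisymm hy (per_le_five hex hy)
          have hq := hr.peelable_five hy
          have hc' := card_support_peel hq.le_per hq.two_le
          refine (Synth.cons_type5 hn ha h hp (Synth.cons_type5 hn ha hr hq
            (synth_of_per_le_four hn ha (hr.peel hq) (by rwa [sign_peel_five hq.le_per])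
              fun z => ?_))).mono (by omega)
          -- A further long cycle would also contain `x`, hence coincide with the cycle of `y`,
          -- which has just been removed.
          by_contra hz
          obtain ⟨hz1, hz2⟩ := of_two_le_per_peel hy5
            (by omega : 2 ≤ per (peel (peel ρ x 5) y 5) z)
          have hxz := hex z (by omega)
          refine notMem_seg_peel_self (k := 5) hy5
            (by omega : 2 ≤ per (peel (peel ρ x 5) y 5) z) ?_
          obtain ⟨j, -, hj⟩ := mem_seg.1 hxz
          have hn := (iterate_peel_of_notMem hy5 hz1 j).2
          rw [← hj] at hn
          exact absurd (hex y hy) hn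

end Synth

/-! ### Comparison with the asymptotic bounds -/

theorem ancillae_le_one {n : ℕ} (σ : Equiv.Perm (Term n)) : ancillae σ ≤ 1 := by
  unfold ancillae; split <;> omega

theorem synth_self {n : ℕ} (hn : 6 ≤ n) (σ : Equiv.Perm (Term n)) :
    Synth (ancillae σ) σ σ (2 ^ n + 32) := by
  refine (synth_of_cycleRefines hn (ancillae_le_one σ) (CycleRefines.refl σ) ?_).mono ?_
  · unfold ancillae; split <;> simp_all
  · have : σ.support.card ≤ 2 ^ n := by
      simpa using Finset.card_le_univ σ.support
    omega

theorem isLittleO_max_zero {f g : ℕ → ℝ} (h : ∀ᶠ n in Filter.atTop, f n ≤ 0) :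
    (fun n => max 0 (f n)) =o[Filter.atTop] g := by
  refine (Asymptotics.isLittleO_zero g Filter.atTop).congr' ?_ Filter.EventuallyEq.rfl
  filter_upwards [h] with n hn
  exact (max_eq_left hn).symm

theorem theorem1 :
    ∃ r₁ r₂ : ℕ → ℝ,
      r₁ =o[Filter.atTop] (fun n : ℕ => (n : ℝ) ^ 2) ∧
      r₂ =o[Filter.atTop] (fun n : ℕ => (n : ℝ) ^ 3) ∧
      ∀ n : ℕ, 6 ≤ n → ∀ σ : Equiv.Perm (Term n),
        ∃ C D : Circuit (n + ancillae σ),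
          CycleSynthesis σ C ∧ Realizes C σ ∧
          (C.length : ℝ) ≤ 9.4 * n * 2 ^ n - 18.8 * 2 ^ n + r₁ n ∧
          LNNVersion C D ∧ (∀ g ∈ D, g.IsLNN) ∧ Realizes D σ ∧
          (D.length : ℝ) ≤ 42.4 * (n : ℝ) ^ 2 * 2 ^ n + r₂ n := by
  -- The error functions are the positive parts of the excess of the proven over the stated main
  -- terms. The coefficient margins 0.4 and 2.4 outweigh the lower-order terms from `n = 2000` on,
  -- so both vanish there and are trivially `o`.
  refine ⟨fun n => max 0 ((2 ^ n + 32) * (9 * n + 300) - (9.4 * n * 2 ^ n - 18.8 * 2 ^ n)),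
    fun n => max 0 ((2 ^ n + 32) * (40 * (n : ℝ) ^ 2 + 2800 * n) - 42.4 * (n : ℝ) ^ 2 * 2 ^ n),
    isLittleO_max_zero ?_, isLittleO_max_zero ?_, fun n hn σ => ?_⟩
  · filter_upwards [Filter.eventually_ge_atTop 2000] with n hn
    have h1 : (2000 : ℝ) ≤ n := by exact_mod_cast hn
    have h2 : (n : ℝ) ≤ 2 ^ n := by exact_mod_cast n.lt_two_pow_self.le
    nlinarith [mul_le_mul h1 h2 (by positivity) (by positivity)]
  · filter_upwards [Filter.eventually_ge_atTop 2000] with n hn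
    have h1 : (2000 : ℝ) ≤ n := by exact_mod_cast hn
    have h2 : (n : ℝ) ≤ 2 ^ n := by exact_mod_cast n.lt_two_pow_self.le
    have h3 : (2 ^ n + 32) * (40 * (n : ℝ) ^ 2 + 2800 * n) - 42.4 * (n : ℝ) ^ 2 * 2 ^ n =
      n * (2 ^ n * (2800 - 2.4 * n) + 32 * (40 * n + 2800)) := by ring
    rw [h3]
    refine mul_nonpos_of_nonneg_of_nonpos (by positivity) ?_
    nlinarith [mul_le_mul h1 h2 (by positivity) (by positivity)]
  · obtain ⟨C, h1, h2, h3, h4⟩ := synth_self hn σ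
    obtain ⟨D, h5, h6, h7, h8⟩ := exists_lnnVersion C
    refine ⟨C, D, h1, h2, ?_, h5, h6, fun x y => by rw [h7, h2], ?_⟩
    · have : (C.length : ℝ) ≤ (2 ^ n + 32) * (9 * n + 300) := by exact_mod_cast h3
      linarith [le_max_right (0 : ℝ)
        ((2 ^ n + 32) * (9 * n + 300) - (9.4 * n * 2 ^ n - 18.8 * 2 ^ n))]
    · have : (D.length : ℝ) ≤ (2 ^ n + 32) * (40 * (n : ℝ) ^ 2 + 2800 * n) := by
        rw [h8]; exact_mod_cast h4
      linarith [le_max_right (0 : ℝ)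
        ((2 ^ n + 32) * (40 * (n : ℝ) ^ 2 + 2800 * n) - 42.4 * (n : ℝ) ^ 2 * 2 ^ n)]
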